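/- **Setting.** Let $1\le d\le n$ and let $\Omega\subset\mathbb R^n$ be open. $G_{d,n}$ is the Grassmannian of $d$-planes of $\mathbb R^n$; a plane is identified with the orthogonal projection onto it, and the metric is the operator norm. A $d$-varifold in $\Omega$ is a Radon measure $V$ on $\Omega\times G_{d,n}$; its mass $\|V\|$ is its projection on $\Omega$; $V=\|V\|\otimes\nu_y$ denotes a disintegration into probability measures $\nu_y$ on $G_{d,n}$, and $c^V(y)=\int S\,d\nu_y(S)$. With $\nabla^S\varphi=S\nabla\varphi$, put $\delta_{ijk}V(\varphi)=\int S_{jk}(\nabla^S\varphi(y))_i\,dV(y,S)$ for $\varphi\in C^1_c(\Omega)$, $i,j,k\in\{1,\dots,n\}$. If these distributions are signed Radon measures in an open set $U$, then $\beta^V_{ijk}\in L^1_{loc}(\|V\|)$ is defined in $U$ by $\delta_{ijk}V=-\beta^V_{ijk}\|V\|+(\delta_{ijk}V)_s$ with $(\delta_{ijk}V)_s$ singular with respect to $\|V\|$. Let $\rho,\xi:[0,\infty)\to[0,\infty)$ be $C^1$ and vanish on $[1,\infty)$, with $\rho$ non-increasing, $\rho'(0)=0$, $\rho'$ Lipschitz,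 $\xi>0$ on $(0,1)$ and $\int_{\mathbb R^n}\rho(|y|)\,dy=\int_{\mathbb R^n}\xi(|y|)\,dy=1$. Put $\rho_\epsilon(y)=\epsilon^{-n}\rho(|y|/\epsilon)$, $\xi_\epsilon(y)=\epsilon^{-n}\xi(|y|/\epsilon)$, $C_f=d\,\omega_d\int_0^1 f(r)r^{d-1}dr$ for $f=\rho,\xi$ (where $\omega_d$ is the volume of the unit ball of $\mathbb R^d$), and $$\beta_{ijk}^{V,\epsilon}(y)=-\frac{C_\xi}{C_\rho}\,\frac{\int S_{jk}(\nabla^S\rho_\epsilon(w-y))_i\,dV(w,S)}{(\|V\|*\xi_\epsilon)(y)},\qquad \beta_{ijk}^{V,\epsilon,\perp}(y)=\beta_{ijk}^{V,\epsilon}(y)-c^V_{jk}(y)\Big(c^V(y)\sum_q\beta^{V,\epsilon}_{q\,\cdot\,q}(y)\Big)_i .$$ $A^{V,\epsilon,\perp}(y)=(a_{ijk})$ is the unique solution of the linear system $a_{ijk}+c^V_{jk}(y)\sum_q a_{qiq}=\beta^{V,\epsilon,\perp}_{ijk}(y)$, $1\le i,j,k\le n$. For open $B\subset\Omega$, $\Delta_B(\mu,\mu')$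 is the supremum of $|\int\varphi\,d\mu-\int\varphi\,d\mu'|$ over the $1$-Lipschitz functions $\varphi$ on $\Omega$ with $\|\varphi\|_\infty\le1$ and $\operatorname{supp}\varphi\subset B$; $B^{\eta}$ denotes the open $\eta$-neighbourhood of $B$. **Hypotheses.** Let $M\subset\Omega$ be an embedded $d$-dimensional $C^2$ submanifold without boundary, with $\mathcal H^d$ restricted to $M$ locally finite in $\Omega$, and let $V=v(M,1)$, i.e. $\|V\|=\mathcal H^d|_M$ and $\nu_y=\delta_{T_yM}$ for $y\in M$. Let $P$ be a $C^1$ extension of $y\mapsto T_yM$, with values in $L(\mathbb R^n;\mathbb R^n)$, to an open neighbourhood of $M$. Let $V_h=\|V_h\|\otimes\nu^h_y$, $h\in\mathbb N$, be $d$-varifolds in $\Omega$ with given disintegrations. Let $x\in M$ and $z_h\in\Omega\cap\operatorname{supp}\|V_h\|$ with $z_h\to x$. Let $(\eta_h),(d_{1,h}),(d_{2,h}),(\epsilon_h)$ be positive, non-increasing sequences tending to $0$ such that, for some neighbourhood $U_0$ of $x$, every ball $B\subset\Omega\cap U_0$ centered in $\operatorname{supp}\|V\|$ and every $h$ satisfy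 $$\Delta_B(\|V\|,\|V_h\|)\le d_{1,h}\min\big(\|V\|(B^{\eta_h}),\|V_h\|(B^{\eta_h})\big),$$ and such that, for $h$ large enough, $$\sup_{y\in B_{\epsilon_h+|x-z_h|}(x)\cap\operatorname{supp}\|V_h\|}\int\|P(y)-S\|\,d\nu^h_y(S)\le d_{2,h}.$$ **Conclusion.** 1. If $\eta_h=O(\epsilon_h)$ and $d_{1,h}+|x-z_h|=o(\epsilon_h)$, then there is $C>0$ such that, for $h$ large enough and all $i,j,k$, $$\max\Big\{\big|\beta_{ijk}^{V_h,\epsilon_h,\perp}(z_h)-\beta_{ijk}^{V,\epsilon_h,\perp}(x)\big|,\ \big|A_{ijk}^{V_h,\epsilon_h,\perp}(z_h)-A_{ijk}^{V,\epsilon_h,\perp}(x)\big|\Big\}\le C\,\frac{d_{1,h}+d_{2,h}+|x-z_h|}{\epsilon_h}.$$ 2. In some open neighbourhood $U\subset\Omega$ of $x$, $V$ has locally bounded variations and $\beta^V$ has a representative that is continuous on $M\cap U$. If $d_{1,h}+d_{2,h}+\eta_h+|x-z_h|=o(\epsilon_h)$, then $\beta_{ijk}^{V_h,\epsilon_h,\perp}(z_h)\to\beta^V_{ijk}(x)$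 for all $i,j,k$, where $\beta^V_{ijk}(x)$ is the value at $x$ of any representative that is continuous at $x$ along $M$. -/

import Mathlib

open Filter Topology MeasureTheory

noncomputable section

/-- `ℝⁿ` with its Euclidean norm. -/
abbrev Eucl (n : ℕ) : Type := EuclideanSpace ℝ (Fin n)

/-- The Grassmannian of `d`-dimensional linear subspaces of `ℝⁿ`. A subspace is represented by the
orthogonal projection onto it; the distance is the operator norm of the difference of projections
and the σ-algebra is the Borel one. -/
abbrev Gr (d n : ℕ) : Type :=
  {S : Eucl n →L[ℝ] Eucl n //
    ∃ T : Submodule ℝ (Eucl n), Module.finrank ℝ T = d ∧ S = T.starProjection}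

/-- The matrix entry `S_{jk} = S e_k · e_j` of an endomorphism of `ℝⁿ`. -/
def entry {n : ℕ} (S : Eucl n →L[ℝ] Eucl n) (j k : Fin n) : ℝ :=
  S (EuclideanSpace.single k 1) j

/-! ### Submanifolds -/

/-- `M` is an embedded `d`-dimensional submanifold of `ℝⁿ` of class `C²`, without boundary: around
each of its points `M` is straightened to `ℝᵈ × {0}` by a local `C²` diffeomorphism of `ℝⁿ`. -/
def IsC2Submanifold (d : ℕ) {n : ℕ} (M : Set (Eucl n)) : Prop :=
  ∀ y ∈ M, ∃ Φ : OpenPartialHomeomorph (Eucl n) (Eucl n), y ∈ Φ.source ∧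
    ContDiffOn ℝ 2 Φ Φ.source ∧ ContDiffOn ℝ 2 Φ.symm Φ.target ∧
    ∀ w ∈ Φ.source, w ∈ M ↔ ∀ i : Fin n, d ≤ (i : ℕ) → Φ w i = 0

/-- The tangent space `T_y M`, spanned by the velocities at `y` of curves in `M`. -/
def tangentSpaceOf {n : ℕ} (M : Set (Eucl n)) (y : Eucl n) : Submodule ℝ (Eucl n) :=
  Submodule.span ℝ {v | ∃ γ : ℝ → Eucl n, γ 0 = y ∧ (∀ᶠ t in 𝓝 0, γ t ∈ M) ∧ HasDerivAt γ v 0}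

/-- The orthogonal projection of `ℝⁿ` onto `T_y M`. -/
def tangentProj {n : ℕ} (M : Set (Eucl n)) (y : Eucl n) : Eucl n →L[ℝ] Eucl n :=
  (tangentSpaceOf M y).starProjection

/-! ### Varifolds -/

/-- A `d`-varifold in `Ω`: a Radon measure on `Ω × G_{d,n}`, represented as a measure on
`ℝⁿ × G_{d,n}` that does not charge the complement of `Ω × G_{d,n}` and is finite on `K × G_{d,n}`
for every compact `K ⊆ Ω`. -/
structure Varifold (d : ℕ) {n : ℕ} (Ω : Set (Eucl n)) where
  toMeasure : Measure (Eucl n × Gr d n)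
  lt_top_of_isCompact : ∀ K : Set (Eucl n), K ⊆ Ω → IsCompact K →
    toMeasure (K ×ˢ Set.univ) < ⊤
  null_compl : toMeasure (Ωᶜ ×ˢ Set.univ) = 0

variable {d n : ℕ} {Ω : Set (Eucl n)}

/-- The mass `‖V‖`: the image of `V` under `(y, S) ↦ y`. -/
def Varifold.mass (V : Varifold d Ω) : Measure (Eucl n) := V.toMeasure.map Prod.fst

/-- `V = v(M, 1)`: `V` is the image of `ℋᵈ` restricted to `M` under `y ↦ (y, T_y M)`. Here `ℋᵈ` is
normalized to agree with Lebesgue measure on `ℝᵈ`. -/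
def Varifold.IsUnitOn (V : Varifold d Ω) (M : Set (Eucl n)) : Prop :=
  ∀ A : Set (Eucl n × Gr d n), MeasurableSet A →
    V.toMeasure A = Measure.euclideanHausdorffMeasure d
      {y | y ∈ M ∧ ∃ S : Gr d n, S.1 = tangentProj M y ∧ (y, S) ∈ A}

/-- `V = ‖V‖ ⊗ ν`: `ν` is a measurable family of probability measures on the Grassmannian which
disintegrates `V` with respect to its mass. -/
def Varifold.IsDisintegration (V : Varifold d Ω)
    (ν : ProbabilityTheory.Kernel (Eucl n) (Gr d n)) : Prop :=
  (∀ y, IsProbabilityMeasure (ν y)) ∧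
    ∀ A : Set (Eucl n × Gr d n), MeasurableSet A →
      V.toMeasure A = ∫⁻ y, ν y {S | (y, S) ∈ A} ∂V.mass

/-- The localized bounded Lipschitz distance `Δ_U(μ, μ')` of two measures carried by `Ω`: the
supremum of `|∫ φ dμ - ∫ φ dμ'|` over `φ ∈ Lip₁(Ω)` with `‖φ‖_∞ ≤ 1` and `supp φ ⊆ U`, the support
being the closure in `Ω` of `{φ ≠ 0}`. -/
def bLipDist (Ω U : Set (Eucl n)) (μ μ' : Measure (Eucl n)) : ENNReal :=
  ⨆ φ ∈ {φ : Eucl n → ℝ | LipschitzOnWith 1 φ Ω ∧ (∀ y ∈ Ω, |φ y| ≤ 1) ∧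
      closure {y | y ∈ Ω ∧ φ y ≠ 0} ∩ Ω ⊆ U},
    ENNReal.ofReal |∫ y, φ y ∂μ - ∫ y, φ y ∂μ'|

/-- The variation `δ_{ijk}V(φ) = ∫ S_{jk} (∇^S φ(y))_i dV(y, S)`, where `∇^S φ = S(∇φ)`. -/
def Varifold.variation (V : Varifold d Ω) (i j k : Fin n) (φ : Eucl n → ℝ) : ℝ :=
  ∫ p, entry p.2.1 j k * (p.2.1 (gradient φ p.1)) i ∂V.toMeasure

/-- `V` has locally bounded variations in the open set `U`, and `β = (β_{ijk})` is the density
`β^V` there: `β_{ijk} ∈ L¹_loc(‖V‖)` and `δ_{ijk}V = -β_{ijk} ‖V‖ + σ` on `C¹_c(U)`, where `σ` is a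
signed Radon measure in `U` (a difference `σ₁ - σ₂`) singular with respect to `‖V‖`. -/
def Varifold.IsVariationDensity (V : Varifold d Ω) (U : Set (Eucl n))
    (β : Fin n → Fin n → Fin n → Eucl n → ℝ) : Prop :=
  ∀ i j k, LocallyIntegrableOn (β i j k) U V.mass ∧
    ∃ σ₁ σ₂ : Measure (Eucl n),
      (∀ K ⊆ U, IsCompact K → σ₁ K < ⊤ ∧ σ₂ K < ⊤) ∧
      σ₁.MutuallySingular (V.mass.restrict U) ∧ σ₂.MutuallySingular (V.mass.restrict U) ∧
      ∀ φ : Eucl n → ℝ, ContDiff ℝ 1 φ → HasCompactSupport φ → tsupport φ ⊆ U →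
        V.variation i j k φ =
          -(∫ y, β i j k y * φ y ∂V.mass) + (∫ y, φ y ∂σ₁ - ∫ y, φ y ∂σ₂)

/-! ### Approximate orthogonal weak second fundamental form -/

/-- The profiles `ρ, ξ : ℝ₊ → ℝ₊` of the regularizing kernels (only their values on `[0, ∞)`
matter). Both are `C¹` on `[0, ∞)` and vanish on `[1, ∞)`; `ρ` is decreasing with `ρ'(0) = 0` and
`ρ'` Lipschitz; `ξ > 0` on `(0, 1)`; both radial kernels have integral `1` on `ℝⁿ`. -/
structure IsKernelPair (n : ℕ) (ρ ξ : ℝ → ℝ) : Prop where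
  contDiff_rho : ContDiffOn ℝ 1 ρ (Set.Ici 0)
  contDiff_xi : ContDiffOn ℝ 1 ξ (Set.Ici 0)
  rho_nonneg : ∀ t, 0 ≤ t → 0 ≤ ρ t
  xi_nonneg : ∀ t, 0 ≤ t → 0 ≤ ξ t
  rho_eq_zero : ∀ t, 1 ≤ t → ρ t = 0
  xi_eq_zero : ∀ t, 1 ≤ t → ξ t = 0
  rho_antitone : AntitoneOn ρ (Set.Ici 0)
  deriv_rho_zero : derivWithin ρ (Set.Ici 0) 0 = 0
  deriv_rho_lipschitz : ∃ L, LipschitzOnWith L (derivWithin ρ (Set.Ici 0)) (Set.Ici 0)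
  xi_pos : ∀ t, 0 < t → t < 1 → 0 < ξ t
  integral_rho : ∫ y : Eucl n, ρ ‖y‖ = 1
  integral_xi : ∫ y : Eucl n, ξ ‖y‖ = 1

/-- The rescaled radial kernel `f_ε(y) = ε⁻ⁿ f(|y| / ε)`. -/
def radialKernel (f : ℝ → ℝ) (ε : ℝ) (y : Eucl n) : ℝ := (ε ^ n)⁻¹ * f (‖y‖ / ε)

/-- The constant `C_f = d ω_d ∫₀¹ f(r) r^{d-1} dr`, with `ω_d` the volume of the unit ball. -/
def kernelConst (d : ℕ) (f : ℝ → ℝ) : ℝ :=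
  d * volume.real (Metric.ball (0 : Eucl d) 1) * ∫ r in (0 : ℝ)..1, f r * r ^ (d - 1)

/-- `(δ_{ijk}V * ρ_ε)(x) = ∫ S_{jk} (∇^S ρ_ε(y - x))_i dV(y, S)`. -/
def Varifold.regVariation (V : Varifold d Ω) (ρ : ℝ → ℝ) (ε : ℝ) (i j k : Fin n)
    (x : Eucl n) : ℝ :=
  ∫ p, entry p.2.1 j k * (p.2.1 (gradient (radialKernel ρ ε) (p.1 - x))) i ∂V.toMeasure

/-- `β_{ijk}^{V,ε}(x) = -(C_ξ / C_ρ) (δ_{ijk}V * ρ_ε)(x) / (‖V‖ * ξ_ε)(x)`. -/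
def Varifold.betaEps (V : Varifold d Ω) (ρ ξ : ℝ → ℝ) (ε : ℝ) (x : Eucl n)
    (i j k : Fin n) : ℝ :=
  -(kernelConst d ξ / kernelConst d ρ) *
    (V.regVariation ρ ε i j k x / ∫ y, radialKernel ξ ε (x - y) ∂V.mass)

/-- The matrix `c = ∫ S dν(S)`; with `ν = ν_x` this is `c^V(x)`. -/
def meanPlane (ν : Measure (Gr d n)) : Matrix (Fin n) (Fin n) ℝ :=
  Matrix.of fun j k => ∫ S, entry S.1 j k ∂ν

/-- `β_{ijk}^{V,ε,⊥}(x) = β_{ijk}^{V,ε}(x) - c_{jk}^V(x) (c^V(x) ∑_q β_{q·q}^{V,ε}(x))_i`, where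
`V = ‖V‖ ⊗ ν`. -/
def Varifold.betaPerp (V : Varifold d Ω) (ν : ProbabilityTheory.Kernel (Eucl n) (Gr d n))
    (ρ ξ : ℝ → ℝ) (ε : ℝ) (x : Eucl n) (i j k : Fin n) : ℝ :=
  V.betaEps ρ ξ ε x i j k -
    meanPlane (ν x) j k *
      (meanPlane (ν x)).mulVec (fun l => ∑ q, V.betaEps ρ ξ ε x q l q) i

/-- The linear system `a_{ijk} + c_{jk} ∑_q a_{qiq} = b_{ijk}`. -/
def SolvesSystem (c : Matrix (Fin n) (Fin n) ℝ) (b a : Fin n → Fin n → Fin n → ℝ) : Prop :=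
  ∀ i j k, a i j k + c j k * ∑ q, a q i q = b i j k

/-- The solution of the system (see `solvesSystem_iff`):
`a_{ijk} = b_{ijk} - c_{jk} ((I + c)⁻¹ h)_i` with `h_i = ∑_q b_{qiq}`. -/
def systemSolution (c : Matrix (Fin n) (Fin n) ℝ) (b : Fin n → Fin n → Fin n → ℝ)
    (i j k : Fin n) : ℝ :=
  b i j k - c j k * (1 + c)⁻¹.mulVec (fun l => ∑ q, b q l q) i

/-- For a symmetric positive semidefinite matrix `c` the system has exactly one solution. -/
theorem solvesSystem_iff {c : Matrix (Fin n) (Fin n) ℝ} (hc : c.PosSemidef)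
    (b a : Fin n → Fin n → Fin n → ℝ) : SolvesSystem c b a ↔ a = systemSolution c b := by
  have hdet : IsUnit (1 + c).det :=
    (Matrix.isUnit_iff_isUnit_det _).1 (Matrix.PosDef.one.add_posSemidef hc).isUnit
  constructor
  · intro h
    have hu : (1 + c).mulVec (fun l => ∑ q, a q l q) = fun l => ∑ q, b q l q := by
      funext l
      rw [Matrix.add_mulVec, Matrix.one_mulVec]
      simp only [Pi.add_apply, Matrix.mulVec, dotProduct]
      rw [← Finset.sum_add_distrib]
      exact Finset.sum_congr rfl fun q _ => h q l q
    have hu' : (1 + c)⁻¹.mulVec (fun l => ∑ q, b q l q) = fun l => ∑ q, a q l q := by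
      rw [← hu, Matrix.mulVec_mulVec, Matrix.nonsing_inv_mul _ hdet, Matrix.one_mulVec]
    funext i j k
    simp only [systemSolution, hu']
    linarith [h i j k]
  · rintro rfl
    set u := (1 + c)⁻¹.mulVec (fun l => ∑ q, b q l q) with hu
    have h1 : (1 + c).mulVec u = fun l => ∑ q, b q l q := by
      rw [hu, Matrix.mulVec_mulVec, Matrix.mul_nonsing_inv _ hdet, Matrix.one_mulVec]
    intro i j k
    have h2 : ∑ q, systemSolution c b q i q = u i := by
      have h3 := congrFun h1 i
      rw [Matrix.add_mulVec, Matrix.one_mulVec] at h3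
      simp only [Pi.add_apply, Matrix.mulVec, dotProduct] at h3
      simp only [systemSolution, ← hu, Finset.sum_sub_distrib]
      linarith
    rw [h2]
    simp only [systemSolution, ← hu]
    ring

/-- `A^{V,ε,⊥}(x)`: the solution of the system with `b = β^{V,ε,⊥}(x)` and `c = c^V(x)`. -/
def Varifold.formPerp (V : Varifold d Ω) (ν : ProbabilityTheory.Kernel (Eucl n) (Gr d n))
    (ρ ξ : ℝ → ℝ) (ε : ℝ) (x : Eucl n) : Fin n → Fin n → Fin n → ℝ :=
  systemSolution (meanPlane (ν x)) (V.betaPerp ν ρ ξ ε x)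

end

/-!
The proof rests on two observations.

*Cancellation at the base point.* Since the planes are projections, `S² = S`, the form
`β^{V,ε,⊥}_{ijk}(z)` is, up to the constant `-C_ξ / C_ρ`, the factor `1 / ε` times the quotient of
`∫ F(S) · κ((w - z)/ε) dV(w, S)` and of the regularized mass, where `κ(v) = ρ'(|v|) v / |v|` and
`F(S) = S_{jk} S e_i - c_{jk} S c_i` with `c = c^V(z)` (`perpField`, `Varifold.betaPerp_eq`). For
`V = v(M, 1)` and `z = x ∈ M` the matrix `c` is `T_x M`, and `F` vanishes at `S = T_x M`. Hence
`w ↦ F(P(w))` is Lipschitz and `O(ε)` on the ball of radius `ε`, which compensates the slope `1 / ε`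
of the kernel: `F(P(w)) · κ((w - x)/ε)` is a Lipschitz test function with a constant independent of
`ε`. Passing from `V_h` at `z_h` to `V` at `x` replaces, one at a time, the plane `S` by `P(w)`
(error `d_{2,h}`), the centre `z_h` by `x` (error `|x - z_h|`) and the mass `‖V_h‖` by `‖V‖`
(error `d_{1,h}`, by the bounded Lipschitz distance); each error is relative to `ε^d`
(`IsTangentExtension.abs_perpIntegral_sub_le`). The denominators are of order `ε^d`
(`abs_massIntegral_sub_le`), and only their errors, which do not involve `d_{2,h}`, have to be
`o(ε)`. The factor `1 / ε` in front of the quotient gives the rate. The matrix `I + c` does not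
shrink vectors, so that the estimate is inherited by the solutions of the linear systems
(`abs_systemSolution_sub_le`).

*Blow-up.* Near `x`, `M` is a graph over its tangent planes with quadratic errors, uniformly in the
base point (`IsGraphAt`, `exists_isGraphAt`). Projecting onto `T_y M` turns integrals over `M`
against kernels at scale `ε` into integrals over a Euclidean space, up to `O(ε)` for Lipschitz
kernels and up to `O(ε²)` for odd kernels against tangent vectors. As a consequence
`ε^{-d-1} ∫_M F · κ((w - y)/ε) dℋᵈ` tends to `-C_ρ` times the tangential divergence of `F`, for every
field `F` that is differentiable and tangent to `M` at `y`
(`tendsto_integral_inner_radialField`). This has two uses. Evaluating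
`∫∫ φ(y) F(w) · κ((w - y)/ε)` over `M × M` in both orders yields the divergence theorem on `M`
(`integral_fderiv_eq_neg_integral_planeDiv`), so that near `x` the variation of `V` has the continuous
density `tr(D(P_{jk} P e_i) ∘ P)` and no singular part. Applied to `F(P(w))` it identifies the limit
of `β^{V,ε,⊥}(x)` with the same expression: the correction term has no tangential divergence, since
differentiating `P² = P` along `M` gives `P (D_v P) P = 0`
(`IsTangentExtension.planeDiv_perpField`).

Any other density that is continuous at `x` along `M` has the same value there, because a measure
cannot be dominated by a measure singular to it (`Varifold.IsVariationDensity.apply_eq`).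
-/

noncomputable section

/-! ### Radial kernels in Euclidean spaces -/

section Radial

variable {E : Type*} [NormedAddCommGroup E] [InnerProductSpace ℝ E]

/-- The radial vector field `v ↦ g(|v|) v / |v|`; it vanishes at the origin. If `g = ρ'`, this is
the gradient of `v ↦ ρ(|v|)`. -/
def radialField (g : ℝ → ℝ) (v : E) : E := (g ‖v‖ / ‖v‖) • v

theorem norm_radialField (g : ℝ → ℝ) (h0 : g 0 = 0) (v : E) : ‖radialField g v‖ = |g ‖v‖| := by
  unfold radialField
  rcases eq_or_ne v 0 with rfl | hv
  · simp [h0]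
  · have : ‖v‖ ≠ 0 := norm_ne_zero_iff.2 hv
    rw [norm_smul, norm_div, norm_norm, Real.norm_eq_abs, div_mul_cancel₀ _ this]

theorem radialField_neg (g : ℝ → ℝ) (v : E) : radialField g (-v) = -radialField g v := by
  simp [radialField]

theorem radialField_eq_zero {g : ℝ → ℝ} (h1 : ∀ t, 1 ≤ t → g t = 0) {v : E} (hv : 1 ≤ ‖v‖) :
    radialField g v = 0 := by
  simp [radialField, h1 _ hv]

theorem abs_le_of_lipschitzOnWith {g : ℝ → ℝ} {L : NNReal} (hg : LipschitzOnWith L g (Set.Ici 0))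
    (h0 : g 0 = 0) {t : ℝ} (ht : 0 ≤ t) : |g t| ≤ L * t := by
  have := hg.dist_le_mul t ht 0 (Set.mem_Ici.2 le_rfl)
  simpa [h0, Real.dist_eq, abs_of_nonneg ht] using this

theorem norm_radialField_le {g : ℝ → ℝ} {L : NNReal} (hg : LipschitzOnWith L g (Set.Ici 0))
    (h0 : g 0 = 0) (h1 : ∀ t, 1 ≤ t → g t = 0) (v : E) : ‖radialField g v‖ ≤ L := by
  rw [norm_radialField g h0]
  rcases le_total 1 ‖v‖ with h | h
  · simp [h1 _ h]
  · exact (abs_le_of_lipschitzOnWith hg h0 (norm_nonneg v)).trans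
      (mul_le_of_le_one_right L.2 h)

/-- The factor `g(p)/p` is only bounded near `p = 0`; weighted with `q` its variation is controlled. -/
theorem abs_div_sub_div_mul_le {g : ℝ → ℝ} {L : NNReal} (hg : LipschitzOnWith L g (Set.Ici 0))
    (h0 : g 0 = 0) {p q : ℝ} (hp : 0 ≤ p) (hq : 0 ≤ q) :
    |g p / p - g q / q| * q ≤ 2 * L * |p - q| := by
  have hL : (0 : ℝ) ≤ L := L.2
  rcases hq.eq_or_lt with rfl | hq'
  · rw [mul_zero]; positivity
  rcases hp.eq_or_lt with rfl | hp'
  · have := abs_le_of_lipschitzOnWith hg h0 hq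
    rw [div_zero, zero_sub, zero_sub, abs_neg, abs_neg, abs_div, abs_of_pos hq',
      div_mul_cancel₀ _ hq'.ne']
    nlinarith
  have h2 : |g p / p| ≤ L := by
    rw [abs_div, abs_of_pos hp', div_le_iff₀ hp']
    exact abs_le_of_lipschitzOnWith hg h0 hp
  have h4 : |g p - g q| ≤ L * |p - q| := by
    simpa [Real.dist_eq] using hg.dist_le_mul p hp q hq
  have h5 : (g p / p - g q / q) * q = g p / p * (q - p) + (g p - g q) := by
    field_simp; ring
  have h6 : |g p / p - g q / q| * q = |(g p / p - g q / q) * q| := by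
    rw [abs_mul, abs_of_pos hq']
  rw [h6, h5]
  refine (abs_add_le _ _).trans ?_
  rw [abs_mul, abs_sub_comm q p]
  have : |g p / p| * |p - q| ≤ L * |p - q| := by gcongr
  linarith

/-- `κ(u) - κ(v) = (g(|u|)/|u|) (u - v) + (g(|u|)/|u| - g(|v|)/|v|) v`, and `|g(t)| ≤ L t`. -/
theorem norm_radialField_sub_le {g : ℝ → ℝ} {L : NNReal}
    (hg : LipschitzOnWith L g (Set.Ici 0)) (h0 : g 0 = 0) (u v : E) :
    ‖radialField g u - radialField g v‖ ≤ 3 * L * ‖u - v‖ := by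
  have hL : (0 : ℝ) ≤ L := L.2
  have key : radialField g u - radialField g v =
      (g ‖u‖ / ‖u‖) • (u - v) + (g ‖u‖ / ‖u‖ - g ‖v‖ / ‖v‖) • v := by
    simp only [radialField, smul_sub, sub_smul]; abel
  have h2 : |g ‖u‖ / ‖u‖| ≤ L := by
    rw [abs_div, abs_norm]
    exact div_le_of_le_mul₀ (norm_nonneg _) hL (abs_le_of_lipschitzOnWith hg h0 (norm_nonneg u))
  have h5 := abs_div_sub_div_mul_le hg h0 (norm_nonneg u) (norm_nonneg v)
  have h3 : 2 * L * |‖u‖ - ‖v‖| ≤ 2 * L * ‖u - v‖ := by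
    gcongr; exact abs_norm_sub_norm_le u v
  rw [key]
  refine (norm_add_le _ _).trans ?_
  rw [norm_smul, norm_smul, Real.norm_eq_abs, Real.norm_eq_abs]
  have : |g ‖u‖ / ‖u‖| * ‖u - v‖ ≤ L * ‖u - v‖ := by gcongr
  linarith

theorem continuous_radialField {g : ℝ → ℝ} {L : NNReal}
    (hg : LipschitzOnWith L g (Set.Ici 0)) (h0 : g 0 = 0) :
    Continuous (radialField g : E → E) := by
  refine (LipschitzWith.of_dist_le_mul (K := 3 * L) fun u v => ?_).continuous
  rw [dist_eq_norm, dist_eq_norm]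
  exact_mod_cast norm_radialField_sub_le hg h0 u v

/-- The kernel `v ↦ ρ(|v|)` is differentiable everywhere; at the origin this uses `ρ'(0) = 0`. -/
theorem hasFDerivAt_radial {ρ g : ℝ → ℝ} (h : ∀ t, 0 ≤ t → HasDerivWithinAt ρ (g t) (Set.Ici 0) t)
    (h0 : g 0 = 0) (v : E) :
    HasFDerivAt (fun v : E => ρ ‖v‖) (innerSL ℝ (radialField g v)) v := by
  rcases eq_or_ne v 0 with rfl | hv
  · have h1 := (h 0 le_rfl).hasFDerivWithinAt.isLittleO
    have h2 : Tendsto (fun w : E => ‖w‖) (𝓝 0) (𝓝[Set.Ici 0] 0) := by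
      refine tendsto_nhdsWithin_iff.2 ⟨?_, Eventually.of_forall fun w => norm_nonneg w⟩
      simpa using (continuous_norm (E := E)).tendsto 0
    have h3 := h1.comp_tendsto h2
    refine HasFDerivAt.of_isLittleO ?_
    simp only [Function.comp_def, h0] at h3
    simp only [radialField, smul_zero, map_zero, norm_zero]
    refine Asymptotics.IsLittleO.of_norm_right ?_
    simpa using h3
  · have hn : 0 < ‖v‖ := norm_pos_iff.2 hv
    have h1 : HasFDerivAt (fun v : E => ‖v‖) ((1 / ‖v‖) • innerSL ℝ v) v := by
      have h2 := ((hasStrictFDerivAt_norm_sq v).hasFDerivAt).sqrt (by positivity)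
      have h3 : (fun v : E => Real.sqrt (‖v‖ ^ 2)) = fun v => ‖v‖ := by
        funext w; exact Real.sqrt_sq (norm_nonneg w)
      rw [h3] at h2
      convert! h2 using 1
      ext w
      simp [Real.sqrt_sq hn.le]
      field_simp
    have h2 : HasDerivAt ρ (g ‖v‖) ‖v‖ := (h _ hn.le).hasDerivAt (Ici_mem_nhds hn)
    convert! h2.comp_hasFDerivAt v h1 using 1
    ext w
    simp [radialField]
    ring

section Integral

variable [FiniteDimensional ℝ E] [MeasurableSpace E] [BorelSpace E]

theorem integrable_of_eq_zero_of_one_le {F : Type*} [NormedAddCommGroup F] {f : E → F}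
    {μ : Measure E} [IsFiniteMeasureOnCompacts μ]
    (hf : Continuous f) (h1 : ∀ v, 1 ≤ ‖v‖ → f v = 0) : Integrable f μ := by
  refine hf.integrable_of_hasCompactSupport ?_
  refine HasCompactSupport.intro (isCompact_closedBall (0 : E) 1) fun v hv => h1 v ?_
  simp only [Metric.mem_closedBall, dist_zero_right, not_le] at hv
  exact hv.le

/-- The divergence theorem for the kernel `ρ(|v|)`: integration by parts in each direction of an
orthonormal basis. -/
theorem integral_inner_radialField {ρ g : ℝ → ℝ} {L : NNReal}
    (h : ∀ t, 0 ≤ t → HasDerivWithinAt ρ (g t) (Set.Ici 0) t)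
    (hg : LipschitzOnWith L g (Set.Ici 0))
    (h0 : g 0 = 0) (h1 : ∀ t, 1 ≤ t → g t = 0) (hρ1 : ∀ t, 1 ≤ t → ρ t = 0)
    (A : E →L[ℝ] E) :
    ∫ v : E, inner ℝ (A v) (radialField g v) =
      -((∫ v : E, ρ ‖v‖) * LinearMap.trace ℝ E (A : E →ₗ[ℝ] E)) := by
  have hd : ∀ v : E, HasFDerivAt (fun v : E => ρ ‖v‖) (innerSL ℝ (radialField g v)) v :=
    hasFDerivAt_radial h h0
  have hcont : Continuous fun v : E => ρ ‖v‖ :=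
    continuous_iff_continuousAt.2 fun v => (hd v).continuousAt
  have hκ : Continuous (radialField g : E → E) := continuous_radialField hg h0
  set b := stdOrthonormalBasis ℝ E
  have hexp : ∀ v : E, inner ℝ (A v) (radialField g v) =
      ∑ a, inner ℝ (A v) (b a) * inner ℝ (b a) (radialField g v) := fun v =>
    (b.sum_inner_mul_inner _ _).symm
  simp_rw [hexp]
  rw [integral_finsetSum]
  swap
  · intro a _
    refine integrable_of_eq_zero_of_one_le (by fun_prop) fun v hv => ?_
    rw [radialField_eq_zero h1 hv, inner_zero_right, mul_zero]
  have hterm : ∀ a, ∫ v : E, inner ℝ (A v) (b a) * inner ℝ (b a) (radialField g v) =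
      -((∫ v : E, ρ ‖v‖) * inner ℝ (b a) (A (b a))) := by
    intro a
    have hf : ∀ v : E, HasFDerivAt (fun v : E => inner ℝ (b a) (A v))
        ((innerSL ℝ (b a)).comp A) v := fun v =>
      ((innerSL ℝ (b a)).comp A).hasFDerivAt
    have := integral_mul_fderiv_eq_neg_fderiv_mul_of_integrable (μ := (volume : Measure E))
      (f := fun v : E => inner ℝ (b a) (A v)) (g := fun v => ρ ‖v‖) (v := b a)
      (by
        simp_rw [fun v => (hf v).fderiv]
        refine integrable_of_eq_zero_of_one_le (continuous_const.mul hcont) fun v hv => ?_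
        simp [hρ1 _ hv])
      (by
        simp_rw [fun v => (hd v).fderiv]
        refine integrable_of_eq_zero_of_one_le
          (by simp only [innerSL_apply_apply]; fun_prop) fun v hv => ?_
        simp [radialField_eq_zero h1 hv])
      (by
        refine integrable_of_eq_zero_of_one_le
          (Continuous.mul (by fun_prop) hcont) fun v hv => ?_
        simp [hρ1 _ hv])
      (fun v _ => (hf v).differentiableAt) (fun v _ => (hd v).differentiableAt)
    simp_rw [fun v => (hf v).fderiv, fun v => (hd v).fderiv] at this
    simp only [innerSL_apply_apply, ContinuousLinearMap.comp_apply] at this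
    rw [integral_const_mul] at this
    rw [mul_comm (∫ v : E, ρ ‖v‖), ← this]
    refine integral_congr_ae (Eventually.of_forall fun v => ?_)
    simp only
    rw [real_inner_comm (b a) (A v), real_inner_comm (b a) (radialField g v)]
  simp_rw [hterm]
  rw [LinearMap.trace_eq_sum_inner _ b, Finset.sum_neg_distrib, Finset.mul_sum]
  rfl

theorem integral_radialField_eq_zero (g : ℝ → ℝ) : ∫ v : E, radialField g v = 0 := by
  have h1 : ∫ v : E, radialField g (-v) = ∫ v : E, radialField g v :=
    integral_neg_eq_self (fun v : E => radialField g v) volume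
  simp_rw [radialField_neg, integral_neg] at h1
  have h2 : (2 : ℝ) • ∫ v : E, radialField g v = 0 := by
    rw [two_smul]
    nth_rewrite 1 [← h1]
    exact neg_add_cancel _
  exact (smul_eq_zero.1 h2).resolve_left two_ne_zero

theorem volume_real_unitBall_eq {d : ℕ} (hE : Module.finrank ℝ E = d) :
    volume.real (Metric.ball (0 : E) 1) = volume.real (Metric.ball (0 : Eucl d) 1) := by
  let e : E ≃ₗᵢ[ℝ] Eucl d := (stdOrthonormalBasis ℝ E).repr.trans
    (LinearIsometryEquiv.piLpCongrLeft 2 ℝ ℝ (finCongr hE))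
  rw [measureReal_def, measureReal_def, ← e.measurePreserving.measure_preimage
    measurableSet_ball.nullMeasurableSet]
  congr 2
  ext v
  simp

/-- Polar coordinates: `C_f` is the integral of `f(|v|)` over a `d`-dimensional space. -/
theorem integral_norm_eq_kernelConst {d : ℕ} (hd : 1 ≤ d) (hE : Module.finrank ℝ E = d)
    {f : ℝ → ℝ} (h1 : ∀ t, 1 ≤ t → f t = 0) : ∫ v : E, f ‖v‖ = kernelConst d f := by
  have : Nontrivial E := Module.nontrivial_of_finrank_pos (R := ℝ) (by omega)
  have hb := volume_real_unitBall_eq hE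
  rw [integral_fun_norm_addHaar, hE, hb, kernelConst]
  have h2 : ∫ y in Set.Ioi (0 : ℝ), y ^ (d - 1) • f y = ∫ r in (0 : ℝ)..1, f r * r ^ (d - 1) := by
    rw [intervalIntegral.integral_of_le zero_le_one]
    rw [← Set.Ioc_union_Ioi_eq_Ioi (zero_le_one' ℝ)]
    rw [setIntegral_eq_of_subset_of_forall_sdiff_eq_zero (s := Set.Ioc (0 : ℝ) 1)]
    · simp_rw [smul_eq_mul, mul_comm]
    · measurability
    · exact Set.subset_union_left
    · rintro t ⟨ht | ht, ht'⟩
      · exact absurd ht ht'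
      · simp [h1 t (le_of_lt ht)]
  rw [h2]
  simp [nsmul_eq_mul, mul_assoc]

end Integral

end Radial

section KernelPair

variable {d n : ℕ} {ρ ξ : ℝ → ℝ}

/-- The derivative `ρ'` of the profile on `[0, ∞)`. -/
abbrev profileDeriv (ρ : ℝ → ℝ) : ℝ → ℝ := derivWithin ρ (Set.Ici 0)

theorem IsKernelPair.hasDerivWithinAt (hk : IsKernelPair n ρ ξ) (t : ℝ) (ht : 0 ≤ t) :
    HasDerivWithinAt ρ (profileDeriv ρ t) (Set.Ici 0) t :=
  ((hk.contDiff_rho.differentiableOn one_ne_zero) t ht).hasDerivWithinAt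

theorem IsKernelPair.profileDeriv_eq_zero (hk : IsKernelPair n ρ ξ) (t : ℝ) (ht : 1 ≤ t) :
    profileDeriv ρ t = 0 := by
  have ht0 : (0 : ℝ) < t := by linarith
  have h1 : HasDerivWithinAt ρ (profileDeriv ρ t) (Set.Ici t) t :=
    (hk.hasDerivWithinAt t ht0.le).mono (Set.Ici_subset_Ici.2 ht0.le)
  have h2 : HasDerivWithinAt ρ 0 (Set.Ici t) t :=
    (hasDerivWithinAt_const t (Set.Ici t) (0 : ℝ)).congr
      (fun s hs => hk.rho_eq_zero s (ht.trans hs)) (hk.rho_eq_zero t ht)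
  exact (uniqueDiffOn_Ici t t (Set.mem_Ici.2 le_rfl)).eq_deriv _ h1 h2

theorem ContDiffOn.exists_lipschitzOnWith_of_eq_zero {f : ℝ → ℝ} (hf : ContDiffOn ℝ 1 f (Set.Ici 0))
    (h1 : ∀ t, 1 ≤ t → f t = 0) : ∃ K : NNReal, LipschitzOnWith K f (Set.Ici 0) := by
  have hc : ContinuousOn (derivWithin f (Set.Ici 0)) (Set.Icc 0 1) :=
    (hf.continuousOn_derivWithin (uniqueDiffOn_Ici 0) le_rfl).mono fun t ht => ht.1
  obtain ⟨K, hK⟩ := isCompact_Icc.exists_bound_of_continuousOn hc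
  have hK0 : 0 ≤ K := (norm_nonneg _).trans (hK 0 (by simp))
  refine ⟨K.toNNReal, ?_⟩
  refine (convex_Ici 0).lipschitzOnWith_of_nnnorm_derivWithin_le
    (hf.differentiableOn one_ne_zero) fun t ht => ?_
  rw [← NNReal.coe_le_coe]
  rw [coe_nnnorm, Real.coe_toNNReal K hK0]
  rcases le_total t 1 with h | h
  · exact hK t ⟨ht, h⟩
  · have ht0 : (0 : ℝ) < t := by linarith
    have h3 : HasDerivWithinAt f (derivWithin f (Set.Ici 0) t) (Set.Ici t) t :=
      ((hf.differentiableOn one_ne_zero) t ht).hasDerivWithinAt.mono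
        (Set.Ici_subset_Ici.2 ht0.le)
    have h2 : HasDerivWithinAt f 0 (Set.Ici t) t :=
      (hasDerivWithinAt_const t (Set.Ici t) (0 : ℝ)).congr
        (fun s hs => h1 s (h.trans hs)) (h1 t h)
    rw [(uniqueDiffOn_Ici t t (Set.mem_Ici.2 le_rfl)).eq_deriv _ h3 h2, norm_zero]
    exact hK0

theorem lipschitzWith_comp_norm {E : Type*} [NormedAddCommGroup E] {f : ℝ → ℝ} {K : NNReal}
    (hf : LipschitzOnWith K f (Set.Ici 0)) : LipschitzWith K fun v : E => f ‖v‖ := by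
  refine LipschitzWith.of_dist_le_mul fun u v => ?_
  refine (hf.dist_le_mul _ (norm_nonneg u) _ (norm_nonneg v)).trans ?_
  gcongr
  rw [Real.dist_eq, dist_eq_norm]
  exact abs_norm_sub_norm_le u v

theorem IsKernelPair.gradient_radialKernel (hk : IsKernelPair n ρ ξ) {ε : ℝ} (hε : 0 < ε)
    (v : Eucl n) :
    gradient (radialKernel ρ ε) v =
      ((ε ^ n)⁻¹ * ε⁻¹) • radialField (profileDeriv ρ) (ε⁻¹ • v) := by
  refine HasGradientAt.gradient ?_
  rw [hasGradientAt_iff_hasFDerivAt]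
  have h1 := hasFDerivAt_radial hk.hasDerivWithinAt hk.deriv_rho_zero (ε⁻¹ • v)
  have h2 : HasFDerivAt (fun w : Eucl n => ε⁻¹ • w) (ε⁻¹ • ContinuousLinearMap.id ℝ (Eucl n)) v :=
    (ε⁻¹ • ContinuousLinearMap.id ℝ (Eucl n)).hasFDerivAt
  have h3 := (h1.comp v h2).const_mul ((ε ^ n)⁻¹)
  have h4 : (radialKernel ρ ε : Eucl n → ℝ) =
      fun w => (ε ^ n)⁻¹ * (((fun v : Eucl n => ρ ‖v‖) ∘ fun w => ε⁻¹ • w) w) := by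
    funext w
    simp only [radialKernel, Function.comp, norm_smul, norm_inv, Real.norm_eq_abs, abs_of_pos hε]
    rw [div_eq_inv_mul]
  rw [h4]
  convert! h3 using 1
  ext w
  simp
  ring

theorem kernelConst_pos (hd : 1 ≤ d) {f : ℝ → ℝ} (hf : ContinuousOn f (Set.Ici 0))
    (h0 : ∀ t, 0 ≤ t → 0 ≤ f t) {s : ℝ} (hs : 0 < s) (hs1 : s < 1) (hpos : 0 < f s) :
    0 < kernelConst d f := by
  have hd' : (0 : ℝ) < d := by exact_mod_cast hd
  have hb : 0 < volume.real (Metric.ball (0 : Eucl d) 1) :=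
    ENNReal.toReal_pos (Metric.measure_ball_pos volume _ one_pos).ne' measure_ball_lt_top.ne
  refine mul_pos (mul_pos hd' hb) ?_
  refine intervalIntegral.integral_pos one_pos ?_ ?_ ⟨s, ⟨hs.le, hs1.le⟩, by positivity⟩
  · exact (hf.mono fun t ht => ht.1).mul (by fun_prop)
  · intro t ht
    exact mul_nonneg (h0 t ht.1.le) (by have := ht.1; positivity)

theorem IsKernelPair.kernelConst_xi_pos (hk : IsKernelPair n ρ ξ) (hd : 1 ≤ d) :
    0 < kernelConst d ξ :=
  kernelConst_pos hd hk.contDiff_xi.continuousOn hk.xi_nonneg one_half_pos one_half_lt_one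
    (hk.xi_pos _ one_half_pos one_half_lt_one)

/-- A decreasing profile whose radial kernel has integral `1` is positive near the origin. -/
theorem IsKernelPair.kernelConst_rho_pos (hk : IsKernelPair n ρ ξ) (hd : 1 ≤ d) :
    0 < kernelConst d ρ := by
  by_cases h : ∃ s, 0 < s ∧ s < 1 ∧ ρ s ≠ 0
  · obtain ⟨s, hs, hs1, hne⟩ := h
    exact kernelConst_pos hd hk.contDiff_rho.continuousOn hk.rho_nonneg hs hs1
      (lt_of_le_of_ne (hk.rho_nonneg s hs.le) hne.symm)
  · exfalso
    push Not at h
    have h0 : ρ 0 = 0 := by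
      have hc : Tendsto ρ (𝓝[>] 0) (𝓝 (ρ 0)) :=
        (hk.contDiff_rho.continuousOn 0 (Set.mem_Ici.2 le_rfl)).mono_left
          (nhdsWithin_mono _ Set.Ioi_subset_Ici_self)
      refine tendsto_nhds_unique hc (tendsto_const_nhds.congr' ?_)
      filter_upwards [Ioo_mem_nhdsGT (zero_lt_one' ℝ)] with s hs
      exact (h s hs.1 hs.2).symm
    have : ∀ y : Eucl n, ρ ‖y‖ = 0 := fun y => by
      rcases (norm_nonneg y).eq_or_lt with h' | h'
      · rw [← h', h0]
      · rcases lt_or_ge ‖y‖ 1 with h1 | h1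
        · exact h _ h' h1
        · exact hk.rho_eq_zero _ h1
    have h2 := hk.integral_rho
    simp [this] at h2

end KernelPair

/-! ### Projecting a submanifold onto its tangent spaces -/

section Hausdorff

variable {X Y : Type*} [EMetricSpace X] [MeasurableSpace X] [BorelSpace X]
  [EMetricSpace Y] [MeasurableSpace Y] [BorelSpace Y]

theorem LipschitzOnWith.euclideanHausdorffMeasure_image_le {K : NNReal} {f : X → Y} {s : Set X}
    (h : LipschitzOnWith K f s) (d : ℕ) :
    Measure.euclideanHausdorffMeasure d (f '' s) ≤
      (K : ENNReal) ^ d * Measure.euclideanHausdorffMeasure d s := by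
  have h1 := h.hausdorffMeasure_image_le (d := d) (Nat.cast_nonneg d)
  rw [ENNReal.rpow_natCast] at h1
  rw [Measure.euclideanHausdorffMeasure_def, Measure.euclideanHausdorffMeasure_def,
    Measure.smul_apply, Measure.smul_apply, ENNReal.smul_def, ENNReal.smul_def, smul_eq_mul,
    smul_eq_mul, mul_left_comm]
  gcongr

/-- A map with `edist u v ≤ K * edist (f u) (f v)` on `s` does not shrink Hausdorff measure by more
than the factor `K ^ d`. -/
theorem euclideanHausdorffMeasure_le_of_edist_le {K : NNReal} {f : X → Y} {s : Set X}
    (h : ∀ u ∈ s, ∀ v ∈ s, edist u v ≤ K * edist (f u) (f v)) (d : ℕ) :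
    Measure.euclideanHausdorffMeasure d s ≤
      (K : ENNReal) ^ d * Measure.euclideanHausdorffMeasure d (f '' s) := by
  rcases s.eq_empty_or_nonempty with rfl | ⟨u0, hu0⟩
  · simp
  have : Nonempty X := ⟨u0⟩
  set g := Function.invFunOn f s
  have hg : ∀ y ∈ f '' s, g y ∈ s ∧ f (g y) = y := fun y hy =>
    ⟨Function.invFunOn_mem hy, Function.invFunOn_eq hy⟩
  have hgf : ∀ u ∈ s, g (f u) = u := fun u hu => by
    obtain ⟨h1, h2⟩ := hg _ (Set.mem_image_of_mem f hu)
    have := h _ h1 _ hu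
    rw [h2, edist_self, mul_zero] at this
    exact edist_le_zero.1 this
  have hL : LipschitzOnWith K g (f '' s) := fun y hy y' hy' => by
    have := h _ (hg y hy).1 _ (hg y' hy').1
    rwa [(hg y hy).2, (hg y' hy').2] at this
  have himg : g '' (f '' s) = s := by
    rw [Set.image_image]
    ext u
    constructor
    · rintro ⟨v, hv, rfl⟩
      exact (hg _ (Set.mem_image_of_mem f hv)).1
    · exact fun hu => ⟨u, hu, hgf u hu⟩
  have := hL.euclideanHausdorffMeasure_image_le d
  rwa [himg] at this

end Hausdorff

section Tangent

variable {d n : ℕ} {M : Set (Eucl n)}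

theorem norm_sub_starProjection_le {n : ℕ} (T : Submodule ℝ (Eucl n)) (v : Eucl n) {u : Eucl n}
    (hu : u ∈ T) : ‖v - T.starProjection v‖ ≤ ‖v - u‖ := by
  have h1 : v - T.starProjection v = (v - u) - T.starProjection (v - u) := by
    rw [map_sub, Submodule.starProjection_eq_self_iff.2 hu]; abel
  rw [h1, ← Submodule.starProjection_orthogonal_val]
  exact Submodule.norm_starProjection_apply_le _ _

theorem norm_sq_eq_starProjection {n : ℕ} (T : Submodule ℝ (Eucl n)) (v : Eucl n) :
    ‖v‖ ^ 2 = ‖T.starProjection v‖ ^ 2 + ‖v - T.starProjection v‖ ^ 2 := by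
  rw [Submodule.norm_sq_eq_add_norm_sq_starProjection v T, Submodule.starProjection_orthogonal_val]

/-- The parametrization `ℝᵈ → ℝᵈ × {0} ⊆ ℝⁿ` of the model plane of a chart. -/
def modelPlane (d n : ℕ) : (Fin d → ℝ) →L[ℝ] Eucl n :=
  LinearMap.toContinuousLinearMap
    { toFun := fun b => WithLp.toLp 2 fun i : Fin n => if h : (i : ℕ) < d then b ⟨i, h⟩ else 0
      map_add' := fun a b => by ext i; by_cases h : (i : ℕ) < d <;> simp [h]
      map_smul' := fun c b => by ext i; by_cases h : (i : ℕ) < d <;> simp [h] }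

theorem modelPlane_apply (b : Fin d → ℝ) (i : Fin n) :
    modelPlane d n b i = if h : (i : ℕ) < d then b ⟨i, h⟩ else 0 := rfl

theorem modelPlane_injective (hdn : d ≤ n) : Function.Injective (modelPlane d n) := by
  intro a b hab
  funext i
  have := congrArg (fun v : Eucl n => v ⟨i, i.2.trans_le hdn⟩) hab
  simpa [modelPlane_apply] using this

section Chart

variable {Φ : OpenPartialHomeomorph (Eucl n) (Eucl n)}

/-- A chart maps the model plane into the tangent space: `t ↦ Φ⁻¹(Φ(w) + t b)` is a curve in `M`. -/
theorem fderiv_symm_mem_tangentSpaceOf (h2 : ContDiffOn ℝ 2 Φ.symm Φ.target)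
    (hM : ∀ w ∈ Φ.source, w ∈ M ↔ ∀ i : Fin n, d ≤ (i : ℕ) → Φ w i = 0)
    {w : Eucl n} (hw : w ∈ Φ.source) (hwM : w ∈ M) {b : Eucl n}
    (hb : ∀ i : Fin n, d ≤ (i : ℕ) → b i = 0) :
    fderiv ℝ Φ.symm (Φ w) b ∈ tangentSpaceOf M w := by
  have hwt : Φ w ∈ Φ.target := Φ.map_source hw
  refine Submodule.subset_span ⟨fun t => Φ.symm (Φ w + t • b), by simp [Φ.left_inv hw], ?_, ?_⟩
  · have hc : Tendsto (fun t : ℝ => Φ w + t • b) (𝓝 0) (𝓝 (Φ w)) := by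
      have : Continuous fun t : ℝ => Φ w + t • b := by fun_prop
      simpa using this.tendsto 0
    filter_upwards [hc (Φ.open_target.mem_nhds hwt)] with t ht
    rw [hM _ (Φ.map_target ht)]
    intro i hi
    rw [Φ.right_inv ht]
    have := (hM w hw).1 hwM i hi
    simp [this, hb i hi]
  · have hd : HasFDerivAt Φ.symm (fderiv ℝ Φ.symm (Φ w)) (Φ w + (0 : ℝ) • b) := by
      simpa using ((h2.contDiffAt (Φ.open_target.mem_nhds hwt)).differentiableAt
        two_ne_zero).hasFDerivAt
    have hl : HasDerivAt (fun t : ℝ => Φ w + t • b) b 0 := by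
      simpa using ((hasDerivAt_id (0 : ℝ)).smul_const b).const_add (Φ w)
    exact hd.comp_hasDerivAt 0 hl

theorem fderiv_symm_injective (h1 : ContDiffOn ℝ 2 Φ Φ.source)
    (h2 : ContDiffOn ℝ 2 Φ.symm Φ.target) {w : Eucl n} (hw : w ∈ Φ.source) :
    Function.Injective (fderiv ℝ Φ.symm (Φ w)) := by
  have hwt : Φ w ∈ Φ.target := Φ.map_source hw
  have hd : HasFDerivAt Φ.symm (fderiv ℝ Φ.symm (Φ w)) (Φ w) :=
    ((h2.contDiffAt (Φ.open_target.mem_nhds hwt)).differentiableAt two_ne_zero).hasFDerivAt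
  have hd' : HasFDerivAt Φ (fderiv ℝ Φ w) (Φ.symm (Φ w)) := by
    rw [Φ.left_inv hw]
    exact ((h1.contDiffAt (Φ.open_source.mem_nhds hw)).differentiableAt two_ne_zero).hasFDerivAt
  have hcomp := hd'.comp (Φ w) hd
  have hid : HasFDerivAt (Φ ∘ Φ.symm) (ContinuousLinearMap.id ℝ (Eucl n)) (Φ w) := by
    refine (hasFDerivAt_id (Φ w)).congr_of_eventuallyEq ?_
    filter_upwards [Φ.open_target.mem_nhds hwt] with a ha
    exact Φ.right_inv ha
  have he := hcomp.unique hid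
  intro a b hab
  have := congrArg (fun L : Eucl n →L[ℝ] Eucl n => L a) he
  have h' := congrArg (fun L : Eucl n →L[ℝ] Eucl n => L b) he
  simp only [ContinuousLinearMap.comp_apply, ContinuousLinearMap.id_apply] at this h'
  rw [← this, ← h', hab]

/-- Points of a `C²` submanifold deviate quadratically from the tangent plane. -/
theorem exists_norm_sub_tangentProj_le (h1 : ContDiffOn ℝ 2 Φ Φ.source)
    (h2 : ContDiffOn ℝ 2 Φ.symm Φ.target)
    (hM : ∀ w ∈ Φ.source, w ∈ M ↔ ∀ i : Fin n, d ≤ (i : ℕ) → Φ w i = 0)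
    {x : Eucl n} (hx : x ∈ Φ.source) :
    ∃ r > 0, ∃ C ≥ 0, ∀ w ∈ M ∩ Metric.ball x r, ∀ w' ∈ M ∩ Metric.ball x r,
      ‖(w - w') - tangentProj M w' (w - w')‖ ≤ C * ‖w - w'‖ ^ 2 := by
  have hxt : Φ x ∈ Φ.target := Φ.map_source hx
  have hΨ : ContDiffAt ℝ 2 Φ.symm (Φ x) := h2.contDiffAt (Φ.open_target.mem_nhds hxt)
  have hΨ' : ContDiffAt ℝ 1 (fderiv ℝ Φ.symm) (Φ x) := hΨ.fderiv_right (by norm_num)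
  obtain ⟨K1, t1, ht1, hK1⟩ := hΨ'.exists_lipschitzOnWith
  obtain ⟨K2, t2, ht2, hK2⟩ := ((h1.contDiffAt (Φ.open_source.mem_nhds hx)).of_le
    (by norm_num : (1 : WithTop ℕ∞) ≤ 2)).exists_lipschitzOnWith
  obtain ⟨δ, hδ, hball⟩ := Metric.mem_nhds_iff.1
    (inter_mem ht1 (Φ.open_target.mem_nhds hxt))
  have hcont : Φ ⁻¹' Metric.ball (Φ x) δ ∈ 𝓝 x :=
    (h1.contDiffAt (Φ.open_source.mem_nhds hx)).continuousAt (Metric.ball_mem_nhds _ hδ)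
  obtain ⟨r, hr, hrball⟩ := Metric.mem_nhds_iff.1
    (inter_mem (inter_mem ht2 hcont) (Φ.open_source.mem_nhds hx))
  refine ⟨r, hr, K1 * K2 ^ 2, by positivity, ?_⟩
  rintro w ⟨hwM, hw⟩ w' ⟨hwM', hw'⟩
  obtain ⟨⟨hw2, hwb⟩, hws⟩ := hrball hw
  obtain ⟨⟨hw2', hwb'⟩, hws'⟩ := hrball hw'
  set a := Φ w
  set a' := Φ w'
  have hseg : segment ℝ a' a ⊆ Metric.ball (Φ x) δ := (convex_ball _ _).segment_subset hwb' hwb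
  have hmv : ‖Φ.symm a - Φ.symm a' - fderiv ℝ Φ.symm a' (a - a')‖ ≤
      (K1 * ‖a - a'‖) * ‖a - a'‖ := by
    refine (convex_segment a' a).norm_image_sub_le_of_norm_hasFDerivWithin_le'
      (f' := fderiv ℝ Φ.symm) (fun u hu => ?_) (fun u hu => ?_) (left_mem_segment ℝ a' a)
      (right_mem_segment ℝ a' a)
    · exact ((h2.contDiffAt (Φ.open_target.mem_nhds (hball (hseg hu)).2)).differentiableAt
        two_ne_zero).hasFDerivAt.hasFDerivWithinAt
    · have := hK1.dist_le_mul u (hball (hseg hu)).1 a' (hball hwb').1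
      rw [dist_eq_norm, dist_eq_norm] at this
      refine this.trans ?_
      gcongr
      obtain ⟨θ, hθ, rfl⟩ := segment_eq_image' ℝ a' a ▸ hu
      rw [add_sub_cancel_left, norm_smul, Real.norm_eq_abs, abs_of_nonneg hθ.1]
      exact mul_le_of_le_one_left (norm_nonneg _) hθ.2
  rw [Φ.left_inv hws, Φ.left_inv hws'] at hmv
  have hL : ‖a - a'‖ ≤ K2 * ‖w - w'‖ := by
    simpa [dist_eq_norm] using hK2.dist_le_mul w hw2 w' hw2'
  refine (norm_sub_starProjection_le _ _
    (fderiv_symm_mem_tangentSpaceOf h2 hM hws' hwM' (b := a - a') ?_)).trans (hmv.trans ?_)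
  · intro i hi
    have e1 := (hM w hws).1 hwM i hi
    have e2 := (hM w' hws').1 hwM' i hi
    simp [a, a', e1, e2]
  · calc (K1 * ‖a - a'‖) * ‖a - a'‖ = K1 * ‖a - a'‖ ^ 2 := by ring
      _ ≤ K1 * (K2 * ‖w - w'‖) ^ 2 := by gcongr
      _ = K1 * K2 ^ 2 * ‖w - w'‖ ^ 2 := by ring

theorem exists_isCompact_inter_closedBall (h1 : ContDiffOn ℝ 2 Φ Φ.source)
    (hM : ∀ w ∈ Φ.source, w ∈ M ↔ ∀ i : Fin n, d ≤ (i : ℕ) → Φ w i = 0)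
    {x : Eucl n} (hx : x ∈ Φ.source) :
    ∃ r > 0, Metric.closedBall x r ⊆ Φ.source ∧
      ∀ y s, Metric.closedBall y s ⊆ Metric.closedBall x r →
        IsCompact (M ∩ Metric.closedBall y s) := by
  obtain ⟨r, hr, hrs⟩ := Metric.nhds_basis_closedBall.mem_iff.1 (Φ.open_source.mem_nhds hx)
  refine ⟨r, hr, hrs, fun y s hys => ?_⟩
  refine (isCompact_closedBall y s).of_isClosed_subset ?_ Set.inter_subset_right
  have hE : IsClosed {a : Eucl n | ∀ i : Fin n, d ≤ (i : ℕ) → a i = 0} := by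
    simp only [Set.ofPred_forall]
    exact isClosed_iInter fun i => isClosed_iInter fun _ =>
      isClosed_eq (by fun_prop) continuous_const
  have := (h1.continuousOn.mono (hys.trans hrs)).preimage_isClosed_of_isClosed
    (Metric.isClosed_closedBall (x := y) (ε := s)) hE
  convert this using 1
  ext w
  constructor
  · rintro ⟨hwM, hw⟩
    exact ⟨hw, (hM w (hrs (hys hw))).1 hwM⟩
  · rintro ⟨hw, hw2⟩
    exact ⟨(hM w (hrs (hys hw))).2 hw2, hw⟩

/-- The projection of `M` onto a `d`-plane `T` is open near the points whose tangent plane is close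
to `T`. -/
theorem image_orthogonalProjectionOnto_mem_nhds (hdn : d ≤ n) (h1 : ContDiffOn ℝ 2 Φ Φ.source)
    (h2 : ContDiffOn ℝ 2 Φ.symm Φ.target)
    (hM : ∀ w ∈ Φ.source, w ∈ M ↔ ∀ i : Fin n, d ≤ (i : ℕ) → Φ w i = 0)
    {w : Eucl n} (hw : w ∈ Φ.source) (hwM : w ∈ M) (T : Submodule ℝ (Eucl n))
    (hT : Module.finrank ℝ T = d) (hTw : ‖tangentProj M w - T.starProjection‖ < 1)
    (y : Eucl n) {s : Set (Eucl n)} (hs : s ∈ 𝓝 w) :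
    (fun w => T.orthogonalProjectionOnto (w - y)) '' (M ∩ s) ∈
      𝓝 (T.orthogonalProjectionOnto (w - y)) := by
  have hwt : Φ w ∈ Φ.target := Φ.map_source hw
  set θ : (Fin d → ℝ) → T := fun b =>
    T.orthogonalProjectionOnto (Φ.symm (Φ w + modelPlane d n b) - y) with hθ
  have hmodel : ∀ b : Fin d → ℝ, ∀ i : Fin n, d ≤ (i : ℕ) → modelPlane d n b i = 0 :=
    fun b i hi => by simp [modelPlane_apply, not_lt.2 hi]
  have hstrict : HasStrictFDerivAt θ ((T.orthogonalProjectionOnto).comp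
      ((fderiv ℝ Φ.symm (Φ w)).comp (modelPlane d n))) 0 := by
    have e1 : HasStrictFDerivAt (fun b : Fin d → ℝ => Φ w + modelPlane d n b)
        (modelPlane d n) 0 := (modelPlane d n).hasStrictFDerivAt.const_add _
    have e2 : HasStrictFDerivAt Φ.symm (fderiv ℝ Φ.symm (Φ w)) (Φ w + modelPlane d n 0) := by
      simpa using (h2.contDiffAt (Φ.open_target.mem_nhds hwt)).hasStrictFDerivAt two_ne_zero
    exact (T.orthogonalProjectionOnto).hasStrictFDerivAt.comp 0 ((e2.comp 0 e1).sub_const y)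
  have hinj : Function.Injective ((T.orthogonalProjectionOnto).comp
      ((fderiv ℝ Φ.symm (Φ w)).comp (modelPlane d n))) := by
    rw [injective_iff_map_eq_zero]
    intro b hb
    set u := fderiv ℝ Φ.symm (Φ w) (modelPlane d n b) with hu
    have huT : u ∈ tangentSpaceOf M w :=
      fderiv_symm_mem_tangentSpaceOf h2 hM hw hwM (hmodel b)
    have hu0 : T.starProjection u = 0 := by
      have : T.orthogonalProjectionOnto u = 0 := hb
      change ((T.orthogonalProjectionOnto u : T) : Eucl n) = 0
      rw [this]; rfl
    have hu1 : tangentProj M w u = u := Submodule.starProjection_eq_self_iff.2 huT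
    have hle : ‖u‖ ≤ ‖tangentProj M w - T.starProjection‖ * ‖u‖ := by
      calc ‖u‖ = ‖(tangentProj M w - T.starProjection) u‖ := by
            rw [sub_apply, hu0, hu1, sub_zero]
        _ ≤ _ := ContinuousLinearMap.le_opNorm _ _
    have hu' : u = 0 := by
      by_contra hne
      have : 0 < ‖u‖ := norm_pos_iff.2 hne
      nlinarith
    refine modelPlane_injective hdn (fderiv_symm_injective h1 h2 hw ?_)
    rw [← hu, hu']; simp
  have hsurj : LinearMap.range ((T.orthogonalProjectionOnto).comp
      ((fderiv ℝ Φ.symm (Φ w)).comp (modelPlane d n))).toLinearMap = ⊤ := by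
    rw [LinearMap.range_eq_top]
    refine (LinearMap.injective_iff_surjective_of_finrank_eq_finrank ?_).1 hinj
    simp [hT]
  have hmap := hstrict.map_nhds_eq_of_surj hsurj
  have hθ0 : θ 0 = T.orthogonalProjectionOnto (w - y) := by simp [hθ, Φ.left_inv hw]
  rw [← hθ0, ← hmap]
  have hc1 : Tendsto (fun b : Fin d → ℝ => Φ w + modelPlane d n b) (𝓝 0) (𝓝 (Φ w)) := by
    have : Continuous fun b : Fin d → ℝ => Φ w + modelPlane d n b := by fun_prop
    simpa using this.tendsto 0
  have hc2 : Tendsto Φ.symm (𝓝 (Φ w)) (𝓝 w) := by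
    simpa [Φ.left_inv hw] using (h2.contDiffAt (Φ.open_target.mem_nhds hwt)).continuousAt.tendsto
  rw [mem_map]
  filter_upwards [hc1 (Φ.open_target.mem_nhds hwt), (hc2.comp hc1) hs] with b hb1 hb2
  refine ⟨Φ.symm (Φ w + modelPlane d n b), ⟨?_, hb2⟩, rfl⟩
  rw [hM _ (Φ.map_target hb1)]
  intro i hi
  rw [Φ.right_inv hb1]
  have := (hM w hw).1 hwM i hi
  simp [this, hmodel b i hi]

end Chart

end Tangent

section Graph

variable {d n : ℕ} {M : Set (Eucl n)}

/-- At scale `s` around `y ∈ M`, the set `M` is a graph over its tangent plane `T = T_y M` up to the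
relative error `C s`, and the projection onto `T` distorts `ℋᵈ` on `M` by at most the factor
`1 + C s²`. -/
structure IsGraphAt (d : ℕ) {n : ℕ} (M : Set (Eucl n)) (C : ℝ) (y : Eucl n) (s : ℝ) : Prop where
  norm_sub_le : ∀ w ∈ M ∩ Metric.ball y s,
    ‖(w - y) - tangentProj M y (w - y)‖ ≤ C * s * ‖w - y‖
  volume_le : ∀ A ⊆ Metric.ball (0 : tangentSpaceOf M y) (s / 2),
    volume A ≤ Measure.euclideanHausdorffMeasure d
      (M ∩ Metric.ball y s ∩ {w | (tangentSpaceOf M y).orthogonalProjectionOnto (w - y) ∈ A})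
  le_volume : ∀ A ⊆ Metric.ball (0 : tangentSpaceOf M y) (s / 2),
    Measure.euclideanHausdorffMeasure d
      (M ∩ Metric.ball y s ∩ {w | (tangentSpaceOf M y).orthogonalProjectionOnto (w - y) ∈ A}) ≤
    ENNReal.ofReal (1 + C * s ^ 2) * volume A

theorem one_add_pow_le_one_add_two_pow_mul {t : ℝ} (h0 : 0 ≤ t) (h1 : t ≤ 1) (d : ℕ) :
    (1 + t) ^ d ≤ 1 + (2 ^ d - 1) * t := by
  induction d with
  | zero => simp
  | succ d ih =>
    have h2 : (1 : ℝ) ≤ 2 ^ d := one_le_pow₀ one_le_two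
    calc (1 + t) ^ (d + 1) = (1 + t) ^ d * (1 + t) := pow_succ _ _
      _ ≤ (1 + (2 ^ d - 1) * t) * (1 + t) := by gcongr
      _ ≤ 1 + (2 ^ (d + 1) - 1) * t := by
        rw [pow_succ]
        nlinarith [mul_nonneg (sub_nonneg.2 h2) (mul_nonneg h0 (sub_nonneg.2 h1))]

/-- In a right triangle whose leg `q` is at most `t` times the hypotenuse `a`, the hypotenuse exceeds
the other leg `p` by a factor `1 + O(t²)` only. -/
theorem le_one_add_mul_of_sq_eq_add {a p q t : ℝ} (hp : 0 ≤ p) (hq : 0 ≤ q)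
    (ht : 0 ≤ t) (ht2 : t ≤ 1 / 2) (h : a ^ 2 = p ^ 2 + q ^ 2) (hqa : q ≤ t * a) :
    a ≤ (1 + 2 * t ^ 2) * p := by
  refine abs_le_of_sq_le_sq' ?_ (by positivity) |>.2
  have h1 : q ^ 2 ≤ t ^ 2 * a ^ 2 := by
    rw [← mul_pow]; exact pow_le_pow_left₀ hq hqa 2
  have h2 : a ^ 2 * (1 - t ^ 2) ≤ p ^ 2 := by nlinarith
  have h3 : t ^ 2 ≤ 1 / 4 := by nlinarith
  have h4 : (1 : ℝ) ≤ (1 - t ^ 2) * (1 + 2 * t ^ 2) ^ 2 := by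
    nlinarith [sq_nonneg t, mul_nonneg (sq_nonneg t) (sub_nonneg.2 h3),
      mul_nonneg (mul_nonneg (sq_nonneg t) (sq_nonneg t)) (sub_nonneg.2 h3)]
  calc a ^ 2 ≤ a ^ 2 * ((1 - t ^ 2) * (1 + 2 * t ^ 2) ^ 2) :=
        le_mul_of_one_le_right (sq_nonneg a) h4
    _ = (a ^ 2 * (1 - t ^ 2)) * (1 + 2 * t ^ 2) ^ 2 := by ring
    _ ≤ p ^ 2 * (1 + 2 * t ^ 2) ^ 2 := by gcongr
    _ = ((1 + 2 * t ^ 2) * p) ^ 2 := by ring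

/-- A `C²` submanifold is a graph over its tangent planes, uniformly near each of its points.
The projection `π` of `M ∩ B(y, s)` onto `T_y M` is `1`-Lipschitz and its inverse is
`(1 + O(s²))`-Lipschitz. The image of `π` contains the ball of radius `s / 2`, because its trace on
that ball is open (inverse function theorem) and closed (compactness). -/
theorem exists_isGraphAt (hdn : d ≤ n) (hM : IsC2Submanifold d M)
    (hdim : ∀ y ∈ M, Module.finrank ℝ (tangentSpaceOf M y) = d) {x : Eucl n} (hx : x ∈ M)
    {r Λ : ℝ} (hr : 0 < r) (hΛ : 0 ≤ Λ)
    (hLip : ∀ w ∈ M ∩ Metric.ball x r, ∀ w' ∈ M ∩ Metric.ball x r,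
      ‖tangentProj M w - tangentProj M w'‖ ≤ Λ * ‖w - w'‖) :
    ∃ r₀ > 0, ∃ C ≥ 0, ∀ y ∈ M ∩ Metric.ball x r₀, ∀ s, 0 < s → s ≤ r₀ →
      IsGraphAt d M C y s := by
  obtain ⟨Φ, hxs, h1, h2, hMΦ⟩ := hM x hx
  obtain ⟨r1, hr1, C1, hC1, hquad⟩ := exists_norm_sub_tangentProj_le h1 h2 hMΦ hxs
  obtain ⟨r3, hr3, hsrc, hcpt⟩ := exists_isCompact_inter_closedBall h1 hMΦ hxs
  set C : ℝ := 2 * C1 + Λ with hC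
  have hC0 : 0 ≤ C := by positivity
  set r₀ : ℝ := min (min (r1 / 3) (r / 3)) (min (r3 / 3) (1 / (4 * (C + 1)))) with hr₀
  have hr₀0 : 0 < r₀ := by positivity
  have hb1 : 3 * r₀ ≤ r1 := by
    have : r₀ ≤ r1 / 3 := (min_le_left _ _).trans (min_le_left _ _)
    linarith
  have hb2 : 3 * r₀ ≤ r := by
    have : r₀ ≤ r / 3 := (min_le_left _ _).trans (min_le_right _ _)
    linarith
  have hb3 : 3 * r₀ ≤ r3 := by
    have : r₀ ≤ r3 / 3 := (min_le_right _ _).trans (min_le_left _ _)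
    linarith
  have hb4 : C * (2 * r₀) ≤ 1 / 2 := by
    have : r₀ ≤ 1 / (4 * (C + 1)) := (min_le_right _ _).trans (min_le_right _ _)
    rw [le_div_iff₀ (by positivity)] at this
    nlinarith
  -- quadratic deviation from the tangent plane at the centre `y`, for pairs of points
  have hdev : ∀ y ∈ M ∩ Metric.ball x r₀, ∀ s, 0 < s → s ≤ 2 * r₀ →
      ∀ w ∈ M ∩ Metric.ball y s, ∀ w' ∈ M ∩ Metric.ball y s,
      ‖(w - w') - tangentProj M y (w - w')‖ ≤ C * s * ‖w - w'‖ := by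
    rintro y ⟨hyM, hy⟩ s hs hs2 w ⟨hwM, hw⟩ w' ⟨hwM', hw'⟩
    rw [Metric.mem_ball] at hy hw hw'
    have hwx : dist w x < 3 * r₀ := by
      have := dist_triangle w y x; linarith
    have hwx' : dist w' x < 3 * r₀ := by
      have := dist_triangle w' y x; linarith
    have q1 := hquad w ⟨hwM, hwx.trans_le hb1⟩ w' ⟨hwM', hwx'.trans_le hb1⟩
    have q2 := hLip w' ⟨hwM', hwx'.trans_le hb2⟩ y
      ⟨hyM, (hy.trans_le (by linarith)).trans_le hb2⟩
    have q3 : ‖w - w'‖ ≤ 2 * s := by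
      rw [← dist_eq_norm]
      have := dist_triangle_right w w' y; linarith
    have q4 : ‖w' - y‖ ≤ s := by rw [← dist_eq_norm]; exact hw'.le
    have e : (w - w') - tangentProj M y (w - w') = ((w - w') - tangentProj M w' (w - w')) +
        (tangentProj M w' - tangentProj M y) (w - w') := by
      rw [sub_apply]; abel
    rw [e]
    refine (norm_add_le _ _).trans ?_
    have q5 : ‖(tangentProj M w' - tangentProj M y) (w - w')‖ ≤ (Λ * s) * ‖w - w'‖ := by
      refine (ContinuousLinearMap.le_opNorm _ _).trans ?_
      gcongr
      exact q2.trans (by gcongr)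
    have q6 : C1 * ‖w - w'‖ ^ 2 ≤ C1 * (2 * s) * ‖w - w'‖ := by
      rw [sq, ← mul_assoc]; gcongr
    rw [hC]; linarith
  -- hence the projection onto the tangent plane at `y` contracts by a factor `1 + O(s²)` at most
  have hexp : ∀ y ∈ M ∩ Metric.ball x r₀, ∀ s, 0 < s → s ≤ 2 * r₀ →
      ∀ w ∈ M ∩ Metric.ball y s, ∀ w' ∈ M ∩ Metric.ball y s,
      ‖w - w'‖ ≤ (1 + 2 * (C * s) ^ 2) * ‖tangentProj M y (w - w')‖ := by
    intro y hy s hs hs2 w hw w' hw'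
    refine le_one_add_mul_of_sq_eq_add (norm_nonneg _) (norm_nonneg _)
      (by positivity) (le_trans (by gcongr) hb4) (norm_sq_eq_starProjection (tangentSpaceOf M y) _)
      (hdev y hy s hs hs2 w hw w' hw')
  refine ⟨r₀, hr₀0, C + 2 ^ d * (2 * C ^ 2), by positivity, fun y hy s hs hsr => ?_⟩
  set T := tangentSpaceOf M y with hT
  set π : Eucl n → T := fun w => T.orthogonalProjectionOnto (w - y) with hπ
  have hyx : dist y x < r₀ := hy.2
  have hbsrc : Metric.ball y s ⊆ Φ.source := by
    intro w hw
    refine hsrc (Metric.mem_closedBall.2 ?_)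
    have := dist_triangle w y x
    rw [Metric.mem_ball] at hw; linarith
  have hπsub : ∀ w w', ‖π w - π w'‖ = ‖tangentProj M y (w - w')‖ := by
    intro w w'
    rw [hπ, ← map_sub, sub_sub_sub_cancel_right]; rfl
  -- the image of `M ∩ B(y, s)` contains the ball of radius `s / 2`
  have hsurj : Metric.ball (0 : T) (s / 2) ⊆ π '' (M ∩ Metric.ball y s) := by
    refine (convex_ball (0 : T) (s / 2)).isPreconnected.subset_of_closure_inter_subset ?_ ?_ ?_
    · rw [isOpen_iff_mem_nhds]
      rintro _ ⟨w, ⟨hwM, hw⟩, rfl⟩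
      refine image_orthogonalProjectionOnto_mem_nhds hdn h1 h2 hMΦ (hbsrc hw) hwM T (hdim y hy.1)
        ?_ y (Metric.isOpen_ball.mem_nhds hw)
      have hwy : ‖w - y‖ ≤ s := by rw [← dist_eq_norm]; exact (Metric.mem_ball.1 hw).le
      have hwx : dist w x < r := by
        have := dist_triangle w y x
        have := Metric.mem_ball.1 hw; linarith
      have := hLip w ⟨hwM, hwx⟩ y ⟨hy.1, Metric.mem_ball.2 (by linarith)⟩
      have h3 : Λ * ‖w - y‖ ≤ C * (2 * r₀) := by
        have : Λ ≤ C := by rw [hC]; linarith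
        gcongr; linarith
      change ‖tangentProj M w - tangentProj M y‖ < 1
      linarith
    · refine ⟨0, Metric.mem_ball_self (by positivity), y, ⟨hy.1, Metric.mem_ball_self hs⟩, ?_⟩
      simp [hπ]
    · rintro v ⟨hv, hvb⟩
      have hK : IsCompact (M ∩ Metric.closedBall y s) := hcpt y s (by
        intro w hw
        have := dist_triangle w y x
        rw [Metric.mem_closedBall] at hw ⊢; linarith)
      have hcl : closure (π '' (M ∩ Metric.ball y s)) ⊆ π '' (M ∩ Metric.closedBall y s) := by
        refine closure_minimal (Set.image_mono (Set.inter_subset_inter_right _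
          Metric.ball_subset_closedBall)) (hK.image ?_).isClosed
        exact T.orthogonalProjectionOnto.continuous.comp (by fun_prop)
      obtain ⟨w, ⟨hwM, hw⟩, rfl⟩ := hcl hv
      refine ⟨w, ⟨hwM, ?_⟩, rfl⟩
      have h3 := hexp y hy (2 * s) (by positivity) (by linarith) w
        ⟨hwM, Metric.closedBall_subset_ball (by linarith) hw⟩ y
        ⟨hy.1, Metric.mem_ball_self (by positivity)⟩
      have h4 : ‖π w‖ < s / 2 := by simpa using hvb
      have h5 : ‖tangentProj M y (w - y)‖ < s / 2 := by
        rw [← hπsub]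
        have : π y = 0 := by simp [hπ]
        rwa [this, sub_zero]
      have h6 : C * (2 * s) ≤ 1 / 2 := le_trans (by gcongr) hb4
      have h6' : (C * (2 * s)) ^ 2 ≤ (1 / 2) ^ 2 := by gcongr
      rw [Metric.mem_ball, dist_eq_norm]
      nlinarith [norm_nonneg (tangentProj M y (w - y))]
  have himg : ∀ A ⊆ Metric.ball (0 : T) (s / 2),
      π '' (M ∩ Metric.ball y s ∩ {w | π w ∈ A}) = A := by
    intro A hA
    ext v
    constructor
    · rintro ⟨w, hw, rfl⟩; exact hw.2
    · intro hv
      obtain ⟨w, hw, rfl⟩ := hsurj (hA hv)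
      exact ⟨w, ⟨hw, hv⟩, rfl⟩
  have hvol : (volume : Measure T) = Measure.euclideanHausdorffMeasure d := by
    rw [← InnerProductSpace.euclideanHausdorffMeasure_eq_volume, hdim y hy.1]
  refine ⟨fun w hw => ?_, fun A hA => ?_, fun A hA => ?_⟩
  · refine (hdev y hy s hs (by linarith) w hw y ⟨hy.1, Metric.mem_ball_self hs⟩).trans ?_
    gcongr
    exact le_add_of_nonneg_right (by positivity)
  · rw [hvol]
    have hL : LipschitzOnWith 1 π (M ∩ Metric.ball y s ∩ {w | π w ∈ A}) := by
      refine LipschitzOnWith.of_dist_le_mul fun w _ w' _ => ?_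
      rw [dist_eq_norm, dist_eq_norm, hπsub, NNReal.coe_one, one_mul]
      exact Submodule.norm_starProjection_apply_le _ _
    have := hL.euclideanHausdorffMeasure_image_le d
    rwa [himg A hA, ENNReal.coe_one, one_pow, one_mul] at this
  · set k : ℝ := 1 + 2 * (C * s) ^ 2 with hk
    have hk0 : 0 ≤ k := by positivity
    have hL : ∀ u ∈ M ∩ Metric.ball y s ∩ {w | π w ∈ A},
        ∀ v ∈ M ∩ Metric.ball y s ∩ {w | π w ∈ A}, edist u v ≤ k.toNNReal * edist (π u) (π v) := by
      intro u hu v hv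
      rw [edist_dist, edist_dist, ← ENNReal.ofReal_coe_nnreal, Real.coe_toNNReal _ hk0,
        ← ENNReal.ofReal_mul hk0]
      refine ENNReal.ofReal_le_ofReal ?_
      rw [dist_eq_norm, dist_eq_norm, hπsub]
      exact hexp y hy s hs (by linarith) u hu.1 v hv.1
    have := euclideanHausdorffMeasure_le_of_edist_le hL d
    rw [himg A hA] at this
    rw [hvol]
    refine this.trans ?_
    gcongr
    rw [← ENNReal.ofReal_coe_nnreal, Real.coe_toNNReal _ hk0, ← ENNReal.ofReal_pow hk0]
    refine ENNReal.ofReal_le_ofReal ?_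
    have h6 : C * s ≤ 1 / 2 := le_trans (by gcongr; linarith) hb4
    have h6' : (C * s) ^ 2 ≤ (1 / 2) ^ 2 := by gcongr
    refine (one_add_pow_le_one_add_two_pow_mul (by positivity) (by linarith) d).trans ?_
    have : 0 ≤ C * s ^ 2 := by positivity
    have : 0 ≤ (C * s) ^ 2 := by positivity
    nlinarith

end Graph

/-! ### Blow-up of the surface measure -/

theorem abs_integral_sub_integral_le_of_measure_le {X : Type*} [MeasurableSpace X] {ν m : Measure X}
    {δ : ℝ} (hδ : 0 ≤ δ) (h1 : ν ≤ m) (h2 : m ≤ ENNReal.ofReal (1 + δ) • ν) {g : X → ℝ}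
    (hg : Integrable g ν) : |∫ x, g x ∂m - ∫ x, g x ∂ν| ≤ δ * ∫ x, |g x| ∂ν := by
  have hgc : Integrable g (ENNReal.ofReal (1 + δ) • ν) := hg.smul_measure ENNReal.ofReal_ne_top
  have hgm : Integrable g m := hgc.mono_measure h2
  have key : ∀ f : X → ℝ, Integrable f ν → (∀ x, 0 ≤ f x) →
      ∫ x, f x ∂ν ≤ ∫ x, f x ∂m ∧ ∫ x, f x ∂m ≤ (1 + δ) * ∫ x, f x ∂ν := by
    intro f hf hf0
    have hfc : Integrable f (ENNReal.ofReal (1 + δ) • ν) := hf.smul_measure ENNReal.ofReal_ne_top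
    refine ⟨integral_mono_measure h1 (Eventually.of_forall hf0) (hfc.mono_measure h2), ?_⟩
    refine (integral_mono_measure h2 (Eventually.of_forall hf0) hfc).trans ?_
    rw [integral_smul_measure, ENNReal.toReal_ofReal (by positivity), smul_eq_mul]
  obtain ⟨a1, a2⟩ := key (fun x => |g x| + g x) (hg.abs.add hg)
    fun x => by have := neg_abs_le (g x); linarith
  obtain ⟨b1, b2⟩ := key (fun x => |g x| - g x) (hg.abs.sub hg)
    fun x => by have := le_abs_self (g x); linarith
  rw [integral_add hg.abs hg, integral_add hgm.abs hgm] at a1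
  rw [integral_add hg.abs hg, integral_add hgm.abs hgm] at a2
  rw [integral_sub hg.abs hg, integral_sub hgm.abs hgm] at b1
  rw [integral_sub hg.abs hg, integral_sub hgm.abs hgm] at b2
  have h3 := abs_integral_le_integral_abs (f := g) (μ := ν)
  rw [abs_le] at h3 ⊢
  constructor <;> nlinarith

section Blowup

variable {d n : ℕ} {M : Set (Eucl n)}

/-- The `d`-dimensional surface measure `ℋᵈ` restricted to `M`. -/
abbrev surfaceMeasure (d : ℕ) {n : ℕ} (M : Set (Eucl n)) : Measure (Eucl n) :=
  (Measure.euclideanHausdorffMeasure d).restrict M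

/-- The projection `w ↦ π(w - y)` onto the tangent space at `y`, as a map into that space. -/
abbrev toTangent (M : Set (Eucl n)) (y w : Eucl n) : tangentSpaceOf M y :=
  (tangentSpaceOf M y).orthogonalProjectionOnto (w - y)

theorem continuous_toTangent (y : Eucl n) : Continuous (toTangent M y) :=
  (tangentSpaceOf M y).orthogonalProjectionOnto.continuous.comp (by fun_prop)

theorem norm_toTangent_le (y w : Eucl n) : ‖toTangent M y w‖ ≤ ‖w - y‖ :=
  Submodule.norm_starProjection_apply_le (tangentSpaceOf M y) (w - y)

theorem coe_toTangent (y w : Eucl n) :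
    (toTangent M y w : Eucl n) = tangentProj M y (w - y) := rfl

variable {C : ℝ} {y : Eucl n} {s ε : ℝ}

/-- Up to a relative error `C s²`, the projection onto the tangent space carries the surface measure
to Lebesgue measure. -/
theorem IsGraphAt.abs_setIntegral_toTangent_sub_le (hG : IsGraphAt d M C y s)
    (hC : 0 ≤ C) {g : tangentSpaceOf M y → ℝ} (hg : Continuous g)
    (hg0 : ∀ v, s / 2 ≤ ‖v‖ → g v = 0) :
    |∫ w in Metric.ball y s, g (toTangent M y w) ∂(surfaceMeasure d M) - ∫ v, g v| ≤
      C * s ^ 2 * ∫ v, |g v| := by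
  set B : Set (tangentSpaceOf M y) := Metric.ball 0 (s / 2) with hB
  set m := ((surfaceMeasure d M).restrict (Metric.ball y s)).map (toTangent M y) with hm
  have hπ := (continuous_toTangent (M := M) y)
  have hoff : ∀ v, v ∉ B → g v = 0 := fun v hv => hg0 v (by simpa [hB] using hv)
  have hint : Integrable g := by
    refine hg.integrable_of_hasCompactSupport ?_
    refine HasCompactSupport.intro (isCompact_closedBall (0 : tangentSpaceOf M y) (s / 2))
      fun v hv => hoff v fun h => hv (Metric.ball_subset_closedBall h)
  have e1 : ∫ w in Metric.ball y s, g (toTangent M y w) ∂(surfaceMeasure d M) =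
      ∫ v in B, g v ∂m := by
    rw [setIntegral_eq_integral_of_forall_compl_eq_zero hoff, hm,
      integral_map hπ.aemeasurable hg.aestronglyMeasurable]
  have e2 : ∫ v, g v = ∫ v in B, g v := (setIntegral_eq_integral_of_forall_compl_eq_zero hoff).symm
  have e3 : ∫ v, |g v| = ∫ v in B, |g v| :=
    (setIntegral_eq_integral_of_forall_compl_eq_zero fun v hv => by simp [hoff v hv]).symm
  have hmA : ∀ A, MeasurableSet A → m.restrict B A = Measure.euclideanHausdorffMeasure d
      (M ∩ Metric.ball y s ∩ {w | toTangent M y w ∈ A ∩ B}) := by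
    intro A hA
    have hAB : MeasurableSet (A ∩ B) := hA.inter measurableSet_ball
    rw [Measure.restrict_apply hA, hm, Measure.map_apply hπ.measurable hAB,
      Measure.restrict_apply (hπ.measurable hAB),
      Measure.restrict_apply ((hπ.measurable hAB).inter measurableSet_ball)]
    congr 1
    ext w
    simp only [Set.mem_inter_iff, Set.mem_preimage, Set.mem_ofPred_eq]
    tauto
  rw [e1, e2, e3]
  refine abs_integral_sub_integral_le_of_measure_le (by positivity) ?_ ?_ hint.integrableOn
  · refine Measure.le_iff.2 fun A hA => ?_
    rw [hmA A hA, Measure.restrict_apply hA]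
    exact hG.volume_le _ Set.inter_subset_right
  · refine Measure.le_iff.2 fun A hA => ?_
    rw [hmA A hA, Measure.smul_apply, Measure.restrict_apply hA, smul_eq_mul]
    exact hG.le_volume _ Set.inter_subset_right

/-- The volume of the unit ball of `ℝᵈ`. -/
abbrev unitBallVolume (d : ℕ) : ℝ := volume.real (Metric.ball (0 : Eucl d) 1)

theorem volume_ball_tangentSpaceOf (hdim : Module.finrank ℝ (tangentSpaceOf M y) = d)
    {r : ℝ} (hr : 0 < r) :
    volume (Metric.ball (0 : tangentSpaceOf M y) r) =
      ENNReal.ofReal (r ^ d * unitBallVolume d) := by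
  rw [Measure.addHaar_ball_of_pos volume _ hr, hdim, ENNReal.ofReal_mul (by positivity),
    unitBallVolume, ← volume_real_unitBall_eq hdim, measureReal_def,
    ENNReal.ofReal_toReal measure_ball_lt_top.ne]

/-- The surface measure of a ball of radius `2 ε` centred at `y ∈ M`. -/
theorem IsGraphAt.surfaceMeasure_ball_le (hG : IsGraphAt d M C y (4 * ε)) (hC : 0 ≤ C)
    (hdim : Module.finrank ℝ (tangentSpaceOf M y) = d) (hε : 0 < ε)
    (hCε : C * (4 * ε) ≤ 1 / 2) (hε1 : ε ≤ 1 / 2) :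
    surfaceMeasure d M (Metric.ball y (2 * ε)) ≤
      ENNReal.ofReal (2 * (2 * ε) ^ d * unitBallVolume d) := by
  have h1 := hG.le_volume (Metric.ball 0 (4 * ε / 2)) subset_rfl
  rw [volume_ball_tangentSpaceOf hdim (by positivity), ← ENNReal.ofReal_mul (by positivity)] at h1
  rw [Measure.restrict_apply measurableSet_ball]
  refine (measure_mono ?_).trans (h1.trans (ENNReal.ofReal_le_ofReal ?_))
  · rintro w ⟨hw, hwM⟩
    refine ⟨⟨hwM, Metric.ball_subset_ball (by linarith) hw⟩, ?_⟩
    rw [Metric.mem_ball, dist_eq_norm] at hw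
    simp only [Set.mem_ofPred_eq, Metric.mem_ball, dist_zero_right]
    refine (norm_toTangent_le y w).trans_lt (by linarith)
  · have h2 : 4 * ε / 2 = 2 * ε := by ring
    rw [h2, ← mul_assoc]
    have h3 : 1 + C * (4 * ε) ^ 2 ≤ 2 := by nlinarith
    gcongr

theorem IsGraphAt.integrable_comp (hG : IsGraphAt d M C y (4 * ε)) (hC : 0 ≤ C)
    (hdim : Module.finrank ℝ (tangentSpaceOf M y) = d) (hε : 0 < ε)
    (hCε : C * (4 * ε) ≤ 1 / 2) (hε1 : ε ≤ 1 / 2) {H : Eucl n → ℝ} (hH : Continuous H)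
    (hH1 : ∀ w, ε ≤ ‖w - y‖ → H w = 0) : Integrable H (surfaceMeasure d M) := by
  have hoff : ∀ w, w ∉ Metric.ball y (2 * ε) → H w = 0 := fun w hw => hH1 w (by
    rw [Metric.mem_ball, dist_eq_norm, not_lt] at hw; linarith)
  rw [← integrableOn_iff_integrable_of_support_subset (s := Metric.ball y (2 * ε))]
  · obtain ⟨K, hK⟩ := (isCompact_closedBall y (2 * ε)).exists_bound_of_continuousOn hH.continuousOn
    refine Measure.integrableOn_of_bounded (M := K)
      ((hG.surfaceMeasure_ball_le hC hdim hε hCε hε1).trans_lt ENNReal.ofReal_lt_top).ne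
      hH.aestronglyMeasurable ?_
    filter_upwards [ae_restrict_mem measurableSet_ball] with w hw
    exact hK w (Metric.ball_subset_closedBall hw)
  · intro w hw
    by_contra h
    exact hw (hoff w h)

/-- If a kernel `H` on `ℝⁿ` and a kernel `h` on the tangent space agree up to `e` along `M`, then
`∫ H((w - y)/ε) dℋᵈ(w)` agrees with `εᵈ ∫_T h` up to `O(e + ε²) εᵈ`. -/
theorem IsGraphAt.abs_integral_sub_le (hG : IsGraphAt d M C y (4 * ε)) (hMm : MeasurableSet M)
    (hC : 0 ≤ C) (hdim : Module.finrank ℝ (tangentSpaceOf M y) = d) (hε : 0 < ε)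
    (hCε : C * (4 * ε) ≤ 1 / 2) (hε1 : ε ≤ 1 / 2) {H : Eucl n → ℝ} (hH : Continuous H)
    (hH1 : ∀ u, 1 ≤ ‖u‖ → H u = 0) {h : tangentSpaceOf M y → ℝ} (hh : Continuous h)
    (hh1 : ∀ v, 1 ≤ ‖v‖ → h v = 0) {ℓ e : ℝ} (he0 : 0 ≤ e) (hℓ : ∀ v, |h v| ≤ ℓ)
    (he : ∀ w ∈ M ∩ Metric.ball y (2 * ε),
      |H (ε⁻¹ • (w - y)) - h (ε⁻¹ • toTangent M y w)| ≤ e) :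
    |∫ w, H (ε⁻¹ • (w - y)) ∂(surfaceMeasure d M) - ε ^ d * ∫ v, h v| ≤
      ε ^ d * (unitBallVolume d * (2 ^ (d + 1) * e + 16 * C * ε ^ 2 * ℓ)) := by
  set μ := surfaceMeasure d M with hμ
  have hoffH : ∀ w, ε ≤ ‖w - y‖ → H (ε⁻¹ • (w - y)) = 0 := fun w hw => hH1 _ (by
    rw [norm_smul, norm_inv, Real.norm_eq_abs, abs_of_pos hε, ← div_eq_inv_mul, le_div_iff₀ hε]
    simpa using hw)
  have hoffh : ∀ v, ε ≤ ‖v‖ → h (ε⁻¹ • v) = 0 := fun v hv => hh1 _ (by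
    rw [norm_smul, norm_inv, Real.norm_eq_abs, abs_of_pos hε, ← div_eq_inv_mul, le_div_iff₀ hε]
    simpa using hv)
  -- on `M`, the projection does not shrink distances to `y` by more than a factor `2`
  have hfar : ∀ w ∈ M ∩ Metric.ball y (4 * ε), w ∉ Metric.ball y (2 * ε) →
      ε ≤ ‖toTangent M y w‖ := by
    intro w hw hw2
    have h1 := hG.norm_sub_le w hw
    rw [Metric.mem_ball, dist_eq_norm, not_lt] at hw2
    have h2 : ‖w - y‖ - ‖tangentProj M y (w - y)‖ ≤ ‖(w - y) - tangentProj M y (w - y)‖ :=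
      norm_sub_norm_le _ _
    have h3 : C * (4 * ε) * ‖w - y‖ ≤ 1 / 2 * ‖w - y‖ := by gcongr
    have h4 : ‖toTangent M y w‖ = ‖tangentProj M y (w - y)‖ := rfl
    rw [h4]; linarith
  have hHi : Integrable (fun w => H (ε⁻¹ • (w - y))) μ :=
    hG.integrable_comp hC hdim hε hCε hε1 (by fun_prop) hoffH
  have hgc : Continuous fun v : tangentSpaceOf M y => h (ε⁻¹ • v) := by fun_prop
  have hmain := hG.abs_setIntegral_toTangent_sub_le hC hgc
    (fun v hv => hoffh v (by linarith))
  have hscale : ∀ f : tangentSpaceOf M y → ℝ, ∫ v, f (ε⁻¹ • v) = ε ^ d * ∫ v, f v := by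
    intro f
    rw [Measure.integral_comp_inv_smul_of_nonneg _ _ hε.le, hdim, smul_eq_mul]
  rw [hscale, hscale fun v => |h v|] at hmain
  have hbd : ∫ v, |h v| ≤ unitBallVolume d * ℓ := by
    have e1 : ∫ v, |h v| = ∫ v in Metric.ball 0 1, |h v| :=
      (setIntegral_eq_integral_of_forall_compl_eq_zero fun v hv => by
        simp [hh1 v (by simpa using hv)]).symm
    rw [e1]
    have := norm_setIntegral_le_of_norm_le_const (f := fun v => |h v|) (C := ℓ)
      (measure_ball_lt_top (μ := volume) (x := (0 : tangentSpaceOf M y)) (r := 1))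
      (fun v _ => by simpa using hℓ v)
    rw [volume_real_unitBall_eq hdim, mul_comm] at this
    exact (le_abs_self _).trans this
  have hsplit : ∫ w, H (ε⁻¹ • (w - y)) ∂μ - ∫ w in Metric.ball y (4 * ε),
      h (ε⁻¹ • toTangent M y w) ∂μ = ∫ w in Metric.ball y (2 * ε),
        (H (ε⁻¹ • (w - y)) - h (ε⁻¹ • toTangent M y w)) ∂μ := by
    have e1 : ∫ w, H (ε⁻¹ • (w - y)) ∂μ = ∫ w in Metric.ball y (2 * ε), H (ε⁻¹ • (w - y)) ∂μ :=
      (setIntegral_eq_integral_of_forall_compl_eq_zero fun w hw => hoffH w (by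
        rw [Metric.mem_ball, dist_eq_norm, not_lt] at hw; linarith)).symm
    have e2 : ∫ w in Metric.ball y (4 * ε), h (ε⁻¹ • toTangent M y w) ∂μ =
        ∫ w in Metric.ball y (2 * ε), h (ε⁻¹ • toTangent M y w) ∂μ := by
      refine setIntegral_eq_of_subset_of_ae_sdiff_eq_zero measurableSet_ball.nullMeasurableSet
        (Metric.ball_subset_ball (by linarith)) ?_
      filter_upwards [ae_restrict_mem hMm] with w hwM hw
      exact hoffh _ (hfar w ⟨hwM, hw.1⟩ hw.2)
    rw [e1, e2, integral_sub hHi.integrableOn]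
    refine Measure.integrableOn_of_bounded (M := ℓ)
      ((hG.surfaceMeasure_ball_le hC hdim hε hCε hε1).trans_lt ENNReal.ofReal_lt_top).ne
      (hgc.comp (continuous_toTangent y)).aestronglyMeasurable (Eventually.of_forall fun w => hℓ _)
  have hdiff : |∫ w in Metric.ball y (2 * ε),
      (H (ε⁻¹ • (w - y)) - h (ε⁻¹ • toTangent M y w)) ∂μ| ≤
      e * (2 * (2 * ε) ^ d * unitBallVolume d) := by
    have hfin := hG.surfaceMeasure_ball_le hC hdim hε hCε hε1
    have := norm_setIntegral_le_of_norm_le_const_ae' (μ := μ) (s := Metric.ball y (2 * ε))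
      (f := fun w => H (ε⁻¹ • (w - y)) - h (ε⁻¹ • toTangent M y w)) (C := e)
      (hfin.trans_lt ENNReal.ofReal_lt_top) (by
        filter_upwards [ae_restrict_mem hMm] with w hwM hw
        exact he w ⟨hwM, hw⟩)
    refine this.trans ?_
    gcongr
    exact ENNReal.toReal_le_of_le_ofReal (by positivity) hfin
  rw [← hsplit] at hdiff
  have htri : |∫ w, H (ε⁻¹ • (w - y)) ∂μ - ε ^ d * ∫ v, h v| ≤
      e * (2 * (2 * ε) ^ d * unitBallVolume d) + C * (4 * ε) ^ 2 * (ε ^ d * ∫ v, |h v|) := by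
    refine le_trans ?_ (add_le_add hdiff hmain)
    exact abs_sub_le _ _ _
  refine htri.trans ?_
  have h7 : C * (4 * ε) ^ 2 * (ε ^ d * ∫ v, |h v|) ≤
      C * (4 * ε) ^ 2 * (ε ^ d * (unitBallVolume d * ℓ)) := by gcongr
  refine (add_le_add_right h7 _).trans (le_of_eq ?_)
  rw [mul_pow, pow_succ]
  ring

end Blowup

section BlowupLimits

variable {d n : ℕ} {M : Set (Eucl n)} {C : ℝ} {y : Eucl n} {ε : ℝ}

theorem IsGraphAt.norm_sub_toTangent_le (hG : IsGraphAt d M C y (4 * ε)) (hε : 0 < ε)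
    {w : Eucl n} (hw : w ∈ M ∩ Metric.ball y (2 * ε)) :
    ‖ε⁻¹ • (w - y) - ((ε⁻¹ • toTangent M y w : tangentSpaceOf M y) : Eucl n)‖ ≤
      4 * C * ε * ‖ε⁻¹ • (w - y)‖ ∧ ‖ε⁻¹ • (w - y)‖ ≤ 2 := by
  have hw2 : ‖w - y‖ < 2 * ε := by rw [← dist_eq_norm]; exact hw.2
  have h1 := hG.norm_sub_le w ⟨hw.1, Metric.ball_subset_ball (by linarith) hw.2⟩
  have e : ε⁻¹ • (w - y) - ((ε⁻¹ • toTangent M y w : tangentSpaceOf M y) : Eucl n) =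
      ε⁻¹ • ((w - y) - tangentProj M y (w - y)) := by
    rw [Submodule.coe_smul, coe_toTangent, smul_sub ε⁻¹ (w - y)]
  have hn : ∀ v : Eucl n, ‖ε⁻¹ • v‖ = ε⁻¹ * ‖v‖ := fun v => by
    rw [norm_smul, norm_inv, Real.norm_eq_abs, abs_of_pos hε]
  rw [e, hn, hn]
  constructor
  · calc ε⁻¹ * ‖(w - y) - tangentProj M y (w - y)‖ ≤ ε⁻¹ * (C * (4 * ε) * ‖w - y‖) := by gcongr
      _ = _ := by ring
  · rw [inv_mul_le_iff₀ hε]; linarith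

/-- Blow-up of the surface measure against a Lipschitz kernel. -/
theorem IsGraphAt.abs_integral_lipschitz_sub_le (hG : IsGraphAt d M C y (4 * ε))
    (hMm : MeasurableSet M) (hC : 0 ≤ C) (hdim : Module.finrank ℝ (tangentSpaceOf M y) = d)
    (hε : 0 < ε) (hCε : C * (4 * ε) ≤ 1 / 2) (hε1 : ε ≤ 1 / 2) {H : Eucl n → ℝ} {ℓ : ℝ}
    (hH : Continuous H) (hL : ∀ u v, |H u - H v| ≤ ℓ * ‖u - v‖) (hH1 : ∀ u, 1 ≤ ‖u‖ → H u = 0)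
    (hb : ∀ u, |H u| ≤ ℓ) :
    |∫ w, H (ε⁻¹ • (w - y)) ∂(surfaceMeasure d M) -
      ε ^ d * ∫ v : tangentSpaceOf M y, H (v : Eucl n)| ≤
      ε ^ (d + 1) * (unitBallVolume d * 2 ^ (d + 5) * C * ℓ) := by
  have hℓ : 0 ≤ ℓ := (abs_nonneg _).trans (hb 0)
  refine (hG.abs_integral_sub_le hMm hC hdim hε hCε hε1 hH hH1
    (h := fun v : tangentSpaceOf M y => H (v : Eucl n)) (ℓ := ℓ) (e := 8 * C * ε * ℓ)
    (hH.comp continuous_subtype_val) (fun v hv => hH1 _ hv) (by positivity) (fun v => hb _)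
    (fun w hw => ?_)).trans ?_
  · obtain ⟨h1, h2⟩ := hG.norm_sub_toTangent_le hε hw
    refine (hL _ _).trans ?_
    have : 4 * C * ε * ‖ε⁻¹ • (w - y)‖ ≤ 4 * C * ε * 2 := by gcongr
    calc ℓ * _ ≤ ℓ * (4 * C * ε * 2) := by gcongr; exact h1.trans this
      _ = _ := by ring
  · rw [pow_succ ε d, mul_assoc (ε ^ d) ε]
    refine mul_le_mul_of_nonneg_left ?_ (by positivity)
    have h3 : (1 : ℝ) ≤ 2 ^ d := one_le_pow₀ one_le_two
    have h4 : 16 * C * ε ^ 2 * ℓ ≤ 16 * 2 ^ d * (C * ε * ℓ) := by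
      have : ε ^ 2 ≤ 2 ^ d * ε := by nlinarith
      calc 16 * C * ε ^ 2 * ℓ ≤ 16 * C * (2 ^ d * ε) * ℓ := by gcongr
        _ = _ := by ring
    have h5 : 2 ^ (d + 1) * (8 * C * ε * ℓ) + 16 * C * ε ^ 2 * ℓ ≤
        ε * (2 ^ (d + 5) * C * ℓ) := by
      calc _ ≤ 2 ^ (d + 1) * (8 * C * ε * ℓ) + 16 * 2 ^ d * (C * ε * ℓ) := by gcongr
        _ = _ := by rw [pow_succ, pow_add]; ring
    calc _ ≤ unitBallVolume d * (ε * (2 ^ (d + 5) * C * ℓ)) := by gcongr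
      _ = _ := by ring

variable {ρ g : ℝ → ℝ} {L : NNReal}

/-- Against a constant vector `a` tangent to `M`, the odd kernel `κ` integrates to `O(ε²)`, one order
better than Lipschitz kernels do: the lengths of `w - y` and of its projection agree up to `O(ε²)`
relative to `|w - y|`, and the surface measure projects to Lebesgue measure up to a factor
`1 + O(ε²)`. -/
theorem IsGraphAt.abs_integral_inner_tangent_le (hG : IsGraphAt d M C y (4 * ε))
    (hMm : MeasurableSet M) (hC : 0 ≤ C) (hdim : Module.finrank ℝ (tangentSpaceOf M y) = d)
    (hε : 0 < ε) (hCε : C * (4 * ε) ≤ 1 / 2) (hε1 : ε ≤ 1 / 2)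
    (hg : LipschitzOnWith L g (Set.Ici 0)) (h0 : g 0 = 0) (h1 : ∀ t, 1 ≤ t → g t = 0)
    {a : Eucl n} (ha : a ∈ tangentSpaceOf M y) :
    |∫ w, inner ℝ a (radialField g (ε⁻¹ • (w - y))) ∂(surfaceMeasure d M)| ≤
      ε ^ (d + 2) * (unitBallVolume d * (2 ^ (d + 7) * C ^ 2 + 16 * C) * (L * ‖a‖)) := by
  have hL0 : (0 : ℝ) ≤ L := L.2
  have hκ : Continuous (radialField g : Eucl n → Eucl n) := continuous_radialField hg h0
  have hκT : Continuous (radialField g : tangentSpaceOf M y → tangentSpaceOf M y) :=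
    continuous_radialField hg h0
  have hmain := hG.abs_integral_sub_le hMm hC hdim hε hCε hε1
    (H := fun u => inner ℝ a (radialField g u)) (by fun_prop)
    (fun u hu => by simp [radialField_eq_zero h1 hu])
    (h := fun v => inner ℝ (⟨a, ha⟩ : tangentSpaceOf M y) (radialField g v)) (by fun_prop)
    (fun v hv => by simp [radialField_eq_zero h1 hv])
    (ℓ := L * ‖a‖) (e := 64 * L * C ^ 2 * ε ^ 2 * ‖a‖) (by positivity)
    (fun v => (abs_real_inner_le_norm _ _).trans (by
      rw [mul_comm]
      exact mul_le_mul_of_nonneg_right (norm_radialField_le hg h0 h1 v) (norm_nonneg _)))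
    (fun w hw => ?_)
  · have hz : ∫ v, inner ℝ (⟨a, ha⟩ : tangentSpaceOf M y) (radialField g v) = 0 := by
      rw [integral_inner (integrable_of_eq_zero_of_one_le hκT fun v hv => radialField_eq_zero h1 hv),
        integral_radialField_eq_zero, inner_zero_right]
    rw [hz, mul_zero, sub_zero] at hmain
    refine hmain.trans (le_of_eq ?_)
    rw [pow_add ε d 2, pow_add 2 d 7, pow_succ 2 d]
    ring
  · obtain ⟨q1, q2⟩ := hG.norm_sub_toTangent_le hε hw
    set u := ε⁻¹ • (w - y) with hu
    set v : tangentSpaceOf M y := ε⁻¹ • toTangent M y w with hv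
    have hvu : ((v : tangentSpaceOf M y) : Eucl n) = (tangentSpaceOf M y).starProjection u := by
      rw [hv, hu, Submodule.coe_smul, coe_toTangent, map_smul]; rfl
    have hin : inner ℝ a u = inner ℝ a (v : Eucl n) := by
      rw [hvu, ← Submodule.inner_starProjection_left_eq_right,
        Submodule.starProjection_eq_self_iff.2 ha]
    have hpyth : ‖u‖ ^ 2 = ‖v‖ ^ 2 + ‖u - (v : Eucl n)‖ ^ 2 := by
      rw [hvu]
      have := norm_sq_eq_starProjection (tangentSpaceOf M y) u
      rwa [← hvu] at this ⊢
    have hvle : ‖v‖ ≤ ‖u‖ := by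
      refine abs_le_of_sq_le_sq' (by nlinarith [sq_nonneg ‖u - (v : Eucl n)‖]) (norm_nonneg u) |>.2
    have hlen : |‖u‖ - ‖v‖| ≤ 32 * C ^ 2 * ε ^ 2 := by
      rw [abs_of_nonneg (by linarith)]
      rcases (norm_nonneg u).eq_or_lt with h | h
      · have : ‖u‖ - ‖v‖ ≤ 0 := by have := norm_nonneg v; linarith
        exact this.trans (by positivity)
      · have h6 : ‖u - (v : Eucl n)‖ ^ 2 ≤ (4 * C * ε * ‖u‖) ^ 2 := by gcongr
        have h7 : (‖u‖ - ‖v‖) * ‖u‖ ≤ (16 * C ^ 2 * ε ^ 2 * ‖u‖) * ‖u‖ := by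
          nlinarith [norm_nonneg v, mul_nonneg (norm_nonneg v) (sub_nonneg.2 hvle)]
        have h8 := le_of_mul_le_mul_right h7 h
        refine h8.trans ?_
        have : 16 * C ^ 2 * ε ^ 2 * ‖u‖ ≤ 16 * C ^ 2 * ε ^ 2 * 2 := by gcongr
        linarith
    have e1 : inner ℝ a (radialField g u) -
        inner ℝ (⟨a, ha⟩ : tangentSpaceOf M y) (radialField g v) =
        (g ‖u‖ / ‖u‖ - g ‖v‖ / ‖v‖) * inner ℝ a (v : Eucl n) := by
      have e2 : inner ℝ (⟨a, ha⟩ : tangentSpaceOf M y) (radialField g v) =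
          (g ‖v‖ / ‖v‖) * inner ℝ a (v : Eucl n) := by
        rw [radialField, inner_smul_right]; rfl
      rw [e2, radialField, inner_smul_right, hin]
      ring
    change |inner ℝ a (radialField g u) -
        inner ℝ (⟨a, ha⟩ : tangentSpaceOf M y) (radialField g v)| ≤ _
    rw [e1, abs_mul]
    have h9 := abs_div_sub_div_mul_le hg h0 (norm_nonneg u) (norm_nonneg v)
    have h10 : |inner ℝ a (v : Eucl n)| ≤ ‖a‖ * ‖v‖ := abs_real_inner_le_norm _ _
    calc _ ≤ |g ‖u‖ / ‖u‖ - g ‖v‖ / ‖v‖| * (‖a‖ * ‖v‖) := by gcongr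
      _ = |g ‖u‖ / ‖u‖ - g ‖v‖ / ‖v‖| * ‖v‖ * ‖a‖ := by ring
      _ ≤ 2 * L * |‖u‖ - ‖v‖| * ‖a‖ := by gcongr
      _ ≤ 2 * L * (32 * C ^ 2 * ε ^ 2) * ‖a‖ := by gcongr
      _ = _ := by ring

theorem one_le_norm_inv_smul (hε : 0 < ε) {v : Eucl n} (hv : ε ≤ ‖v‖) : 1 ≤ ‖ε⁻¹ • v‖ := by
  rw [norm_smul, norm_inv, Real.norm_eq_abs, abs_of_pos hε, ← div_eq_inv_mul, le_div_iff₀ hε]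
  simpa using hv

theorem abs_integral_le_of_le_on_ball {H : Eucl n → ℝ} {μ : Measure (Eucl n)} {r c K : ℝ}
    (hc : 0 ≤ c) (hK : 0 ≤ K) (hμ : μ (Metric.ball y r) ≤ ENNReal.ofReal K)
    (hH : ∀ w, r ≤ ‖w - y‖ → H w = 0) (hle : ∀ w, ‖w - y‖ < r → |H w| ≤ c) :
    |∫ w, H w ∂μ| ≤ c * K := by
  have e1 : ∫ w, H w ∂μ = ∫ w in Metric.ball y r, H w ∂μ :=
    (setIntegral_eq_integral_of_forall_compl_eq_zero fun w hw => hH w (by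
      rw [Metric.mem_ball, dist_eq_norm, not_lt] at hw; exact hw)).symm
  rw [e1]
  refine (norm_setIntegral_le_of_norm_le_const (f := H) (C := c) (hμ.trans_lt ENNReal.ofReal_lt_top)
    fun w hw => hle w (by rw [← dist_eq_norm]; exact hw)).trans ?_
  gcongr
  exact ENNReal.toReal_le_of_le_ofReal hK hμ

/-- A vector field which is tangent to `M` at `y` and Lipschitz at `y` integrates against `κ` to
`O(ε)`. -/
theorem IsGraphAt.abs_integral_inner_le (hG : IsGraphAt d M C y (4 * ε))
    (hMm : MeasurableSet M) (hC : 0 ≤ C) (hdim : Module.finrank ℝ (tangentSpaceOf M y) = d)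
    (hε : 0 < ε) (hCε : C * (4 * ε) ≤ 1 / 2) (hε1 : ε ≤ 1 / 2)
    (hg : LipschitzOnWith L g (Set.Ici 0)) (h0 : g 0 = 0) (h1 : ∀ t, 1 ≤ t → g t = 0)
    {F : Eucl n → Eucl n} (hF : Continuous F) (hFy : F y ∈ tangentSpaceOf M y) {ℓ : ℝ}
    (hℓ0 : 0 ≤ ℓ) (hℓ : ∀ w, ‖F w - F y‖ ≤ ℓ * ‖w - y‖) :
    |∫ w, inner ℝ (F w) (radialField g (ε⁻¹ • (w - y))) ∂(surfaceMeasure d M)| ≤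
      ε ^ (d + 1) * (unitBallVolume d * (2 ^ (d + 7) * C ^ 2 + 16 * C + 2 ^ (d + 1)) *
        (L * (‖F y‖ + ℓ))) := by
  have hL0 : (0 : ℝ) ≤ L := L.2
  have hκ : Continuous (radialField g : Eucl n → Eucl n) := continuous_radialField hg h0
  have hz : ∀ w, ε ≤ ‖w - y‖ → radialField g (ε⁻¹ • (w - y)) = 0 := fun w hw =>
    radialField_eq_zero h1 (one_le_norm_inv_smul hε hw)
  have e1 : ∫ w, inner ℝ (F w) (radialField g (ε⁻¹ • (w - y))) ∂(surfaceMeasure d M) =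
      ∫ w, inner ℝ (F y) (radialField g (ε⁻¹ • (w - y))) ∂(surfaceMeasure d M) +
      ∫ w, inner ℝ (F w - F y) (radialField g (ε⁻¹ • (w - y))) ∂(surfaceMeasure d M) := by
    rw [← integral_add]
    · refine integral_congr_ae (Eventually.of_forall fun w => ?_)
      simp only
      rw [← inner_add_left, add_sub_cancel]
    · exact hG.integrable_comp hC hdim hε hCε hε1 (by fun_prop) fun w hw => by simp [hz w hw]
    · exact hG.integrable_comp hC hdim hε hCε hε1 (by fun_prop) fun w hw => by simp [hz w hw]
  have h2 := hG.abs_integral_inner_tangent_le hMm hC hdim hε hCε hε1 hg h0 h1 hFy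
  have h3 : |∫ w, inner ℝ (F w - F y) (radialField g (ε⁻¹ • (w - y))) ∂(surfaceMeasure d M)| ≤
      (ℓ * ε * L) * (2 * (2 * ε) ^ d * unitBallVolume d) := by
    refine abs_integral_le_of_le_on_ball (y := y) (r := 2 * ε) (by positivity) (by positivity)
      (hG.surfaceMeasure_ball_le hC hdim hε hCε hε1)
      (fun w hw => by rw [hz w (by linarith), inner_zero_right]) fun w hw => ?_
    rcases le_total ε ‖w - y‖ with h | h
    · rw [hz w h, inner_zero_right, abs_zero]; positivity
    · refine (abs_real_inner_le_norm _ _).trans ?_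
      gcongr
      · exact (hℓ w).trans (by gcongr)
      · exact norm_radialField_le hg h0 h1 _
  rw [e1]
  refine (abs_add_le _ _).trans ((add_le_add h2 h3).trans ?_)
  have h4 : ε ^ (d + 2) ≤ ε ^ (d + 1) := pow_le_pow_of_le_one hε.le (by linarith) (by omega)
  have h5 : ε ^ (d + 2) * (unitBallVolume d * (2 ^ (d + 7) * C ^ 2 + 16 * C) * (L * ‖F y‖)) ≤
      ε ^ (d + 1) * (unitBallVolume d * (2 ^ (d + 7) * C ^ 2 + 16 * C) * (L * (‖F y‖ + ℓ))) := by
    gcongr; linarith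
  have h6 : (ℓ * ε * L) * (2 * (2 * ε) ^ d * unitBallVolume d) ≤
      ε ^ (d + 1) * (unitBallVolume d * 2 ^ (d + 1) * (L * (‖F y‖ + ℓ))) := by
    calc (ℓ * ε * L) * (2 * (2 * ε) ^ d * unitBallVolume d) =
          ε ^ (d + 1) * (unitBallVolume d * 2 ^ (d + 1) * (L * ℓ)) := by
          rw [mul_pow]; ring
      _ ≤ _ := by gcongr; have := norm_nonneg (F y); linarith
  refine (add_le_add h5 h6).trans (le_of_eq ?_)
  ring

end BlowupLimits

section TraceLimit

variable {d n : ℕ} {M : Set (Eucl n)} {C : ℝ} {y : Eucl n}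
variable {ρ g : ℝ → ℝ} {L : NNReal}

theorem abs_inner_apply_radialField_sub_le (hg : LipschitzOnWith L g (Set.Ici 0)) (h0 : g 0 = 0)
    (h1 : ∀ t, 1 ≤ t → g t = 0) (A : Eucl n →L[ℝ] Eucl n) (u v : Eucl n) :
    |inner ℝ (A u) (radialField g u) - inner ℝ (A v) (radialField g v)| ≤
      4 * L * ‖A‖ * ‖u - v‖ := by
  wlog huv : ‖v‖ ≤ ‖u‖ generalizing u v
  · rw [abs_sub_comm, norm_sub_rev]
    exact this v u (le_of_not_ge huv)
  rcases le_total 1 ‖v‖ with hv | hv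
  · rw [radialField_eq_zero h1 hv, radialField_eq_zero h1 (hv.trans huv)]
    simp only [inner_zero_right, sub_zero, abs_zero]
    positivity
  · have e : inner ℝ (A u) (radialField g u) - inner ℝ (A v) (radialField g v) =
        inner ℝ (A (u - v)) (radialField g u) +
          inner ℝ (A v) (radialField g u - radialField g v) := by
      rw [map_sub, inner_sub_left, inner_sub_right]; ring
    rw [e]
    refine (abs_add_le _ _).trans ?_
    have q1 : |inner ℝ (A (u - v)) (radialField g u)| ≤ (‖A‖ * ‖u - v‖) * L := by
      refine (abs_real_inner_le_norm _ _).trans ?_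
      gcongr
      · exact A.le_opNorm _
      · exact norm_radialField_le hg h0 h1 u
    have q2 : |inner ℝ (A v) (radialField g u - radialField g v)| ≤
        (‖A‖ * 1) * (3 * L * ‖u - v‖) := by
      refine (abs_real_inner_le_norm _ _).trans ?_
      gcongr
      · exact (A.le_opNorm _).trans (by gcongr)
      · exact norm_radialField_sub_le hg h0 u v
    linarith

/-- Over a tangent space `T` only the part `π A` of the linear field `A` counts, whose trace on `T` is
`tr(A ∘ π)`. -/
theorem integral_tangent_inner_apply_radialField (hd : 1 ≤ d)
    (hdim : Module.finrank ℝ (tangentSpaceOf M y) = d)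
    (hρ : ∀ t, 0 ≤ t → HasDerivWithinAt ρ (g t) (Set.Ici 0) t)
    (hg : LipschitzOnWith L g (Set.Ici 0)) (h0 : g 0 = 0) (h1 : ∀ t, 1 ≤ t → g t = 0)
    (hρ1 : ∀ t, 1 ≤ t → ρ t = 0) (A : Eucl n →L[ℝ] Eucl n) :
    ∫ v : tangentSpaceOf M y, inner ℝ (A v) (radialField g (v : Eucl n)) =
      -(kernelConst d ρ *
        LinearMap.trace ℝ (Eucl n) (A.comp (tangentProj M y) : Eucl n →ₗ[ℝ] Eucl n)) := by
  set T := tangentSpaceOf M y with hT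
  set B : T →L[ℝ] T := T.orthogonalProjectionOnto.comp (A.comp T.subtypeL) with hB
  have h := integral_inner_radialField hρ hg h0 h1 hρ1 B
  rw [integral_norm_eq_kernelConst hd hdim hρ1] at h
  have e1 : ∀ v : T, inner ℝ (A v) (radialField g (v : Eucl n)) = inner ℝ (B v) (radialField g v) := by
    intro v
    have : radialField g (v : Eucl n) = ((radialField g v : T) : Eucl n) := rfl
    rw [this, ← Submodule.inner_orthogonalProjectionOnto_eq_of_mem_right]
    rfl
  simp_rw [e1]
  rw [h]
  congr 2
  exact LinearMap.trace_comp_comm' ((A.comp T.subtypeL : T →L[ℝ] Eucl n) : T →ₗ[ℝ] Eucl n)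
    (T.orthogonalProjectionOnto : Eucl n →ₗ[ℝ] T)

/-- The scales at which the quantitative blow-up estimates apply are all small ones. -/
theorem eventually_small_scale {r₀ : ℝ} (hr₀ : 0 < r₀) (C : ℝ) :
    ∀ᶠ ε in 𝓝[>] (0 : ℝ), 0 < ε ∧ 4 * ε ≤ r₀ ∧ C * (4 * ε) ≤ 1 / 2 ∧ ε ≤ 1 / 2 := by
  have h1 : Tendsto (fun ε : ℝ => 4 * ε) (𝓝[>] 0) (𝓝 (4 * 0)) :=
    tendsto_nhdsWithin_of_tendsto_nhds ((continuous_const.mul continuous_id).tendsto 0)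
  have h2 : Tendsto (fun ε : ℝ => C * (4 * ε)) (𝓝[>] 0) (𝓝 (C * (4 * 0))) := h1.const_mul C
  have h3 : Tendsto (fun ε : ℝ => ε) (𝓝[>] 0) (𝓝 0) := tendsto_nhdsWithin_of_tendsto_nhds tendsto_id
  rw [mul_zero] at h1 h2
  rw [mul_zero] at h2
  filter_upwards [self_mem_nhdsWithin, h1.eventually_le_const hr₀,
    h2.eventually_le_const (by norm_num : (0 : ℝ) < 1 / 2),
    h3.eventually_le_const (by norm_num : (0 : ℝ) < 1 / 2)] with ε e1 e2 e3 e4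
  exact ⟨e1, e2, e3, e4⟩

variable {r₀ : ℝ}

/-- Blow-up of the surface measure at a point against a Lipschitz kernel, as a limit. -/
theorem tendsto_integral_lipschitz (hG : ∀ s, 0 < s → s ≤ r₀ → IsGraphAt d M C y s) (hr₀ : 0 < r₀)
    (hMm : MeasurableSet M) (hC : 0 ≤ C) (hdim : Module.finrank ℝ (tangentSpaceOf M y) = d)
    {H : Eucl n → ℝ} {ℓ : ℝ}
    (hH : Continuous H) (hL : ∀ u v, |H u - H v| ≤ ℓ * ‖u - v‖) (hH1 : ∀ u, 1 ≤ ‖u‖ → H u = 0)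
    (hb : ∀ u, |H u| ≤ ℓ) :
    Tendsto (fun ε => (ε ^ d)⁻¹ * ∫ w, H (ε⁻¹ • (w - y)) ∂(surfaceMeasure d M)) (𝓝[>] 0)
      (𝓝 (∫ v : tangentSpaceOf M y, H (v : Eucl n))) := by
  rw [tendsto_iff_norm_sub_tendsto_zero]
  have hlim : Tendsto (fun ε : ℝ => ε * (unitBallVolume d * 2 ^ (d + 5) * C * ℓ)) (𝓝[>] 0) (𝓝 0) := by
    have : Continuous fun ε : ℝ => ε * (unitBallVolume d * 2 ^ (d + 5) * C * ℓ) := by fun_prop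
    simpa using tendsto_nhdsWithin_of_tendsto_nhds (this.tendsto 0)
  refine squeeze_zero' (Eventually.of_forall fun _ => norm_nonneg _) ?_ hlim
  filter_upwards [eventually_small_scale hr₀ C] with ε ⟨e1, e2, e3, e4⟩
  have h := (hG (4 * ε) (by positivity) e2).abs_integral_lipschitz_sub_le hMm hC hdim e1 e3 e4 hH
    hL hH1 hb
  have hp : 0 < ε ^ d := by positivity
  have e : (ε ^ d)⁻¹ * ∫ w, H (ε⁻¹ • (w - y)) ∂(surfaceMeasure d M) -
      ∫ v : tangentSpaceOf M y, H (v : Eucl n) = (ε ^ d)⁻¹ *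
      (∫ w, H (ε⁻¹ • (w - y)) ∂(surfaceMeasure d M) -
        ε ^ d * ∫ v : tangentSpaceOf M y, H (v : Eucl n)) := by
    field_simp
  rw [e, norm_mul, norm_inv, Real.norm_eq_abs, abs_of_pos hp, Real.norm_eq_abs,
    inv_mul_le_iff₀ hp]
  refine h.trans (le_of_eq ?_)
  rw [pow_succ]; ring

/-- The blow-up of `F · κ` at a point `y` where `F` is differentiable and tangent to `M` is the
tangential divergence of `F`, up to the factor `-C_ρ`. -/
theorem tendsto_integral_inner_radialField (hd : 1 ≤ d)
    (hG : ∀ s, 0 < s → s ≤ r₀ → IsGraphAt d M C y s) (hr₀ : 0 < r₀)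
    (hMm : MeasurableSet M) (hC : 0 ≤ C) (hdim : Module.finrank ℝ (tangentSpaceOf M y) = d)
    (hρ : ∀ t, 0 ≤ t → HasDerivWithinAt ρ (g t) (Set.Ici 0) t)
    (hg : LipschitzOnWith L g (Set.Ici 0)) (h0 : g 0 = 0) (h1 : ∀ t, 1 ≤ t → g t = 0)
    (hρ1 : ∀ t, 1 ≤ t → ρ t = 0) {F : Eucl n → Eucl n} {F' : Eucl n →L[ℝ] Eucl n}
    (hF : Continuous F) (hF' : HasFDerivAt F F' y) (hFy : F y ∈ tangentSpaceOf M y) :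
    Tendsto (fun ε => (ε ^ (d + 1))⁻¹ *
        ∫ w, inner ℝ (F w) (radialField g (ε⁻¹ • (w - y))) ∂(surfaceMeasure d M)) (𝓝[>] 0)
      (𝓝 (-(kernelConst d ρ *
        LinearMap.trace ℝ (Eucl n) (F'.comp (tangentProj M y) : Eucl n →ₗ[ℝ] Eucl n)))) := by
  set μ := surfaceMeasure d M with hμ
  have hL0 : (0 : ℝ) ≤ L := L.2
  have hκ : Continuous (radialField g : Eucl n → Eucl n) := continuous_radialField hg h0
  have hz : ∀ ε, 0 < ε → ∀ w, ε ≤ ‖w - y‖ → radialField g (ε⁻¹ • (w - y)) = 0 :=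
    fun ε hε w hw => radialField_eq_zero h1 (one_le_norm_inv_smul hε hw)
  have hlim2 := tendsto_integral_lipschitz hG hr₀ hMm hC hdim
    (H := fun u => inner ℝ (F' u) (radialField g u)) (ℓ := 4 * L * ‖F'‖) (by fun_prop)
    (abs_inner_apply_radialField_sub_le hg h0 h1 F')
    (fun u hu => by simp [radialField_eq_zero h1 hu]) (fun u => by
      rcases le_total 1 ‖u‖ with hu | hu
      · rw [radialField_eq_zero h1 hu, inner_zero_right, abs_zero]; positivity
      · refine (abs_real_inner_le_norm _ _).trans ?_
        calc ‖F' u‖ * ‖radialField g u‖ ≤ (‖F'‖ * 1) * L := by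
              gcongr
              · exact (F'.le_opNorm u).trans (by gcongr)
              · exact norm_radialField_le hg h0 h1 u
          _ ≤ _ := by nlinarith [mul_nonneg (norm_nonneg F') hL0])
  rw [integral_tangent_inner_apply_radialField hd hdim hρ hg h0 h1 hρ1] at hlim2
  -- the constant part of `F` contributes `O(ε)`
  have hlim1 : Tendsto (fun ε => (ε ^ (d + 1))⁻¹ *
      ∫ w, inner ℝ (F y) (radialField g (ε⁻¹ • (w - y))) ∂μ) (𝓝[>] 0) (𝓝 0) := by
    rw [tendsto_zero_iff_norm_tendsto_zero]
    set K := unitBallVolume d * (2 ^ (d + 7) * C ^ 2 + 16 * C) * (L * ‖F y‖)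
    have hlim : Tendsto (fun ε : ℝ => ε * K) (𝓝[>] 0) (𝓝 0) := by
      have : Continuous fun ε : ℝ => ε * K := by fun_prop
      simpa using tendsto_nhdsWithin_of_tendsto_nhds (this.tendsto 0)
    refine squeeze_zero' (Eventually.of_forall fun _ => norm_nonneg _) ?_ hlim
    filter_upwards [eventually_small_scale hr₀ C] with ε ⟨e1, e2, e3, e4⟩
    have h := (hG (4 * ε) (by positivity) e2).abs_integral_inner_tangent_le hMm hC hdim e1 e3 e4 hg
      h0 h1 hFy
    have hp : 0 < ε ^ (d + 1) := by positivity
    rw [norm_mul, norm_inv, Real.norm_eq_abs, abs_of_pos hp, Real.norm_eq_abs, inv_mul_le_iff₀ hp]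
    refine h.trans (le_of_eq ?_)
    ring
  -- the remainder of the Taylor expansion of `F` contributes `o(1)`
  have hlim3 : Tendsto (fun ε => (ε ^ (d + 1))⁻¹ *
      ∫ w, inner ℝ (F w - F y - F' (w - y)) (radialField g (ε⁻¹ • (w - y))) ∂μ) (𝓝[>] 0)
      (𝓝 0) := by
    rw [Metric.tendsto_nhds]
    intro e he
    set K := L * (2 * 2 ^ d * unitBallVolume d) with hK
    have hK0 : 0 ≤ K := by positivity
    have hη : 0 < e / (2 * (K + 1)) := by positivity
    obtain ⟨δ, hδ, hR⟩ := Metric.eventually_nhds_iff.1 (hF'.isLittleO.def hη)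
    have hδ' : ∀ᶠ ε in 𝓝[>] (0 : ℝ), ε < δ := by
      have h3 : Tendsto (fun ε : ℝ => ε) (𝓝[>] 0) (𝓝 0) :=
        tendsto_nhdsWithin_of_tendsto_nhds tendsto_id
      exact h3.eventually_lt_const hδ
    filter_upwards [eventually_small_scale hr₀ C, hδ'] with ε ⟨e1, e2, e3, e4⟩ e5
    have hp : 0 < ε ^ (d + 1) := by positivity
    have h3 : |∫ w, inner ℝ (F w - F y - F' (w - y)) (radialField g (ε⁻¹ • (w - y))) ∂μ| ≤
        (e / (2 * (K + 1)) * ε * L) * (2 * (2 * ε) ^ d * unitBallVolume d) := by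
      refine abs_integral_le_of_le_on_ball (y := y) (r := 2 * ε) (by positivity) (by positivity)
        ((hG (4 * ε) (by positivity) e2).surfaceMeasure_ball_le hC hdim e1 e3 e4)
        (fun w hw => by rw [hz ε e1 w (by linarith), inner_zero_right]) fun w hw => ?_
      rcases lt_or_ge ‖w - y‖ ε with h | h
      · refine (abs_real_inner_le_norm _ _).trans ?_
        gcongr
        · refine (hR (by rw [dist_eq_norm]; exact h.trans e5)).trans ?_
          gcongr
        · exact norm_radialField_le hg h0 h1 _
      · rw [hz ε e1 w h, inner_zero_right, abs_zero]; positivity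
    rw [dist_zero_right, norm_mul, norm_inv, Real.norm_eq_abs, abs_of_pos hp, Real.norm_eq_abs,
      inv_mul_lt_iff₀ hp]
    refine h3.trans_lt ?_
    have e6 : (e / (2 * (K + 1)) * ε * L) * (2 * (2 * ε) ^ d * unitBallVolume d) =
        ε ^ (d + 1) * (e / (2 * (K + 1)) * K) := by
      rw [hK, mul_pow]; ring
    rw [e6]
    gcongr
    rw [div_mul_eq_mul_div, div_lt_iff₀ (by positivity)]
    nlinarith
  have hsum := (hlim1.add hlim2).add hlim3
  rw [zero_add, add_zero] at hsum
  refine hsum.congr' ?_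
  filter_upwards [eventually_small_scale hr₀ C] with ε ⟨e1, e2, e3, e4⟩
  have hint : ∀ G : Eucl n → Eucl n, Continuous G →
      Integrable (fun w => inner ℝ (G w) (radialField g (ε⁻¹ • (w - y)))) μ := fun G hGc =>
    (hG (4 * ε) (by positivity) e2).integrable_comp hC hdim e1 e3 e4 (by fun_prop)
      fun w hw => by simp [hz ε e1 w hw]
  have e7 : (ε ^ d)⁻¹ * ∫ w, inner ℝ (F' (ε⁻¹ • (w - y))) (radialField g (ε⁻¹ • (w - y))) ∂μ =
      (ε ^ (d + 1))⁻¹ * ∫ w, inner ℝ (F' (w - y)) (radialField g (ε⁻¹ • (w - y))) ∂μ := by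
    simp_rw [map_smul, inner_smul_left]
    rw [integral_const_mul, pow_succ]
    simp
    ring
  have i1 := hint (fun _ => F y) continuous_const
  have i2 := hint (fun w => F' (w - y)) (by fun_prop)
  have i3 := hint (fun w => F w - F y - F' (w - y)) (by fun_prop)
  have e8 : ∫ w, inner ℝ (F w) (radialField g (ε⁻¹ • (w - y))) ∂μ =
      ∫ w, ((inner ℝ (F y) (radialField g (ε⁻¹ • (w - y))) +
        inner ℝ (F' (w - y)) (radialField g (ε⁻¹ • (w - y)))) +
        inner ℝ (F w - F y - F' (w - y)) (radialField g (ε⁻¹ • (w - y)))) ∂μ := by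
    refine integral_congr_ae (Eventually.of_forall fun w => ?_)
    simp only
    rw [← inner_add_left, ← inner_add_left]
    congr 1
    abel
  rw [e7, ← mul_add, ← mul_add, e8]
  congr 1
  exact ((integral_add (i1.add i2) i3).trans (congrArg (· + _) (integral_add i1 i2))).symm

end TraceLimit

/-! ### The divergence theorem on a submanifold -/

section Divergence

variable {d n : ℕ} {M : Set (Eucl n)} {C : ℝ}
variable {ρ g : ℝ → ℝ} {L : NNReal}

/-- The tangential divergence `tr(DQ ∘ S)` of the vector field `Q` at `y`, for a plane `S`. -/
def planeDiv (Q : Eucl n → Eucl n) (y : Eucl n) (S : Eucl n →L[ℝ] Eucl n) : ℝ :=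
  LinearMap.trace ℝ (Eucl n) ((fderiv ℝ Q y).comp S : Eucl n →ₗ[ℝ] Eucl n)

/-- The divergence theorem for a tangential vector field `Q` and a function `φ` supported near `x`.
The double integral `∫∫ φ(y) Q(w) · κ((w - y)/ε)` over `M × M` is blown up in the two possible
orders: in `w` first it gives the divergence of `Q`, in `y` first the derivative of `φ`. -/
theorem integral_fderiv_eq_neg_integral_planeDiv (hd : 1 ≤ d) (hMm : MeasurableSet M) (hC : 0 ≤ C)
    (hdim : ∀ y ∈ M, Module.finrank ℝ (tangentSpaceOf M y) = d)
    (hρ : ∀ t, 0 ≤ t → HasDerivWithinAt ρ (g t) (Set.Ici 0) t)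
    (hg : LipschitzOnWith L g (Set.Ici 0)) (h0 : g 0 = 0) (h1 : ∀ t, 1 ≤ t → g t = 0)
    (hρ1 : ∀ t, 1 ≤ t → ρ t = 0) (hCρ : 0 < kernelConst d ρ)
    {x : Eucl n} (hx : x ∈ M) {r₀ R : ℝ}
    (hG : ∀ y ∈ M ∩ Metric.ball x r₀, ∀ s, 0 < s → s ≤ r₀ → IsGraphAt d M C y s)
    (hR : 0 < R) (hRr : 4 * R ≤ r₀) (hRC : C * (4 * R) ≤ 1 / 2) (hR1 : R ≤ 1 / 2)
    {Q : Eucl n → Eucl n} (hQ : ContDiff ℝ 1 Q) {K : NNReal} (hQK : LipschitzWith K Q)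
    {B : ℝ} (hQB : ∀ w, ‖Q w‖ ≤ B) (hQT : ∀ y ∈ M ∩ Metric.ball x r₀, Q y ∈ tangentSpaceOf M y)
    {φ : Eucl n → ℝ} (hφ : ContDiff ℝ 1 φ) (hφc : HasCompactSupport φ)
    (hφR : tsupport φ ⊆ Metric.ball x R) :
    ∫ w, fderiv ℝ φ w (Q w) ∂(surfaceMeasure d M) =
      -∫ y, φ y * planeDiv Q y (tangentProj M y) ∂(surfaceMeasure d M) := by
  have hr₀ : 0 < r₀ := by linarith
  set μ := surfaceMeasure d M with hμ
  set μ' := μ.restrict (Metric.ball x (2 * R)) with hμ'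
  have hL0 : (0 : ℝ) ≤ L := L.2
  have hB0 : 0 ≤ B := (norm_nonneg _).trans (hQB x)
  have hκ : Continuous (radialField g : Eucl n → Eucl n) := continuous_radialField hg h0
  have hz : ∀ ε, 0 < ε → ∀ w y : Eucl n, ε ≤ ‖w - y‖ → radialField g (ε⁻¹ • (w - y)) = 0 :=
    fun ε hε w y hw => radialField_eq_zero h1 (one_le_norm_inv_smul hε hw)
  have hfin : IsFiniteMeasure μ' := by
    refine ⟨?_⟩
    rw [hμ', Measure.restrict_apply_univ]
    exact ((hG x ⟨hx, Metric.mem_ball_self hr₀⟩ (4 * R) (by positivity)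
      hRr).surfaceMeasure_ball_le hC (hdim x hx) hR hRC hR1).trans_lt ENNReal.ofReal_lt_top
  obtain ⟨Kφ, hKφ⟩ := ContDiff.lipschitzWith_of_hasCompactSupport hφc hφ one_ne_zero
  obtain ⟨Bφ, hBφ⟩ := hφc.exists_bound_of_continuous hφ.continuous
  have hBφ0 : 0 ≤ Bφ := (norm_nonneg _).trans (hBφ x)
  have hφ0 : ∀ y, y ∉ Metric.ball x R → φ y = 0 := fun y hy =>
    image_eq_zero_of_notMem_tsupport fun h => hy (hφR h)
  have hdφ0 : ∀ y, y ∉ Metric.ball x R → fderiv ℝ φ y = 0 := fun y hy =>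
    image_eq_zero_of_notMem_tsupport fun h => hy (hφR (tsupport_fderiv_subset ℝ h))
  have hsub : Metric.ball x R ⊆ Metric.ball x (2 * R) := Metric.ball_subset_ball (by linarith)
  set f : ℝ → Eucl n → Eucl n → ℝ := fun ε y w =>
    φ y * inner ℝ (Q w) (radialField g (ε⁻¹ • (w - y))) with hf
  have hfc : ∀ ε, Continuous (Function.uncurry (f ε)) := by
    intro ε
    have hφc' := hφ.continuous
    have hQc := hQ.continuous
    simp only [hf, Function.uncurry_def]
    fun_prop
  have hswap : ∀ ε, ∫ y, ∫ w, f ε y w ∂μ' ∂μ' = ∫ w, ∫ y, f ε y w ∂μ' ∂μ' := by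
    intro ε
    refine integral_integral_swap ?_
    refine Integrable.of_bound (hfc ε).aestronglyMeasurable (Bφ * (B * L))
      (Eventually.of_forall fun p => ?_)
    simp only [hf, Function.uncurry_def, norm_mul]
    gcongr
    · exact hBφ _
    · refine (norm_inner_le_norm _ _).trans ?_
      gcongr
      · exact hQB _
      · exact norm_radialField_le hg h0 h1 _
  have hae : ∀ᵐ w ∂μ', w ∈ M ∩ Metric.ball x (2 * R) := by
    filter_upwards [ae_restrict_mem (μ := μ) (s := Metric.ball x (2 * R)) measurableSet_ball,
      ae_restrict_of_ae (s := Metric.ball x (2 * R)) (ae_restrict_mem hMm)] with w hw hwM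
    exact ⟨hwM, hw⟩
  have hball : Metric.ball x (2 * R) ⊆ Metric.ball x r₀ := Metric.ball_subset_ball (by linarith)
  have hRev : ∀ᶠ ε in 𝓝[>] (0 : ℝ), ε < R :=
    (tendsto_nhdsWithin_of_tendsto_nhds tendsto_id).eventually_lt_const hR
  set K₁ := unitBallVolume d * (2 ^ (d + 7) * C ^ 2 + 16 * C + 2 ^ (d + 1)) with hK₁
  have hK₁0 : 0 ≤ K₁ := by positivity
  have hinner1 : ∀ ε, 0 < ε → ε < R → ∀ y, ∫ w, f ε y w ∂μ' =
      φ y * ∫ w, inner ℝ (Q w) (radialField g (ε⁻¹ • (w - y))) ∂μ := by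
    intro ε hε hεR y
    simp only [hf]
    rw [integral_const_mul]
    by_cases hy : y ∈ Metric.ball x R
    · rw [hμ', setIntegral_eq_integral_of_forall_compl_eq_zero]
      intro w hw
      rw [Metric.mem_ball, not_lt] at hw
      rw [Metric.mem_ball] at hy
      have := dist_triangle w y x
      rw [hz ε hε w y (by rw [← dist_eq_norm]; linarith), inner_zero_right]
    · rw [hφ0 y hy, zero_mul, zero_mul]
  have hinner2 : ∀ ε w, ∫ y, f ε y w ∂μ' =
      -∫ y, inner ℝ (φ y • Q w) (radialField g (ε⁻¹ • (y - w))) ∂μ := by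
    intro ε w
    rw [hμ', setIntegral_eq_integral_of_forall_compl_eq_zero, ← integral_neg]
    · refine integral_congr_ae (Eventually.of_forall fun y => ?_)
      simp only [hf]
      rw [inner_smul_left, ← neg_sub w y, smul_neg, radialField_neg, inner_neg_right]
      simp
    · intro y hy
      simp [hf, hφ0 y fun h => hy (hsub h)]
  have hlim1 : Tendsto (fun ε => ∫ y, (ε ^ (d + 1))⁻¹ * ∫ w, f ε y w ∂μ' ∂μ') (𝓝[>] 0)
      (𝓝 (∫ y, φ y * -(kernelConst d ρ * planeDiv Q y (tangentProj M y)) ∂μ')) := by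
    refine tendsto_integral_filter_of_dominated_convergence
      (fun _ => Bφ * (K₁ * (L * (B + K)))) ?_ ?_ (integrable_const _) ?_
    · refine Eventually.of_forall fun ε => AEStronglyMeasurable.const_mul ?_ _
      exact ((hfc ε).stronglyMeasurable.integral_prod_right).aestronglyMeasurable
    · filter_upwards [eventually_small_scale hr₀ C, hRev] with ε ⟨e1, e2, e3, e4⟩ e5
      filter_upwards [hae] with y hy
      have hp : 0 < ε ^ (d + 1) := by positivity
      rw [hinner1 ε e1 e5, norm_mul, norm_mul, norm_inv, Real.norm_of_nonneg hp.le,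
        inv_mul_le_iff₀ hp]
      have h2 := (hG y ⟨hy.1, hball hy.2⟩ (4 * ε) (by positivity) e2).abs_integral_inner_le hMm hC
        (hdim y hy.1) e1 e3 e4 hg h0 h1 hQ.continuous (hQT y ⟨hy.1, hball hy.2⟩) K.2
        (fun w => by simpa [dist_eq_norm] using hQK.dist_le_mul w y)
      calc _ ≤ Bφ * (ε ^ (d + 1) * (K₁ * (L * (‖Q y‖ + K)))) := by
            gcongr
            · exact hBφ y
            · exact h2
        _ ≤ Bφ * (ε ^ (d + 1) * (K₁ * (L * (B + K)))) := by gcongr; exact hQB y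
        _ = _ := by ring
    · filter_upwards [hae] with y hy
      have h2 := tendsto_integral_inner_radialField hd (hG y ⟨hy.1, hball hy.2⟩) hr₀ hMm hC
        (hdim y hy.1) hρ hg h0 h1 hρ1 hQ.continuous
        (hQ.differentiable one_ne_zero y).hasFDerivAt (hQT y ⟨hy.1, hball hy.2⟩)
      refine (h2.const_mul (φ y)).congr' ?_
      filter_upwards [eventually_small_scale hr₀ C, hRev] with ε ⟨e1, _⟩ e5
      rw [hinner1 ε e1 e5]; ring
  have hlim2 : Tendsto (fun ε => ∫ w, (ε ^ (d + 1))⁻¹ * ∫ y, f ε y w ∂μ' ∂μ') (𝓝[>] 0)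
      (𝓝 (∫ w, kernelConst d ρ * fderiv ℝ φ w (Q w) ∂μ')) := by
    refine tendsto_integral_filter_of_dominated_convergence
      (fun _ => K₁ * (L * (Bφ * B + Kφ * B))) ?_ ?_ (integrable_const _) ?_
    · refine Eventually.of_forall fun ε => AEStronglyMeasurable.const_mul ?_ _
      have h3 : Continuous (Function.uncurry fun w y => f ε y w) :=
        (hfc ε).comp continuous_swap
      exact (h3.stronglyMeasurable.integral_prod_right).aestronglyMeasurable
    · filter_upwards [eventually_small_scale hr₀ C] with ε ⟨e1, e2, e3, e4⟩
      filter_upwards [hae] with w hw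
      have hp : 0 < ε ^ (d + 1) := by positivity
      rw [hinner2, norm_mul, norm_inv, Real.norm_of_nonneg hp.le, norm_neg, inv_mul_le_iff₀ hp]
      have h2 := (hG w ⟨hw.1, hball hw.2⟩ (4 * ε) (by positivity) e2).abs_integral_inner_le hMm hC
        (hdim w hw.1) e1 e3 e4 hg h0 h1 (F := fun y => φ y • Q w) (ℓ := Kφ * B)
        (hφ.continuous.smul continuous_const)
        (Submodule.smul_mem _ _ (hQT w ⟨hw.1, hball hw.2⟩)) (by positivity) (fun y => by
          rw [← sub_smul, norm_smul]
          calc ‖φ y - φ w‖ * ‖Q w‖ ≤ (Kφ * ‖y - w‖) * B := by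
                gcongr
                · simpa [dist_eq_norm] using hKφ.dist_le_mul y w
                · exact hQB w
            _ = _ := by ring)
      refine h2.trans ?_
      gcongr
      rw [norm_smul]
      gcongr
      · exact hBφ w
      · exact hQB w
    · filter_upwards [hae] with w hw
      have hwT := hQT w ⟨hw.1, hball hw.2⟩
      have hF' : HasFDerivAt (fun y => φ y • Q w) ((fderiv ℝ φ w).smulRight (Q w)) w :=
        (hφ.differentiable one_ne_zero w).hasFDerivAt.smul_const (Q w)
      have h2 := tendsto_integral_inner_radialField hd (hG w ⟨hw.1, hball hw.2⟩) hr₀ hMm hC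
        (hdim w hw.1) hρ hg h0 h1 hρ1 (F := fun y => φ y • Q w)
        (hφ.continuous.smul continuous_const) hF'
        (Submodule.smul_mem _ _ hwT)
      have htr : LinearMap.trace ℝ (Eucl n) (((fderiv ℝ φ w).smulRight (Q w)).comp
          (tangentProj M w) : Eucl n →ₗ[ℝ] Eucl n) = fderiv ℝ φ w (Q w) := by
        have e1 : (((fderiv ℝ φ w).smulRight (Q w)).comp
            (tangentProj M w) : Eucl n →ₗ[ℝ] Eucl n) =
            LinearMap.smulRight ((fderiv ℝ φ w).comp (tangentProj M w) : Eucl n →ₗ[ℝ] ℝ) (Q w) := rfl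
        have e2 : tangentProj M w (Q w) = Q w := Submodule.starProjection_eq_self_iff.2 hwT
        rw [e1, LinearMap.trace_smulRight]
        simp [e2]
      rw [htr] at h2
      have h3 := h2.neg
      rw [neg_neg] at h3
      refine h3.congr' (Eventually.of_forall fun ε => ?_)
      simp only
      rw [hinner2]; ring
  have heq := tendsto_nhds_unique hlim1 (hlim2.congr fun ε => by
    rw [integral_const_mul, integral_const_mul, hswap ε])
  have e1 : ∫ y, φ y * -(kernelConst d ρ * planeDiv Q y (tangentProj M y)) ∂μ' =
      -kernelConst d ρ * ∫ y, φ y * planeDiv Q y (tangentProj M y) ∂μ := by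
    rw [hμ', setIntegral_eq_integral_of_forall_compl_eq_zero, ← integral_const_mul]
    · refine integral_congr_ae (Eventually.of_forall fun y => ?_)
      simp only; ring
    · intro y hy
      rw [hφ0 y fun h => hy (hsub h), zero_mul]
  have e2 : ∫ w, kernelConst d ρ * fderiv ℝ φ w (Q w) ∂μ' =
      kernelConst d ρ * ∫ w, fderiv ℝ φ w (Q w) ∂μ := by
    rw [hμ', setIntegral_eq_integral_of_forall_compl_eq_zero, integral_const_mul]
    intro y hy
    rw [hdφ0 y fun h => hy (hsub h)]; simp
  rw [e1, e2] at heq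
  have := mul_left_cancel₀ hCρ.ne' (heq.symm.trans (neg_mul_comm _ _))
  rw [this]

end Divergence

/-! ### Varifolds, their masses and disintegrations -/

section SubmanifoldMeasurable

variable {d n : ℕ} {M : Set (Eucl n)}

/-- An embedded submanifold is locally closed. -/
theorem IsC2Submanifold.measurableSet (hM : IsC2Submanifold d M) : MeasurableSet M := by
  have h : IsLocallyClosed M := by
    refine ((isLocallyClosed_tfae M).out 0 3).2 fun y hy => ?_
    obtain ⟨Φ, hxs, h1, _, hMΦ⟩ := hM y hy
    obtain ⟨r, hr, _, hcpt⟩ := exists_isCompact_inter_closedBall h1 hMΦ hxs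
    refine ⟨Metric.ball y r, Metric.mem_ball_self hr, Metric.isOpen_ball, ?_⟩
    refine Metric.isOpen_ball.inter_closure.trans ?_
    refine (closure_minimal ?_ (hcpt y r subset_rfl).isClosed).trans Set.inter_subset_left
    rintro w ⟨hw, hwM⟩
    exact ⟨hwM, Metric.ball_subset_closedBall hw⟩
  obtain ⟨U, Z, hU, hZ, rfl⟩ := h
  exact hU.measurableSet.inter hZ.measurableSet

end SubmanifoldMeasurable

section VarifoldBasics

variable {d n : ℕ} {Ω : Set (Eucl n)}

theorem Varifold.mass_apply (V : Varifold d Ω) {A : Set (Eucl n)} (hA : MeasurableSet A) :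
    V.mass A = V.toMeasure (A ×ˢ Set.univ) := by
  rw [Varifold.mass, Measure.map_apply measurable_fst hA]
  congr 1
  ext p
  simp

theorem Varifold.mass_lt_top (V : Varifold d Ω) {K : Set (Eucl n)} (hKΩ : K ⊆ Ω)
    (hK : IsCompact K) : V.mass K < ⊤ := by
  rw [V.mass_apply hK.measurableSet]
  exact V.lt_top_of_isCompact K hKΩ hK

theorem Varifold.sigmaFinite_mass (V : Varifold d Ω) (hΩ : IsOpen Ω) : SigmaFinite V.mass := by
  obtain ⟨F, hFc, hFΩ, hFU, hFm⟩ := hΩ.exists_iUnion_isClosed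
  refine ⟨⟨⟨fun k => (F k ∩ Metric.closedBall 0 k) ∪ Ωᶜ, fun _ => trivial, fun k => ?_, ?_⟩⟩⟩
  · have h1 : V.mass (F k ∩ Metric.closedBall 0 k) < ⊤ :=
      V.mass_lt_top (Set.inter_subset_left.trans (hFΩ k))
        ((isCompact_closedBall _ _).inter_left (hFc k))
    have h2 : V.mass Ωᶜ = 0 := by
      rw [V.mass_apply hΩ.measurableSet.compl, V.null_compl]
    refine (measure_union_le _ _).trans_lt ?_
    rw [h2, add_zero]
    exact h1
  · refine Set.eq_univ_of_forall fun w => ?_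
    by_cases hw : w ∈ Ω
    · rw [← hFU] at hw
      obtain ⟨k, hk⟩ := Set.mem_iUnion.1 hw
      obtain ⟨m, hm⟩ := exists_nat_ge ‖w‖
      refine Set.mem_iUnion.2 ⟨max k m, Or.inl ⟨hFm (le_max_left _ _) hk, ?_⟩⟩
      rw [mem_closedBall_zero_iff]
      exact hm.trans (by exact_mod_cast le_max_right _ _)
    · exact Set.mem_iUnion.2 ⟨0, Or.inr hw⟩

theorem Varifold.IsDisintegration.toMeasure_eq {V : Varifold d Ω}
    {ν : ProbabilityTheory.Kernel (Eucl n) (Gr d n)} (hν : V.IsDisintegration ν)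
    (hΩ : IsOpen Ω) : V.toMeasure = V.mass.compProd ν := by
  have := V.sigmaFinite_mass hΩ
  have : ProbabilityTheory.IsMarkovKernel ν := ⟨hν.1⟩
  ext A hA
  rw [hν.2 A hA, Measure.compProd_apply hA]
  rfl

theorem norm_le_one_of_gr (S : Gr d n) : ‖S.1‖ ≤ 1 := by
  obtain ⟨T, _, hT⟩ := S.2
  rw [hT]
  exact Submodule.starProjection_norm_le _

/-- A continuous bounded function on `ℝⁿ × G_{d,n}` which vanishes off a compact subset of `Ω` is
integrable for the varifold. -/
theorem Varifold.integrable_of_continuous (V : Varifold d Ω) {K : Set (Eucl n)} (hKΩ : K ⊆ Ω)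
    (hK : IsCompact K) {f : Eucl n × Gr d n → ℝ} (hf : Continuous f) {B : ℝ}
    (hB : ∀ p, |f p| ≤ B) (h0 : ∀ p, p.1 ∉ K → f p = 0) : Integrable f V.toMeasure := by
  rw [← integrableOn_iff_integrable_of_support_subset (s := K ×ˢ (Set.univ : Set (Gr d n)))]
  · exact Measure.integrableOn_of_bounded (V.lt_top_of_isCompact K hKΩ hK).ne
      hf.aestronglyMeasurable (Eventually.of_forall hB)
  · intro p hp
    by_contra h
    exact hp (h0 p fun hpK => h ⟨hpK, trivial⟩)

variable {M : Set (Eucl n)}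

theorem finrank_tangentSpaceOf {y : Eucl n} (h : ∃ S : Gr d n, S.1 = tangentProj M y) :
    Module.finrank ℝ (tangentSpaceOf M y) = d := by
  obtain ⟨S, hS⟩ := h
  obtain ⟨T, hT, hST⟩ := S.2
  have h1 : T.starProjection = (tangentSpaceOf M y).starProjection := hST.symm.trans hS
  have h2 : T = tangentSpaceOf M y := by
    rw [← Submodule.range_starProjection T, ← Submodule.range_starProjection (tangentSpaceOf M y), h1]
  rw [← h2, hT]

theorem Varifold.IsUnitOn.mass_eq {V : Varifold d Ω} (hV : V.IsUnitOn M)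
    (hT : ∀ y ∈ M, ∃ S : Gr d n, S.1 = tangentProj M y) : V.mass = surfaceMeasure d M := by
  ext A hA
  rw [V.mass_apply hA, hV _ (hA.prod MeasurableSet.univ), Measure.restrict_apply hA]
  congr 1
  ext y
  constructor
  · rintro ⟨hy, S, _, hS⟩
    exact ⟨hS.1, hy⟩
  · rintro ⟨hyA, hyM⟩
    obtain ⟨S, hS⟩ := hT y hyM
    exact ⟨hyM, S, hS, hyA, trivial⟩

/-- Integration against `v(M, 1)`: the plane is evaluated at the tangent plane. -/
theorem Varifold.integral_eq_of_dirac {V : Varifold d Ω} (hΩ : IsOpen Ω)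
    {ν : ProbabilityTheory.Kernel (Eucl n) (Gr d n)} (hν : V.IsDisintegration ν)
    (hVM : V.mass = surfaceMeasure d M) (hMm : MeasurableSet M)
    (hνM : ∀ y ∈ M, ∃ S : Gr d n, S.1 = tangentProj M y ∧ ν y = Measure.dirac S)
    {f : Eucl n → (Eucl n →L[ℝ] Eucl n) → ℝ}
    (hf : Integrable (fun p : Eucl n × Gr d n => f p.1 p.2.1) V.toMeasure) :
    ∫ p, f p.1 p.2.1 ∂V.toMeasure = ∫ w, f w (tangentProj M w) ∂(surfaceMeasure d M) := by
  have := V.sigmaFinite_mass hΩ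
  have : ProbabilityTheory.IsMarkovKernel ν := ⟨hν.1⟩
  rw [hν.toMeasure_eq hΩ] at hf ⊢
  rw [Measure.integral_compProd hf, hVM]
  refine integral_congr_ae ?_
  filter_upwards [ae_restrict_mem hMm] with w hw
  obtain ⟨S, hS, hνS⟩ := hνM w hw
  rw [hνS, integral_dirac, hS]

end VarifoldBasics

section PlaneFields

variable {d n : ℕ}

theorem abs_entry_le (S : Eucl n →L[ℝ] Eucl n) (j k : Fin n) : |entry S j k| ≤ ‖S‖ := by
  have h1 : |S (EuclideanSpace.single k 1) j| ≤ ‖S (EuclideanSpace.single k 1)‖ :=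
    PiLp.norm_apply_le (S (EuclideanSpace.single k (1 : ℝ))) j
  refine h1.trans ((S.le_opNorm _).trans ?_)
  simp

theorem entry_sub (S S' : Eucl n →L[ℝ] Eucl n) (j k : Fin n) :
    entry (S - S') j k = entry S j k - entry S' j k := by
  simp [entry]

theorem continuous_entry (j k : Fin n) :
    Continuous fun S : Eucl n →L[ℝ] Eucl n => entry S j k := by
  unfold entry; fun_prop

theorem entry_starProjection_symm (T : Submodule ℝ (Eucl n)) (j k : Fin n) :
    entry T.starProjection j k = entry T.starProjection k j := by
  have h := Submodule.inner_starProjection_left_eq_right T (EuclideanSpace.single k (1 : ℝ))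
    (EuclideanSpace.single j (1 : ℝ))
  simpa [entry, EuclideanSpace.inner_single_left, EuclideanSpace.inner_single_right] using h

theorem apply_eq_sum_entry (S : Eucl n →L[ℝ] Eucl n) (v : Eucl n) (i : Fin n) :
    S v i = ∑ l, entry S i l * v l := by
  have hv : v = ∑ l, v l • EuclideanSpace.single l (1 : ℝ) := by
    ext m
    simp [Pi.single_apply]
  conv_lhs => rw [hv]
  rw [map_sum]
  simp only [map_smul, entry]
  simp [mul_comm]

/-- The vector `S_{jk} S e_i - c_{jk} S c_i`, with `c_i` the `i`-th row of `c`. For `c = c^V(x)` its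
inner product with `∇ρ_ε` is the integrand of `β_{ijk}^{V,ε,⊥}(x)`. -/
def perpField (c : Matrix (Fin n) (Fin n) ℝ) (i j k : Fin n) (S : Eucl n →L[ℝ] Eucl n) : Eucl n :=
  entry S j k • S (EuclideanSpace.single i 1) - c j k • S (WithLp.toLp 2 (c i))

theorem continuous_perpField (c : Matrix (Fin n) (Fin n) ℝ) (i j k : Fin n) :
    Continuous (perpField c i j k) := by
  have := continuous_entry (n := n) j k
  unfold perpField
  fun_prop

theorem norm_toLp_le_of_abs_le {b : Fin n → ℝ} {δ : ℝ} (h : ∀ l, |b l| ≤ δ) :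
    ‖(WithLp.toLp 2 b : Eucl n)‖ ≤ n * δ := by
  have hb : (WithLp.toLp 2 b : Eucl n) = ∑ l, b l • EuclideanSpace.single l (1 : ℝ) := by
    ext m
    simp [Pi.single_apply]
  rw [hb]
  refine (norm_sum_le _ _).trans ?_
  calc ∑ l, ‖b l • (EuclideanSpace.single l (1 : ℝ) : Eucl n)‖ ≤ ∑ _l : Fin n, δ := by
        refine Finset.sum_le_sum fun l _ => ?_
        rw [norm_smul]
        simpa using h l
    _ = n * δ := by simp

theorem norm_perpField_sub_le {c c' : Matrix (Fin n) (Fin n) ℝ} {S S' : Eucl n →L[ℝ] Eucl n}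
    {B δ : ℝ} (hB : 1 ≤ B) (hS : ‖S‖ ≤ B) (hS' : ‖S'‖ ≤ B) (hc : ∀ a b, |c a b| ≤ 1)
    (hc' : ∀ a b, |c' a b| ≤ 1) (hcc : ∀ a b, |c a b - c' a b| ≤ δ) (i j k : Fin n) :
    ‖perpField c i j k S - perpField c' i j k S'‖ ≤ 2 * B * (1 + n) * (‖S - S'‖ + δ) := by
  have hδ : 0 ≤ δ := (abs_nonneg _).trans (hcc i j)
  have hn : (0 : ℝ) ≤ n := Nat.cast_nonneg n
  set e : Eucl n := EuclideanSpace.single i 1 with he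
  have hen : ‖e‖ = 1 := by simp [he]
  set r : Eucl n := WithLp.toLp 2 (c i) with hr
  set r' : Eucl n := WithLp.toLp 2 (c' i) with hr'
  have hrn : ‖r‖ ≤ n := by simpa using norm_toLp_le_of_abs_le (hc i)
  have hrr : ‖r - r'‖ ≤ n * δ := by
    have : r - r' = WithLp.toLp 2 (fun l => c i l - c' i l) := rfl
    rw [this]
    exact norm_toLp_le_of_abs_le (hcc i)
  have e1 : perpField c i j k S - perpField c' i j k S' =
      entry (S - S') j k • S e + entry S' j k • (S - S') e - (c j k - c' j k) • S r -
        c' j k • (S - S') r - c' j k • S' (r - r') := by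
    simp only [perpField, entry_sub, sub_apply, map_sub, sub_smul, smul_sub]
    abel
  rw [e1]
  have q1 : ‖entry (S - S') j k • S e‖ ≤ ‖S - S'‖ * B := by
    rw [norm_smul]
    gcongr
    · exact abs_entry_le _ _ _
    · exact (S.le_opNorm _).trans (by rw [hen, mul_one]; exact hS)
  have q2 : ‖entry S' j k • (S - S') e‖ ≤ B * ‖S - S'‖ := by
    rw [norm_smul]
    gcongr
    · exact (abs_entry_le _ _ _).trans hS'
    · exact ((S - S').le_opNorm _).trans (by rw [hen, mul_one])
  have q3 : ‖(c j k - c' j k) • S r‖ ≤ δ * (B * n) := by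
    rw [norm_smul]
    gcongr
    · exact hcc j k
    · exact (S.le_opNorm _).trans (by gcongr)
  have q4 : ‖c' j k • (S - S') r‖ ≤ 1 * (‖S - S'‖ * n) := by
    rw [norm_smul]
    gcongr
    · exact hc' j k
    · exact ((S - S').le_opNorm _).trans (by gcongr)
  have q5 : ‖c' j k • S' (r - r')‖ ≤ 1 * (B * (n * δ)) := by
    rw [norm_smul]
    gcongr
    · exact hc' j k
    · exact (S'.le_opNorm _).trans (by gcongr)
  refine (norm_sub_le _ _).trans ((add_le_add (norm_sub_le _ _) le_rfl).trans
    ((add_le_add (add_le_add (norm_sub_le _ _) le_rfl) le_rfl).trans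
    ((add_le_add (add_le_add (add_le_add (norm_add_le _ _) le_rfl) le_rfl) le_rfl).trans ?_)))
  have hN : 0 ≤ ‖S - S'‖ := norm_nonneg _
  nlinarith [mul_nonneg hN hn, mul_nonneg hδ (by linarith : 0 ≤ B), mul_nonneg hδ hn,
    mul_nonneg (mul_nonneg hN hn) (by linarith : 0 ≤ B - 1)]

/-- At the base point itself, the field vanishes, since `P² = P`. -/
theorem perpField_eq_zero {T : Submodule ℝ (Eucl n)} {c : Matrix (Fin n) (Fin n) ℝ}
    (hc : ∀ a b, c a b = entry T.starProjection a b) (i j k : Fin n) :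
    perpField c i j k T.starProjection = 0 := by
  have h1 : (WithLp.toLp 2 (c i) : Eucl n) = T.starProjection (EuclideanSpace.single i 1) := by
    ext l
    rw [PiLp.toLp_apply, hc, entry_starProjection_symm]
    rfl
  have h2 : T.starProjection (T.starProjection (EuclideanSpace.single i (1 : ℝ))) =
      T.starProjection (EuclideanSpace.single i 1) :=
    Submodule.starProjection_eq_self_iff.2 (Submodule.starProjection_apply_mem _ _)
  rw [perpField, h1, h2, hc, sub_self]

/-- For a projection `S`, the coordinate expression in the definition of `β^⊥` is the inner product
with `perpField`. -/
theorem inner_perpField (T : Submodule ℝ (Eucl n)) (c : Matrix (Fin n) (Fin n) ℝ) (i j k : Fin n)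
    (v : Eucl n) : inner ℝ (perpField c i j k T.starProjection) v =
      entry T.starProjection j k * T.starProjection v i -
        c j k * ∑ l, c i l * T.starProjection v l := by
  rw [perpField, inner_sub_left, inner_smul_left, inner_smul_left,
    Submodule.inner_starProjection_left_eq_right, Submodule.inner_starProjection_left_eq_right]
  simp [PiLp.inner_apply, mul_comm]

end PlaneFields

/-! ### The approximate orthogonal forms -/

section BetaPerp

variable {d n : ℕ} {Ω : Set (Eucl n)}

/-- The numerator of `β_{ijk}^{V,ε,⊥}(z)` up to a power of `ε`, for an arbitrary matrix `c` in place
of `c^V(z)`. -/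
def perpIntegral (V : Varifold d Ω) (g : ℝ → ℝ) (c : Matrix (Fin n) (Fin n) ℝ) (ε : ℝ) (z : Eucl n)
    (i j k : Fin n) : ℝ :=
  ∫ p, inner ℝ (perpField c i j k p.2.1) (radialField g (ε⁻¹ • (p.1 - z))) ∂V.toMeasure

/-- The mass regularized by the kernel `ξ`, up to a power of `ε`. -/
def massIntegral (μ : Measure (Eucl n)) (ξ : ℝ → ℝ) (ε : ℝ) (z : Eucl n) : ℝ :=
  ∫ w, ξ ‖ε⁻¹ • (w - z)‖ ∂μ

variable {g : ℝ → ℝ} {L : NNReal} {ε : ℝ} {z : Eucl n}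

/-- Expressions of the form `f(S) · κ((w - z)/ε)` with `f` continuous and bounded are integrable. -/
theorem Varifold.integrable_inner_radialField (V : Varifold d Ω)
    (hg : LipschitzOnWith L g (Set.Ici 0)) (h0 : g 0 = 0) (h1 : ∀ t, 1 ≤ t → g t = 0)
    (hε : 0 < ε) (hz : Metric.closedBall z ε ⊆ Ω) {f : Eucl n × Gr d n → Eucl n}
    (hf : Continuous f) {B : ℝ} (hB : ∀ p, ‖f p‖ ≤ B) :
    Integrable (fun p => inner ℝ (f p) (radialField g (ε⁻¹ • (p.1 - z)))) V.toMeasure := by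
  have hκ : Continuous (radialField g : Eucl n → Eucl n) := continuous_radialField hg h0
  refine V.integrable_of_continuous hz (isCompact_closedBall z ε) (B := B * L) (by fun_prop)
    (fun p => ?_) fun p hp => ?_
  · refine (abs_real_inner_le_norm _ _).trans ?_
    have := (norm_nonneg _).trans (hB p)
    gcongr
    · exact hB p
    · exact norm_radialField_le hg h0 h1 _
  · rw [Metric.mem_closedBall, dist_eq_norm, not_le] at hp
    rw [radialField_eq_zero h1 (one_le_norm_inv_smul hε hp.le), inner_zero_right]

theorem Varifold.regVariation_eq (V : Varifold d Ω) {ρ ξ : ℝ → ℝ} (hk : IsKernelPair n ρ ξ)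
    (hε : 0 < ε) (i j k : Fin n) :
    V.regVariation ρ ε i j k z = ((ε ^ n)⁻¹ * ε⁻¹) * ∫ p, entry p.2.1 j k *
      p.2.1 (radialField (profileDeriv ρ) (ε⁻¹ • (p.1 - z))) i ∂V.toMeasure := by
  rw [Varifold.regVariation, ← integral_const_mul]
  refine integral_congr_ae (Eventually.of_forall fun p => ?_)
  simp only
  rw [hk.gradient_radialKernel hε, map_smul, PiLp.smul_apply, smul_eq_mul]
  ring

theorem integral_radialKernel_eq (μ : Measure (Eucl n)) {ξ : ℝ → ℝ} (hε : 0 < ε) :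
    ∫ y, radialKernel ξ ε (z - y) ∂μ = (ε ^ n)⁻¹ * massIntegral μ ξ ε z := by
  rw [massIntegral, ← integral_const_mul]
  refine integral_congr_ae (Eventually.of_forall fun y => ?_)
  simp only [radialKernel]
  rw [norm_smul, norm_inv, Real.norm_of_nonneg hε.le, norm_sub_rev, div_eq_inv_mul]

/-- Since `S² = S`, contracting `S_{jk} (S v)_i` over `i = k` yields `(S v)_j`. -/
theorem sum_entry_mul_apply (S : Gr d n) (v : Eucl n) (l : Fin n) :
    ∑ q, entry S.1 l q * S.1 v q = S.1 v l := by
  rw [← apply_eq_sum_entry]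
  obtain ⟨T, _, hT⟩ := S.2
  rw [hT, Submodule.starProjection_eq_self_iff.2 (Submodule.starProjection_apply_mem _ _)]

/-- `β^{V,ε,⊥}(z)` as a quotient of integrals against kernels of fixed shape. The correction term
factors through the same integral because `∑_q S_{lq} (S v)_q = (S v)_l`. -/
theorem Varifold.betaPerp_eq (V : Varifold d Ω)
    (ν : ProbabilityTheory.Kernel (Eucl n) (Gr d n)) {ρ ξ : ℝ → ℝ} (hk : IsKernelPair n ρ ξ)
    (hε : 0 < ε) (hz : Metric.closedBall z ε ⊆ Ω) (i j k : Fin n) :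
    V.betaPerp ν ρ ξ ε z i j k = -(kernelConst d ξ / kernelConst d ρ) * (ε⁻¹ *
      (perpIntegral V (profileDeriv ρ) (meanPlane (ν z)) ε z i j k /
        massIntegral V.mass ξ ε z)) := by
  obtain ⟨L, hg⟩ := hk.deriv_rho_lipschitz
  set κ : Eucl n × Gr d n → Eucl n :=
    fun p => radialField (profileDeriv ρ) (ε⁻¹ • (p.1 - z)) with hκ
  set D := massIntegral V.mass ξ ε z with hD
  set a := kernelConst d ξ / kernelConst d ρ with ha
  set R : Fin n → Fin n → Fin n → ℝ := fun i j k =>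
    ∫ p, entry p.2.1 j k * p.2.1 (κ p) i ∂V.toMeasure with hR
  have hval : Continuous fun p : Eucl n × Gr d n => p.2.1 :=
    continuous_subtype_val.comp continuous_snd
  have hκc : Continuous κ :=
    (continuous_radialField hg hk.deriv_rho_zero).comp (by fun_prop)
  have hint : ∀ i j k, Integrable (fun p => entry p.2.1 j k * p.2.1 (κ p) i) V.toMeasure := by
    intro i j k
    have hc := continuous_entry (n := n) j k
    refine V.integrable_of_continuous hz (isCompact_closedBall z ε) (B := 1 * (1 * L)) ?_
      (fun p => ?_) fun p hp => ?_
    · have h2 : Continuous fun p : Eucl n × Gr d n => p.2.1 (κ p) := hval.clm_apply hκc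
      exact (hc.comp hval).mul ((EuclideanSpace.proj i).continuous.comp h2)
    · rw [abs_mul]
      gcongr
      · exact (abs_entry_le _ _ _).trans (norm_le_one_of_gr p.2)
      · refine (PiLp.norm_apply_le (p.2.1 (κ p)) i).trans ((p.2.1.le_opNorm _).trans ?_)
        gcongr
        · exact norm_le_one_of_gr p.2
        · exact norm_radialField_le hg hk.deriv_rho_zero hk.profileDeriv_eq_zero _
    · rw [Metric.mem_closedBall, dist_eq_norm, not_le] at hp
      rw [hκ]
      simp only
      rw [radialField_eq_zero hk.profileDeriv_eq_zero (one_le_norm_inv_smul hε hp.le)]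
      simp
  have hβ : ∀ i j k, V.betaEps ρ ξ ε z i j k = -a * (ε⁻¹ * (R i j k / D)) := by
    intro i j k
    rw [Varifold.betaEps, V.regVariation_eq hk hε, integral_radialKernel_eq _ hε]
    have hp : (ε ^ n)⁻¹ ≠ 0 := by positivity
    rw [mul_assoc (ε ^ n)⁻¹, mul_div_mul_left _ _ hp, mul_div_assoc]
  have hRl : ∀ l, ∑ q, R q l q = ∫ p, p.2.1 (κ p) l ∂V.toMeasure := by
    intro l
    simp only [hR]
    rw [← integral_finsetSum _ fun q _ => hint q l q]
    refine integral_congr_ae (Eventually.of_forall fun p => ?_)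
    exact sum_entry_mul_apply p.2 (κ p) l
  have hintl : ∀ l, Integrable (fun p => p.2.1 (κ p) l) V.toMeasure := by
    intro l
    have h := integrable_finsetSum Finset.univ fun q _ => hint q l q
    exact h.congr (Eventually.of_forall fun p => sum_entry_mul_apply p.2 (κ p) l)
  set c := meanPlane (ν z) with hc
  have hN : perpIntegral V (profileDeriv ρ) c ε z i j k =
      R i j k - c j k * ∑ l, c i l * ∑ q, R q l q := by
    have e1 : ∀ p : Eucl n × Gr d n, inner ℝ (perpField c i j k p.2.1) (κ p) =
        entry p.2.1 j k * p.2.1 (κ p) i - c j k * ∑ l, c i l * p.2.1 (κ p) l := by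
      intro p
      obtain ⟨T, _, hT⟩ := p.2.2
      rw [hT]
      exact inner_perpField T c i j k (κ p)
    have e2 : perpIntegral V (profileDeriv ρ) c ε z i j k =
        ∫ p, (entry p.2.1 j k * p.2.1 (κ p) i - c j k * ∑ l, c i l * p.2.1 (κ p) l)
          ∂V.toMeasure := integral_congr_ae (Eventually.of_forall e1)
    rw [e2, integral_sub (hint i j k) ((integrable_finsetSum _ fun l _ =>
      (hintl l).const_mul _).const_mul _), integral_const_mul,
      integral_finsetSum _ fun l _ => (hintl l).const_mul _]
    simp_rw [hRl, integral_const_mul]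
    rfl
  rw [Varifold.betaPerp, hN]
  simp only [hβ, Matrix.mulVec, dotProduct]
  simp_rw [← Finset.mul_sum, ← Finset.sum_div]
  have e3 : ∑ l, c i l * (-a * (ε⁻¹ * ((∑ q, R q l q) / D))) =
      -a * (ε⁻¹ * ((∑ l, c i l * ∑ q, R q l q) / D)) := by
    rw [Finset.sum_div, Finset.mul_sum, Finset.mul_sum]
    exact Finset.sum_congr rfl fun l _ => by ring
  rw [e3, ← hc]
  ring

end BetaPerp

section MeanPlane

variable {d n : ℕ}

theorem integrable_entry (ν : Measure (Gr d n)) [IsProbabilityMeasure ν] (j k : Fin n) :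
    Integrable (fun S : Gr d n => entry S.1 j k) ν := by
  refine Integrable.of_bound
    ((continuous_entry j k).comp continuous_subtype_val).aestronglyMeasurable 1
    (Eventually.of_forall fun S => ?_)
  exact (abs_entry_le _ _ _).trans (norm_le_one_of_gr S)

theorem abs_meanPlane_le (ν : Measure (Gr d n)) [IsProbabilityMeasure ν] (j k : Fin n) :
    |meanPlane ν j k| ≤ 1 := by
  have := norm_integral_le_of_norm_le_const (μ := ν) (f := fun S : Gr d n => entry S.1 j k) (C := 1)
    (Eventually.of_forall fun S => (abs_entry_le _ _ _).trans (norm_le_one_of_gr S))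
  simpa [meanPlane] using this

theorem integrable_norm_sub (ν : Measure (Gr d n)) [IsProbabilityMeasure ν]
    (P : Eucl n →L[ℝ] Eucl n) : Integrable (fun S : Gr d n => ‖P - S.1‖) ν := by
  have hc : Continuous fun S : Gr d n => ‖P - S.1‖ :=
    (continuous_const.sub continuous_subtype_val).norm
  refine Integrable.of_bound hc.aestronglyMeasurable (‖P‖ + 1) (Eventually.of_forall fun S => ?_)
  rw [norm_norm]
  exact (norm_sub_le _ _).trans (by gcongr; exact norm_le_one_of_gr S)

theorem abs_meanPlane_sub_entry_le (ν : Measure (Gr d n)) [IsProbabilityMeasure ν]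
    (P : Eucl n →L[ℝ] Eucl n) (j k : Fin n) :
    |meanPlane ν j k - entry P j k| ≤ ∫ S, ‖P - S.1‖ ∂ν := by
  have e : meanPlane ν j k - entry P j k = ∫ S, (entry S.1 j k - entry P j k) ∂ν := by
    rw [integral_sub (integrable_entry ν j k) (integrable_const _)]
    simp [meanPlane]
  rw [e]
  refine (abs_integral_le_integral_abs).trans
    (integral_mono ((integrable_entry ν j k).sub (integrable_const _)).abs
      (integrable_norm_sub ν P) fun S => ?_)
  simp only
  rw [← entry_sub, norm_sub_rev]
  exact abs_entry_le _ _ _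

theorem meanPlane_dirac (S : Gr d n) (j k : Fin n) :
    meanPlane (Measure.dirac S) j k = entry S.1 j k := by
  simp [meanPlane]

theorem posSemidef_meanPlane (ν : Measure (Gr d n)) [IsProbabilityMeasure ν] :
    (meanPlane ν).PosSemidef := by
  refine Matrix.PosSemidef.of_dotProduct_mulVec_nonneg ?_ fun v => ?_
  · ext j k
    simp only [Matrix.conjTranspose_apply, meanPlane, Matrix.of_apply, star_trivial]
    refine integral_congr_ae (Eventually.of_forall fun S => ?_)
    obtain ⟨T, _, hT⟩ := S.2
    simp only [hT]
    exact entry_starProjection_symm T k j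
  · have e : star v ⬝ᵥ (meanPlane ν).mulVec v =
        ∫ S : Gr d n, inner ℝ (S.1 (WithLp.toLp 2 v)) (WithLp.toLp 2 v : Eucl n) ∂ν := by
      have e1 : ∀ S : Gr d n, inner ℝ (S.1 (WithLp.toLp 2 v)) (WithLp.toLp 2 v : Eucl n) =
          ∑ j, v j * ∑ k, entry S.1 j k * v k := fun S => by
        simp only [PiLp.inner_apply]
        refine Finset.sum_congr rfl fun j _ => ?_
        rw [apply_eq_sum_entry]
        simp
      simp_rw [e1]
      rw [integral_finsetSum _ fun j _ => (integrable_finsetSum _ fun k _ =>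
        (integrable_entry ν j k).mul_const _).const_mul _]
      simp only [dotProduct, Matrix.mulVec, star_trivial]
      refine Finset.sum_congr rfl fun j _ => ?_
      rw [integral_const_mul, integral_finsetSum _ fun k _ => (integrable_entry ν j k).mul_const _]
      congr 1
      refine Finset.sum_congr rfl fun k _ => ?_
      rw [integral_mul_const]
      rfl
    rw [e]
    refine integral_nonneg fun S => ?_
    obtain ⟨T, _, hT⟩ := S.2
    simp only [hT]
    exact Submodule.re_inner_starProjection_nonneg T (WithLp.toLp 2 v)

end MeanPlane

section System

variable {n : ℕ}

/-- For a positive semidefinite `c`, the operator `1 + c` does not shrink vectors. -/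
theorem norm_le_of_one_add_mulVec_eq {c : Matrix (Fin n) (Fin n) ℝ} (hc : c.PosSemidef)
    {u h : Fin n → ℝ} (hu : (1 + c).mulVec u = h) :
    ‖(WithLp.toLp 2 u : Eucl n)‖ ≤ ‖(WithLp.toLp 2 h : Eucl n)‖ := by
  have h1 : 0 ≤ u ⬝ᵥ c.mulVec u := by simpa using hc.dotProduct_mulVec_nonneg u
  have h2 : u ⬝ᵥ h = u ⬝ᵥ u + u ⬝ᵥ c.mulVec u := by
    rw [← hu, Matrix.add_mulVec, Matrix.one_mulVec, dotProduct_add]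
  have h3 : u ⬝ᵥ u = ‖(WithLp.toLp 2 u : Eucl n)‖ ^ 2 := by
    rw [EuclideanSpace.real_norm_sq_eq]
    simp [dotProduct, sq]
  have h4 : u ⬝ᵥ h ≤ ‖(WithLp.toLp 2 u : Eucl n)‖ * ‖(WithLp.toLp 2 h : Eucl n)‖ := by
    have := real_inner_le_norm (WithLp.toLp 2 u : Eucl n) (WithLp.toLp 2 h)
    refine le_trans (le_of_eq ?_) this
    simp [dotProduct, PiLp.inner_apply, mul_comm]
  rcases (norm_nonneg (WithLp.toLp 2 u : Eucl n)).eq_or_lt with h5 | h5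
  · rw [← h5]; exact norm_nonneg _
  · refine le_of_mul_le_mul_left ?_ h5
    nlinarith

theorem abs_apply_le_of_one_add_mulVec_eq {c : Matrix (Fin n) (Fin n) ℝ} (hc : c.PosSemidef)
    {u h : Fin n → ℝ} (hu : (1 + c).mulVec u = h) {δ : ℝ} (hδ : ∀ l, |h l| ≤ δ) (i : Fin n) :
    |u i| ≤ n * δ :=
  (PiLp.norm_apply_le (WithLp.toLp 2 u : Eucl n) i).trans
    ((norm_le_of_one_add_mulVec_eq hc hu).trans (norm_toLp_le_of_abs_le hδ))

theorem abs_sum_le_of_abs_le {b : Fin n → ℝ} {δ : ℝ} (h : ∀ l, |b l| ≤ δ) :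
    |∑ l, b l| ≤ n * δ := by
  refine (Finset.abs_sum_le_sum_abs _ _).trans ((Finset.sum_le_sum fun l _ => h l).trans ?_)
  simp

/-- Lipschitz dependence of the solution of the linear system on its data. -/
theorem abs_systemSolution_sub_le {c c' : Matrix (Fin n) (Fin n) ℝ} (hc : c.PosSemidef)
    (hc' : c'.PosSemidef) (hc1 : ∀ a b, |c a b| ≤ 1) {b b' : Fin n → Fin n → Fin n → ℝ}
    {τ B δ : ℝ} (hb : ∀ i j k, |b i j k - b' i j k| ≤ τ) (hB : ∀ i j k, |b' i j k| ≤ B)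
    (hcc : ∀ a b, |c a b - c' a b| ≤ δ) (i j k : Fin n) :
    |systemSolution c b i j k - systemSolution c' b' i j k| ≤
      (1 + n ^ 2) * τ + (n ^ 4 + n ^ 2) * (B * δ) := by
  have hδ : 0 ≤ δ := (abs_nonneg _).trans (hcc i j)
  have hB0 : 0 ≤ B := (abs_nonneg _).trans (hB i j k)
  have hsol : ∀ {c : Matrix (Fin n) (Fin n) ℝ}, c.PosSemidef → ∀ h : Fin n → ℝ,
      (1 + c).mulVec ((1 + c)⁻¹.mulVec h) = h := by
    intro c hc h
    have hdet : IsUnit (1 + c).det :=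
      (Matrix.isUnit_iff_isUnit_det _).1 (Matrix.PosDef.one.add_posSemidef hc).isUnit
    rw [Matrix.mulVec_mulVec, Matrix.mul_nonsing_inv _ hdet, Matrix.one_mulVec]
  set h : Fin n → ℝ := fun l => ∑ q, b q l q with hh
  set h' : Fin n → ℝ := fun l => ∑ q, b' q l q with hh'
  set u := (1 + c)⁻¹.mulVec h with hu
  set u' := (1 + c')⁻¹.mulVec h' with hu'
  have e1 : (1 + c).mulVec u = h := hsol hc h
  have e2 : (1 + c').mulVec u' = h' := hsol hc' h'
  have q1 : ∀ l, |u' l| ≤ n * (n * B) := fun l =>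
    abs_apply_le_of_one_add_mulVec_eq hc' e2 (fun m => abs_sum_le_of_abs_le fun q => hB q m q) l
  have e3 : (1 + c).mulVec (u - u') = h - h' - (c - c').mulVec u' := by
    rw [Matrix.mulVec_sub, e1, Matrix.sub_mulVec, ← e2, Matrix.add_mulVec, Matrix.add_mulVec]
    abel
  have q2 : ∀ l, |(h - h' - (c - c').mulVec u') l| ≤ n * τ + n * (δ * (n * (n * B))) := by
    intro l
    refine (abs_sub _ _).trans (add_le_add ?_ ?_)
    · have : (h - h') l = ∑ q, (b q l q - b' q l q) := by simp [hh, hh']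
      rw [this]
      exact abs_sum_le_of_abs_le fun q => hb q l q
    · refine abs_sum_le_of_abs_le fun m => ?_
      rw [abs_mul]
      gcongr
      · exact hcc l m
      · exact q1 m
  have q3 := abs_apply_le_of_one_add_mulVec_eq hc e3 q2 i
  have e4 : systemSolution c b i j k - systemSolution c' b' i j k =
      (b i j k - b' i j k) - c j k * (u - u') i - (c j k - c' j k) * u' i := by
    simp only [systemSolution, ← hh, ← hh', ← hu, ← hu', Pi.sub_apply]
    ring
  rw [e4]
  have q4 : |c j k * (u - u') i| ≤ 1 * (n * (n * τ + n * (δ * (n * (n * B))))) := by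
    rw [abs_mul]
    gcongr
    exact hc1 j k
  have q5 : |(c j k - c' j k) * u' i| ≤ δ * (n * (n * B)) := by
    rw [abs_mul]
    gcongr
    · exact hcc j k
    · exact q1 i
  refine (abs_sub _ _).trans ((add_le_add (abs_sub _ _) le_rfl).trans ?_)
  refine (add_le_add (add_le_add (hb i j k) q4) q5).trans (le_of_eq ?_)
  ring

end System

/-! ### Comparison of two measures on a small ball -/

section Comparison

variable {d n : ℕ} {Ω : Set (Eucl n)} {x z : Eucl n} {ε a m : ℝ} {μ μ' : Measure (Eucl n)}

/-- The bounded Lipschitz distance controls the integrals of test functions with both bound and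
Lipschitz constant `K`. -/
theorem abs_integral_sub_le_of_bLipDist_le {U T : Set (Eucl n)} (ha : 0 ≤ a)
    (h : bLipDist Ω U μ μ' ≤ ENNReal.ofReal a) {φ : Eucl n → ℝ} {K : ℝ}
    (hL : ∀ u v, |φ u - φ v| ≤ K * ‖u - v‖) (hb : ∀ u, |φ u| ≤ K) (hT : IsClosed T)
    (hTU : T ⊆ U) (h0 : ∀ w, w ∉ T → φ w = 0) :
    |∫ w, φ w ∂μ - ∫ w, φ w ∂μ'| ≤ K * a := by
  have hK : 0 ≤ K := (abs_nonneg _).trans (hb 0)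
  rcases hK.eq_or_lt with rfl | hK
  · have : φ = 0 := funext fun u => abs_nonpos_iff.1 (hb u)
    simp [this]
  have hmem : (fun w => K⁻¹ * φ w) ∈ {φ : Eucl n → ℝ | LipschitzOnWith 1 φ Ω ∧
      (∀ y ∈ Ω, |φ y| ≤ 1) ∧ closure {y | y ∈ Ω ∧ φ y ≠ 0} ∩ Ω ⊆ U} := by
    refine ⟨LipschitzOnWith.of_dist_le_mul fun u _ v _ => ?_, fun y _ => ?_, ?_⟩
    · rw [Real.dist_eq, ← mul_sub, abs_mul, abs_inv, abs_of_pos hK, NNReal.coe_one, one_mul,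
        inv_mul_le_iff₀ hK, dist_eq_norm]
      exact hL u v
    · rw [abs_mul, abs_inv, abs_of_pos hK, inv_mul_le_iff₀ hK, mul_one]
      exact hb y
    · refine Set.inter_subset_left.trans ((closure_minimal ?_ hT).trans hTU)
      rintro y ⟨_, hy⟩
      by_contra hyT
      exact hy (by simp [h0 y hyT])
  have h1 := (le_iSup₂ (f := fun (φ : Eucl n → ℝ) (_ : φ ∈ {φ : Eucl n → ℝ |
    LipschitzOnWith 1 φ Ω ∧ (∀ y ∈ Ω, |φ y| ≤ 1) ∧ closure {y | y ∈ Ω ∧ φ y ≠ 0} ∩ Ω ⊆ U}) =>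
    ENNReal.ofReal |∫ y, φ y ∂μ - ∫ y, φ y ∂μ'|) _ hmem).trans h
  rw [ENNReal.ofReal_le_ofReal_iff ha, integral_const_mul, integral_const_mul, ← mul_sub, abs_mul,
    abs_inv, abs_of_pos hK, inv_mul_le_iff₀ hK] at h1
  exact h1

/-- Closeness of the masses on the ball of radius `4 ε` transfers an upper density bound. The test
function is the cut-off of height and slope of order `ε` and `1`, so that an error `a ≤ ε` is
harmless. -/
theorem measure_ball_le_of_bLipDist_le (hε : 0 < ε) (hε1 : ε ≤ 1) (ha : 0 ≤ a) (haε : a ≤ ε)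
    (hm : 0 ≤ m) (hμ : μ (Metric.ball x (4 * ε)) ≤ ENNReal.ofReal (m * ε ^ d))
    (hμ' : μ' (Metric.closedBall x (4 * ε)) < ⊤)
    (h : bLipDist Ω (Metric.ball x (4 * ε)) μ μ' ≤ ENNReal.ofReal (a * ε ^ d)) :
    μ' (Metric.ball x (2 * ε)) ≤ ENNReal.ofReal ((m + 1) * ε ^ d) := by
  have hp : 0 < ε ^ d := by positivity
  set φ : Eucl n → ℝ := fun w => max 0 (min ε (3 * ε - ‖w - x‖)) with hφ
  have hφc : Continuous φ := by fun_prop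
  have hφ0 : ∀ w, 0 ≤ φ w := fun w => le_max_left _ _
  have hφε : ∀ w, φ w ≤ ε := fun w => max_le hε.le (min_le_left _ _)
  have hφz : ∀ w, 3 * ε ≤ ‖w - x‖ → φ w = 0 := fun w hw =>
    max_eq_left ((min_le_right _ _).trans (by linarith))
  have hφ2 : ∀ w, ‖w - x‖ ≤ 2 * ε → φ w = ε := fun w hw => by
    simp only [hφ]
    rw [min_eq_left (by linarith), max_eq_right hε.le]
  have hL : ∀ u v, |φ u - φ v| ≤ 1 * ‖u - v‖ := by
    intro u v
    refine (abs_max_sub_max_le_max _ _ _ _).trans (max_le (by simp) ?_)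
    refine (abs_min_sub_min_le_max _ _ _ _).trans (max_le (by simp) ?_)
    have e : (3 * ε - ‖u - x‖) - (3 * ε - ‖v - x‖) = ‖v - x‖ - ‖u - x‖ := by ring
    rw [e, one_mul]
    refine (abs_norm_sub_norm_le _ _).trans (le_of_eq ?_)
    rw [sub_sub_sub_cancel_right, norm_sub_rev]
  have h1 := abs_integral_sub_le_of_bLipDist_le (by positivity) h hL
    (fun u => by rw [abs_of_nonneg (hφ0 u)]; exact (hφε u).trans hε1)
    (Metric.isClosed_closedBall (x := x) (ε := 3 * ε))
    (Metric.closedBall_subset_ball (by linarith)) fun w hw => hφz w (by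
      rw [Metric.mem_closedBall, not_le, dist_eq_norm] at hw; exact hw.le)
  have h2 : |∫ w, φ w ∂μ| ≤ ε * (m * ε ^ d) :=
    abs_integral_le_of_le_on_ball hε.le (by positivity) hμ (fun w hw => hφz w (by linarith))
      fun w _ => by rw [abs_of_nonneg (hφ0 w)]; exact hφε w
  have hsub : Metric.ball x (2 * ε) ⊆ Metric.closedBall x (4 * ε) :=
    (Metric.ball_subset_ball (by linarith)).trans Metric.ball_subset_closedBall
  have hint : Integrable φ μ' := by
    rw [← integrableOn_iff_integrable_of_support_subset (s := Metric.closedBall x (4 * ε))]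
    · exact Measure.integrableOn_of_bounded (M := ε) hμ'.ne hφc.aestronglyMeasurable
        (Eventually.of_forall fun w => by rw [Real.norm_of_nonneg (hφ0 w)]; exact hφε w)
    · intro w hw
      by_contra hn
      rw [Metric.mem_closedBall, not_le, dist_eq_norm] at hn
      exact hw (hφz w (by linarith))
  have h3 : ε * μ'.real (Metric.ball x (2 * ε)) ≤ ∫ w, φ w ∂μ' := by
    refine le_trans (le_of_eq ?_) (setIntegral_le_integral hint (Eventually.of_forall hφ0)
      (s := Metric.ball x (2 * ε)))
    rw [setIntegral_congr_fun measurableSet_ball (g := fun _ => ε) fun w hw => hφ2 w (by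
      rw [Metric.mem_ball, dist_eq_norm] at hw; exact hw.le)]
    simp [mul_comm]
  have h4 : ε * μ'.real (Metric.ball x (2 * ε)) ≤ ε * ((m + 1) * ε ^ d) := by
    have := (abs_le.1 h1).1
    have h5 := (abs_le.1 h2).2
    have : a * ε ^ d ≤ ε * ε ^ d := by gcongr
    linarith
  exact (ENNReal.le_ofReal_iff_toReal_le ((measure_mono hsub).trans_lt hμ').ne (by positivity)).2
    (le_of_mul_le_mul_left h4 hε)

theorem norm_inv_smul_sub_inv_smul (hε : 0 < ε) (w x z : Eucl n) :
    ‖ε⁻¹ • (w - z) - ε⁻¹ • (w - x)‖ = ε⁻¹ * ‖x - z‖ := by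
  rw [← smul_sub, sub_sub_sub_cancel_left, norm_smul, norm_inv, Real.norm_of_nonneg hε.le]

/-- The difference of two integrals with respect to one measure, the integrands being close on a
ball and vanishing outside of it. -/
theorem abs_integral_sub_integral_le_of_le_on_ball {H H' : Eucl n → ℝ} {r c K : ℝ} (hc : 0 ≤ c)
    (hK : 0 ≤ K) (hμ : μ (Metric.ball x r) ≤ ENNReal.ofReal K) (hi : Integrable H μ)
    (hi' : Integrable H' μ) (hH : ∀ w, r ≤ ‖w - x‖ → H w = 0)
    (hH' : ∀ w, r ≤ ‖w - x‖ → H' w = 0) (hle : ∀ w, ‖w - x‖ < r → |H w - H' w| ≤ c) :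
    |∫ w, H w ∂μ - ∫ w, H' w ∂μ| ≤ c * K := by
  rw [← integral_sub hi hi']
  exact abs_integral_le_of_le_on_ball hc hK hμ (fun w hw => by rw [hH w hw, hH' w hw, sub_zero]) hle

theorem eps_le_norm_sub {w : Eucl n} (hzx : ‖x - z‖ ≤ ε) (hw : 2 * ε ≤ ‖w - x‖) :
    ε ≤ ‖w - z‖ := by
  have := norm_sub_le_norm_sub_add_norm_sub w z x
  rw [norm_sub_rev z x] at this
  linarith

theorem abs_norm_le_of_lipschitzOnWith {ξ : ℝ → ℝ} {Lξ : NNReal}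
    (hξ : LipschitzOnWith Lξ ξ (Set.Ici 0)) (hξ1 : ∀ t, 1 ≤ t → ξ t = 0) (u : Eucl n) :
    |ξ ‖u‖| ≤ Lξ := by
  rcases le_total 1 ‖u‖ with hu | hu
  · rw [hξ1 _ hu, abs_zero]; exact Lξ.2
  · have h := hξ.dist_le_mul ‖u‖ (norm_nonneg u) 1 (Set.mem_Ici.2 zero_le_one)
    rw [hξ1 1 le_rfl, Real.dist_eq, Real.dist_eq, sub_zero] at h
    refine h.trans (mul_le_of_le_one_right Lξ.2 ?_)
    rw [abs_sub_comm, abs_of_nonneg (by linarith)]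
    linarith [norm_nonneg u]

/-- Stability of the regularized mass under a change of the measure and of the centre. -/
theorem abs_massIntegral_sub_le {ξ : ℝ → ℝ} {Lξ : NNReal} (hξ : LipschitzOnWith Lξ ξ (Set.Ici 0))
    (hξ1 : ∀ t, 1 ≤ t → ξ t = 0) (hε : 0 < ε) (hε1 : ε ≤ 1) (hzx : ‖x - z‖ ≤ ε) (ha : 0 ≤ a)
    (hm : 0 ≤ m) (hμ' : μ' (Metric.ball x (2 * ε)) ≤ ENNReal.ofReal (m * ε ^ d))
    (h : bLipDist Ω (Metric.ball x (4 * ε)) μ μ' ≤ ENNReal.ofReal (a * ε ^ d)) :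
    |massIntegral μ' ξ ε z - massIntegral μ ξ ε x| ≤ Lξ * (a + m * ‖x - z‖) * (ε ^ d * ε⁻¹) := by
  have hlip := lipschitzWith_comp_norm (E := Eucl n) hξ
  have hfin : μ' (Metric.ball x (2 * ε)) < ⊤ := hμ'.trans_lt ENNReal.ofReal_lt_top
  have hlip' : ∀ u v : Eucl n, |ξ ‖u‖ - ξ ‖v‖| ≤ Lξ * ‖u - v‖ := fun u v => by
    simpa [Real.dist_eq, dist_eq_norm] using hlip.dist_le_mul u v
  have hb : ∀ u : Eucl n, |ξ ‖u‖| ≤ Lξ := fun u =>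
    abs_norm_le_of_lipschitzOnWith hξ hξ1 u
  have hc : ∀ y : Eucl n, Continuous fun w : Eucl n => ξ ‖ε⁻¹ • (w - y)‖ := fun y =>
    hlip.continuous.comp (by fun_prop)
  have hz0 : ∀ w, 2 * ε ≤ ‖w - x‖ → ξ ‖ε⁻¹ • (w - z)‖ = 0 := fun w hw =>
    hξ1 _ (one_le_norm_inv_smul hε (eps_le_norm_sub hzx hw))
  have hx0 : ∀ w, ε ≤ ‖w - x‖ → ξ ‖ε⁻¹ • (w - x)‖ = 0 := fun w hw =>
    hξ1 _ (one_le_norm_inv_smul hε hw)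
  have hint : ∀ y, (∀ w, 2 * ε ≤ ‖w - x‖ → ξ ‖ε⁻¹ • (w - y)‖ = 0) →
      Integrable (fun w : Eucl n => ξ ‖ε⁻¹ • (w - y)‖) μ' := by
    intro y hy
    rw [← integrableOn_iff_integrable_of_support_subset (s := Metric.ball x (2 * ε))]
    · exact Measure.integrableOn_of_bounded (M := Lξ) hfin.ne (hc y).aestronglyMeasurable
        (Eventually.of_forall fun w => hb _)
    · intro w hw
      by_contra hn
      rw [Metric.mem_ball, not_lt, dist_eq_norm] at hn
      exact hw (hy w hn)
  have h1 : |massIntegral μ' ξ ε z - massIntegral μ' ξ ε x| ≤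
      (Lξ * (ε⁻¹ * ‖x - z‖)) * (m * ε ^ d) := by
    refine abs_integral_sub_integral_le_of_le_on_ball (by positivity) (by positivity) hμ'
      (hint z hz0) (hint x fun w hw => hx0 w (by linarith)) hz0 (fun w hw => hx0 w (by linarith))
      fun w _ => ?_
    rw [← norm_inv_smul_sub_inv_smul hε w x z]
    exact hlip' _ _
  have h2 : |massIntegral μ ξ ε x - massIntegral μ' ξ ε x| ≤ (Lξ * ε⁻¹) * (a * ε ^ d) := by
    refine abs_integral_sub_le_of_bLipDist_le (by positivity) h (fun u v => ?_) (fun u => ?_)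
      (Metric.isClosed_closedBall (x := x) (ε := ε)) (Metric.closedBall_subset_ball (by linarith))
      fun w hw => hx0 w (by
        rw [Metric.mem_closedBall, not_le, dist_eq_norm] at hw; exact hw.le)
    · refine (hlip' _ _).trans (le_of_eq ?_)
      rw [← smul_sub, sub_sub_sub_cancel_right, norm_smul, norm_inv, Real.norm_of_nonneg hε.le,
        mul_assoc]
    · exact (hb _).trans (le_mul_of_one_le_right Lξ.2 ((one_le_inv₀ hε).2 hε1))
  rw [abs_sub_comm] at h2
  refine (abs_sub_le _ (massIntegral μ' ξ ε x) _).trans ((add_le_add h1 h2).trans (le_of_eq ?_))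
  ring

variable {g : ℝ → ℝ} {L : NNReal} {F : Eucl n → Eucl n} {ℓ : ℝ}

/-- A Lipschitz field vanishing at `x` compensates the slope `1 / ε` of the rescaled kernel. -/
theorem abs_inner_radialField_sub_le (hg : LipschitzOnWith L g (Set.Ici 0)) (h0 : g 0 = 0)
    (h1 : ∀ t, 1 ≤ t → g t = 0) (hε : 0 < ε) (hℓ0 : 0 ≤ ℓ) (hF : ∀ u v, ‖F u - F v‖ ≤ ℓ * ‖u - v‖)
    (hFx : F x = 0) (u v : Eucl n) :
    |inner ℝ (F u) (radialField g (ε⁻¹ • (u - x))) -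
      inner ℝ (F v) (radialField g (ε⁻¹ • (v - x)))| ≤ 4 * ℓ * L * ‖u - v‖ := by
  have hL0 : (0 : ℝ) ≤ L := L.2
  wlog huv : ‖v - x‖ ≤ ‖u - x‖ generalizing u v
  · rw [abs_sub_comm, norm_sub_rev]
    exact this v u (le_of_not_ge huv)
  rcases le_total ε ‖v - x‖ with hv | hv
  · rw [radialField_eq_zero h1 (one_le_norm_inv_smul hε hv),
      radialField_eq_zero h1 (one_le_norm_inv_smul hε (hv.trans huv))]
    simp only [inner_zero_right, sub_zero, abs_zero]
    positivity
  · have e : inner ℝ (F u) (radialField g (ε⁻¹ • (u - x))) -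
        inner ℝ (F v) (radialField g (ε⁻¹ • (v - x))) =
        inner ℝ (F u - F v) (radialField g (ε⁻¹ • (u - x))) +
          inner ℝ (F v) (radialField g (ε⁻¹ • (u - x)) - radialField g (ε⁻¹ • (v - x))) := by
      rw [inner_sub_left, inner_sub_right]; ring
    rw [e]
    refine (abs_add_le _ _).trans ?_
    have q1 : |inner ℝ (F u - F v) (radialField g (ε⁻¹ • (u - x)))| ≤ (ℓ * ‖u - v‖) * L := by
      refine (abs_real_inner_le_norm _ _).trans ?_
      gcongr
      · exact hF u v
      · exact norm_radialField_le hg h0 h1 _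
    have q2 : |inner ℝ (F v) (radialField g (ε⁻¹ • (u - x)) - radialField g (ε⁻¹ • (v - x)))| ≤
        (ℓ * ε) * (3 * L * (ε⁻¹ * ‖u - v‖)) := by
      refine (abs_real_inner_le_norm _ _).trans ?_
      gcongr
      · have := hF v x
        rw [hFx, sub_zero] at this
        exact this.trans (by gcongr)
      · refine (norm_radialField_sub_le hg h0 _ _).trans (le_of_eq ?_)
        rw [← smul_sub, sub_sub_sub_cancel_right, norm_smul, norm_inv, Real.norm_of_nonneg hε.le]
    have e2 : (ℓ * ε) * (3 * L * (ε⁻¹ * ‖u - v‖)) = 3 * ℓ * L * ‖u - v‖ := by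
      field_simp
    linarith

/-- Stability of `∫ F · κ` under a change of the measure and of the centre, for a Lipschitz field
`F` vanishing at the centre. -/
theorem abs_integral_inner_radialField_sub_le (hg : LipschitzOnWith L g (Set.Ici 0))
    (h0 : g 0 = 0) (h1 : ∀ t, 1 ≤ t → g t = 0) (hε : 0 < ε) (hε1 : ε ≤ 1) (hzx : ‖x - z‖ ≤ ε)
    (ha : 0 ≤ a) (hm : 0 ≤ m)
    (hμ' : μ' (Metric.ball x (2 * ε)) ≤ ENNReal.ofReal (m * ε ^ d))
    (h : bLipDist Ω (Metric.ball x (4 * ε)) μ μ' ≤ ENNReal.ofReal (a * ε ^ d))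
    (hℓ0 : 0 ≤ ℓ) (hF : ∀ u v, ‖F u - F v‖ ≤ ℓ * ‖u - v‖) (hFx : F x = 0) (hFc : Continuous F) :
    |∫ w, inner ℝ (F w) (radialField g (ε⁻¹ • (w - z))) ∂μ' -
      ∫ w, inner ℝ (F w) (radialField g (ε⁻¹ • (w - x))) ∂μ| ≤
      ℓ * L * (4 * a + 6 * m * ‖x - z‖) * ε ^ d := by
  have hL0 : (0 : ℝ) ≤ L := L.2
  have hκ : Continuous (radialField g : Eucl n → Eucl n) := continuous_radialField hg h0
  have hfin : μ' (Metric.ball x (2 * ε)) < ⊤ := hμ'.trans_lt ENNReal.ofReal_lt_top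
  have hFn : ∀ w, ‖F w‖ ≤ ℓ * ‖w - x‖ := fun w => by
    have := hF w x
    rwa [hFx, sub_zero] at this
  have hz0 : ∀ w, 2 * ε ≤ ‖w - x‖ → inner ℝ (F w) (radialField g (ε⁻¹ • (w - z))) = 0 :=
    fun w hw => by
      rw [radialField_eq_zero h1 (one_le_norm_inv_smul hε (eps_le_norm_sub hzx hw)),
        inner_zero_right]
  have hx0 : ∀ w, ε ≤ ‖w - x‖ → inner ℝ (F w) (radialField g (ε⁻¹ • (w - x))) = 0 :=
    fun w hw => by rw [radialField_eq_zero h1 (one_le_norm_inv_smul hε hw), inner_zero_right]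
  have hint : ∀ y, (∀ w, 2 * ε ≤ ‖w - x‖ → inner ℝ (F w) (radialField g (ε⁻¹ • (w - y))) = 0) →
      Integrable (fun w : Eucl n => inner ℝ (F w) (radialField g (ε⁻¹ • (w - y)))) μ' := by
    intro y hy
    rw [← integrableOn_iff_integrable_of_support_subset (s := Metric.ball x (2 * ε))]
    · refine Measure.integrableOn_of_bounded (M := ℓ * (2 * ε) * L) hfin.ne
        (Continuous.aestronglyMeasurable (by fun_prop)) ?_
      filter_upwards [ae_restrict_mem measurableSet_ball] with w hw
      rw [Metric.mem_ball, dist_eq_norm] at hw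
      refine (abs_real_inner_le_norm _ _).trans ?_
      gcongr
      · exact (hFn w).trans (by gcongr)
      · exact norm_radialField_le hg h0 h1 _
    · intro w hw
      by_contra hn
      rw [Metric.mem_ball, not_lt, dist_eq_norm] at hn
      exact hw (hy w hn)
  have e1 : |∫ w, inner ℝ (F w) (radialField g (ε⁻¹ • (w - z))) ∂μ' -
      ∫ w, inner ℝ (F w) (radialField g (ε⁻¹ • (w - x))) ∂μ'| ≤
      ((ℓ * (2 * ε)) * (3 * L * (ε⁻¹ * ‖x - z‖))) * (m * ε ^ d) := by
    refine abs_integral_sub_integral_le_of_le_on_ball (by positivity) (by positivity) hμ'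
      (hint z hz0) (hint x fun w hw => hx0 w (by linarith)) hz0 (fun w hw => hx0 w (by linarith))
      fun w hw => ?_
    rw [← inner_sub_right]
    refine (abs_real_inner_le_norm _ _).trans ?_
    gcongr
    · exact (hFn w).trans (by gcongr)
    · rw [← norm_inv_smul_sub_inv_smul hε w x z]
      exact norm_radialField_sub_le hg h0 _ _
  have e2 : |∫ w, inner ℝ (F w) (radialField g (ε⁻¹ • (w - x))) ∂μ -
      ∫ w, inner ℝ (F w) (radialField g (ε⁻¹ • (w - x))) ∂μ'| ≤ (4 * ℓ * L) * (a * ε ^ d) := by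
    refine abs_integral_sub_le_of_bLipDist_le (by positivity) h
      (abs_inner_radialField_sub_le hg h0 h1 hε hℓ0 hF hFx) (fun u => ?_)
      (Metric.isClosed_closedBall (x := x) (ε := ε)) (Metric.closedBall_subset_ball (by linarith))
      fun w hw => hx0 w (by
        rw [Metric.mem_closedBall, not_le, dist_eq_norm] at hw; exact hw.le)
    rcases le_total ε ‖u - x‖ with hu | hu
    · rw [hx0 u hu, abs_zero]; positivity
    · refine (abs_real_inner_le_norm _ _).trans ?_
      calc ‖F u‖ * ‖radialField g (ε⁻¹ • (u - x))‖ ≤ (ℓ * 1) * L := by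
            gcongr
            · exact (hFn u).trans (by gcongr; exact hu.trans hε1)
            · exact norm_radialField_le hg h0 h1 _
        _ ≤ _ := by nlinarith [mul_nonneg hℓ0 hL0]
  rw [abs_sub_comm] at e2
  refine (abs_sub_le _ _ _).trans ((add_le_add e1 e2).trans (le_of_eq ?_))
  field_simp
  ring

end Comparison

section ReplacePlane

variable {d n : ℕ} {Ω : Set (Eucl n)} {x z : Eucl n} {ε m δ D B : ℝ}
variable {g : ℝ → ℝ} {L : NNReal}

/-- Replacing the plane `S` by `Q(w)` and the matrix `c` by `c'` in the numerator of `β^⊥`. -/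
theorem Varifold.abs_perpIntegral_sub_le (W : Varifold d Ω) (hΩ : IsOpen Ω)
    {ν : ProbabilityTheory.Kernel (Eucl n) (Gr d n)} (hν : W.IsDisintegration ν)
    (hg : LipschitzOnWith L g (Set.Ici 0)) (h0 : g 0 = 0) (h1 : ∀ t, 1 ≤ t → g t = 0) (hε : 0 < ε)
    (hzΩ : Metric.closedBall z ε ⊆ Ω) (hm : 0 ≤ m)
    (hμ : W.mass (Metric.ball z ε) ≤ ENNReal.ofReal m)
    {Q : Eucl n → (Eucl n →L[ℝ] Eucl n)} (hQ : Continuous Q) (hB : 1 ≤ B) (hQB : ∀ w, ‖Q w‖ ≤ B)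
    (hD : ∀ w ∈ Metric.ball z ε ∩ W.mass.support, ∫ S, ‖Q w - S.1‖ ∂(ν w) ≤ D) (hD0 : 0 ≤ D)
    {c c' : Matrix (Fin n) (Fin n) ℝ} (hc : ∀ a b, |c a b| ≤ 1) (hc' : ∀ a b, |c' a b| ≤ 1)
    (hcc : ∀ a b, |c a b - c' a b| ≤ δ) (i j k : Fin n) :
    |perpIntegral W g c ε z i j k -
      ∫ w, inner ℝ (perpField c' i j k (Q w)) (radialField g (ε⁻¹ • (w - z))) ∂W.mass| ≤
      2 * B * (1 + n) * (D + δ) * L * m := by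
  have hδ : 0 ≤ δ := (abs_nonneg _).trans (hcc i j)
  have hL0 : (0 : ℝ) ≤ L := L.2
  have := W.sigmaFinite_mass hΩ
  have : ProbabilityTheory.IsMarkovKernel ν := ⟨hν.1⟩
  have hκ : Continuous (radialField g : Eucl n → Eucl n) := continuous_radialField hg h0
  have hval : Continuous fun p : Eucl n × Gr d n => p.2.1 :=
    continuous_subtype_val.comp continuous_snd
  have hbd : ∀ (w : Eucl n) (S : Gr d n), ‖perpField c i j k S.1 - perpField c' i j k (Q w)‖ ≤
      2 * B * (1 + n) * (‖Q w - S.1‖ + δ) := fun w S => by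
    rw [norm_sub_rev (Q w)]
    exact norm_perpField_sub_le hB ((norm_le_one_of_gr S).trans hB) (hQB w) hc hc' hcc i j k
  have hQB' : ∀ (w : Eucl n) (S : Gr d n), ‖Q w - S.1‖ ≤ B + B := fun w S =>
    (norm_sub_le _ _).trans (add_le_add (hQB w) ((norm_le_one_of_gr S).trans hB))
  have hfield : Continuous fun p : Eucl n × Gr d n =>
      perpField c i j k p.2.1 - perpField c' i j k (Q p.1) :=
    ((continuous_perpField c i j k).comp hval).sub
      ((continuous_perpField c' i j k).comp (hQ.comp continuous_fst))
  have hone : ∀ p : Eucl n × Gr d n, ‖perpField c i j k p.2.1‖ ≤ 2 * B * (1 + n) * (B + 1) := by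
    intro p
    have h := norm_perpField_sub_le (c := c) (c' := 0) (S := p.2.1) (S' := 0) (δ := 1) hB
      ((norm_le_one_of_gr p.2).trans hB) (by simp; linarith) hc (by simp)
      (fun a b => by simpa using hc a b) i j k
    have e : perpField (n := n) 0 i j k 0 = 0 := by simp [perpField, entry]
    rw [e, sub_zero, sub_zero] at h
    refine h.trans ?_
    gcongr
    exact (norm_le_one_of_gr p.2).trans hB
  have hi1 := W.integrable_inner_radialField hg h0 h1 hε hzΩ
    ((continuous_perpField c i j k).comp hval) hone
  have hi := W.integrable_inner_radialField hg h0 h1 hε hzΩ hfield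
    (B := 2 * B * (1 + n) * (B + B + δ)) fun p => (hbd p.1 p.2).trans (by gcongr; exact hQB' _ _)
  have hmap : ∫ w, inner ℝ (perpField c' i j k (Q w)) (radialField g (ε⁻¹ • (w - z))) ∂W.mass =
      ∫ p, inner ℝ (perpField c' i j k (Q p.1)) (radialField g (ε⁻¹ • (p.1 - z))) ∂W.toMeasure := by
    refine integral_map measurable_fst.aemeasurable (Continuous.aestronglyMeasurable ?_)
    have := (continuous_perpField c' i j k).comp hQ
    have h2 : Continuous fun w => perpField c' i j k (Q w) := this
    fun_prop
  have hi2 : Integrable (fun p : Eucl n × Gr d n =>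
      inner ℝ (perpField c' i j k (Q p.1)) (radialField g (ε⁻¹ • (p.1 - z)))) W.toMeasure := by
    refine (hi1.sub hi).congr (Eventually.of_forall fun p => ?_)
    simp only [Pi.sub_apply, Function.comp_apply]
    rw [← inner_sub_left, sub_sub_cancel]
  have hsub : perpIntegral W g c ε z i j k -
      ∫ w, inner ℝ (perpField c' i j k (Q w)) (radialField g (ε⁻¹ • (w - z))) ∂W.mass =
      ∫ p, inner ℝ (perpField c i j k p.2.1 - perpField c' i j k (Q p.1))
        (radialField g (ε⁻¹ • (p.1 - z))) ∂W.toMeasure := by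
    rw [hmap, perpIntegral]
    refine (integral_sub hi1 hi2).symm.trans (integral_congr_ae (Eventually.of_forall fun p => ?_))
    simp only [Function.comp_apply]
    rw [← inner_sub_left]
  rw [hsub]
  rw [hν.toMeasure_eq hΩ] at hi ⊢
  rw [Measure.integral_compProd hi]
  have hoff : ∀ w, w ∉ Metric.ball z ε → ∫ S, inner ℝ (perpField c i j k S.1 -
      perpField c' i j k (Q w)) (radialField g (ε⁻¹ • (w - z))) ∂(ν w) = 0 := by
    intro w hw
    rw [Metric.mem_ball, not_lt, dist_eq_norm] at hw
    rw [radialField_eq_zero h1 (one_le_norm_inv_smul hε hw)]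
    simp
  rw [← setIntegral_eq_integral_of_forall_compl_eq_zero hoff]
  have hae : ∀ᵐ w ∂(W.mass.restrict (Metric.ball z ε)), ‖∫ S, inner ℝ (perpField c i j k S.1 -
      perpField c' i j k (Q w)) (radialField g (ε⁻¹ • (w - z))) ∂(ν w)‖ ≤
      2 * B * (1 + n) * (D + δ) * L := by
    filter_upwards [ae_restrict_mem measurableSet_ball,
      ae_restrict_of_ae (Measure.support_mem_ae (μ := W.mass))] with w hw hws
    have hI := integrable_norm_sub (ν w) (Q w)
    calc _ ≤ ∫ S, 2 * B * (1 + n) * (‖Q w - S.1‖ + δ) * L ∂(ν w) := by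
          refine norm_integral_le_of_norm_le
            (((hI.add (integrable_const δ)).const_mul _).mul_const _) (Eventually.of_forall fun S => ?_)
          refine (abs_real_inner_le_norm _ _).trans ?_
          gcongr
          · exact hbd w S
          · exact norm_radialField_le hg h0 h1 _
      _ = 2 * B * (1 + n) * (∫ S, ‖Q w - S.1‖ ∂(ν w) + δ) * L := by
          rw [integral_mul_const, integral_const_mul, integral_add hI (integrable_const δ)]
          simp
      _ ≤ _ := by gcongr; exact hD w ⟨hw, hws⟩
  have hbound := norm_setIntegral_le_of_norm_le_const_ae (hμ.trans_lt ENNReal.ofReal_lt_top) hae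
  refine hbound.trans ?_
  gcongr
  exact ENNReal.toReal_le_of_le_ofReal hm hμ

end ReplacePlane

/-! ### Stability of the approximate orthogonal forms -/

section TangentExtension

variable {d n : ℕ} {Ω M : Set (Eucl n)} {x : Eucl n}

/-- `Q` is a bounded Lipschitz map of class `C¹` on `ℝⁿ` which gives the tangent planes of `M` at
points within distance `r₀` of `x ∈ M`, and near these points `M` is a graph with constant `C`. -/
structure IsTangentExtension (d : ℕ) {n : ℕ} (M : Set (Eucl n)) (x : Eucl n)
    (Q : Eucl n → (Eucl n →L[ℝ] Eucl n)) (K : NNReal) (B C r₀ : ℝ) : Prop where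
  mem : x ∈ M
  measurableSet : MeasurableSet M
  finrank_eq : ∀ y ∈ M, Module.finrank ℝ (tangentSpaceOf M y) = d
  contDiff : ContDiff ℝ 1 Q
  lipschitz : LipschitzWith K Q
  one_le : 1 ≤ B
  norm_le : ∀ w, ‖Q w‖ ≤ B
  radius_pos : 0 < r₀
  eq_tangentProj : ∀ w ∈ M ∩ Metric.ball x r₀, Q w = tangentProj M w
  const_nonneg : 0 ≤ C
  isGraphAt : ∀ y ∈ M ∩ Metric.ball x r₀, ∀ s, 0 < s → s ≤ r₀ → IsGraphAt d M C y s

/-- Cutting off with a bump function. -/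
theorem exists_contDiff_hasCompactSupport_eq {E F : Type*} [NormedAddCommGroup E] [NormedSpace ℝ E]
    [FiniteDimensional ℝ E] [NormedAddCommGroup F] [NormedSpace ℝ F] {N : Set E} (hN : IsOpen N)
    {x : E} (hxN : x ∈ N) {P : E → F} (hP : ContDiffOn ℝ 1 P N) :
    ∃ Q : E → F, ContDiff ℝ 1 Q ∧ HasCompactSupport Q ∧
      ∃ r > 0, ∀ w ∈ Metric.ball x r, Q w = P w := by
  obtain ⟨r, hr, hrN⟩ := Metric.isOpen_iff.1 hN x hxN
  obtain ⟨f, hf1, hf2⟩ : ∃ f : ContDiffBump x, f.rIn = r / 4 ∧ f.rOut = r / 2 :=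
    ⟨⟨r / 4, r / 2, by positivity, by linarith⟩, rfl, rfl⟩
  have hfN : tsupport f ⊆ N := by
    rw [f.tsupport_eq, hf2]
    exact (Metric.closedBall_subset_ball (by linarith)).trans hrN
  refine ⟨fun w => f w • P w, contDiff_iff_contDiffAt.2 fun w => ?_,
    f.hasCompactSupport.smul_right, r / 4, by positivity, fun w hw => ?_⟩
  · by_cases hw : w ∈ tsupport f
    · exact (f.contDiff.contDiffAt).smul ((hP w (hfN hw)).contDiffAt (hN.mem_nhds (hfN hw)))
    · have h1 : (fun w => f w • P w) =ᶠ[𝓝 w] fun _ => 0 := by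
        filter_upwards [(isClosed_tsupport (f : E → ℝ)).isOpen_compl.mem_nhds hw] with v hv
        rw [image_eq_zero_of_notMem_tsupport hv, zero_smul]
      exact contDiffAt_const.congr_of_eventuallyEq h1
  · simp only
    rw [f.one_of_mem_closedBall (by rw [hf1]; exact Metric.ball_subset_closedBall hw), one_smul]

theorem exists_isTangentExtension (hdn : d ≤ n) (hM : IsC2Submanifold d M)
    (hdim : ∀ y ∈ M, Module.finrank ℝ (tangentSpaceOf M y) = d) (hx : x ∈ M)
    {N : Set (Eucl n)} (hN : IsOpen N) (hxN : x ∈ N) {P : Eucl n → (Eucl n →L[ℝ] Eucl n)}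
    (hP : ContDiffOn ℝ 1 P N) (hPM : ∀ y ∈ M, P y = tangentProj M y) :
    ∃ Q K B C r₀, IsTangentExtension d M x Q K B C r₀ ∧ ∀ w ∈ Metric.ball x r₀, Q w = P w := by
  obtain ⟨Q, hQd, hQc, r, hr, hQP⟩ := exists_contDiff_hasCompactSupport_eq hN hxN hP
  obtain ⟨K, hK⟩ := hQd.lipschitzWith_of_hasCompactSupport hQc one_ne_zero
  obtain ⟨B, hB⟩ := hQc.exists_bound_of_continuous hQd.continuous
  have hLip : ∀ w ∈ M ∩ Metric.ball x r, ∀ w' ∈ M ∩ Metric.ball x r,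
      ‖tangentProj M w - tangentProj M w'‖ ≤ K * ‖w - w'‖ := by
    intro w hw w' hw'
    rw [← hPM w hw.1, ← hPM w' hw'.1, ← hQP w hw.2, ← hQP w' hw'.2, ← dist_eq_norm, ← dist_eq_norm]
    exact hK.dist_le_mul w w'
  obtain ⟨r₀, hr₀, C, hC, hG⟩ := exists_isGraphAt hdn hM hdim hx hr K.2 hLip
  have hsub : Metric.ball x (min r₀ r) ⊆ Metric.ball x r := Metric.ball_subset_ball (min_le_right _ _)
  have hsub₀ : Metric.ball x (min r₀ r) ⊆ Metric.ball x r₀ := Metric.ball_subset_ball (min_le_left _ _)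
  refine ⟨Q, K, max 1 B, C, min r₀ r, ?_, fun w hw => hQP w (hsub hw)⟩
  exact
    { mem := hx
      measurableSet := hM.measurableSet
      finrank_eq := hdim
      contDiff := hQd
      lipschitz := hK
      one_le := le_max_left _ _
      norm_le := fun w => (hB w).trans (le_max_right _ _)
      radius_pos := lt_min hr₀ hr
      eq_tangentProj := fun w hw => by rw [hQP w (hsub hw.2), hPM w hw.1]
      const_nonneg := hC
      isGraphAt := fun y hy s hs hs' => hG y ⟨hy.1, hsub₀ hy.2⟩ s hs (hs'.trans (min_le_left _ _)) }

/-- The matrix of an endomorphism of `ℝⁿ` in the standard basis. For `Q x = T_x M` it is the mean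
plane `c^V(x)` of `V = v(M, 1)`, see `IsTangentExtension.meanPlane_eq`. -/
def entryMatrix (S : Eucl n →L[ℝ] Eucl n) : Matrix (Fin n) (Fin n) ℝ := Matrix.of (entry S)

namespace IsTangentExtension

variable {Q : Eucl n → (Eucl n →L[ℝ] Eucl n)} {K : NNReal} {B C r₀ : ℝ}

theorem eq_self (hE : IsTangentExtension d M x Q K B C r₀) : Q x = tangentProj M x :=
  hE.eq_tangentProj x ⟨hE.mem, Metric.mem_ball_self hE.radius_pos⟩

theorem abs_entryMatrix_le (hE : IsTangentExtension d M x Q K B C r₀) (a b : Fin n) :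
    |entryMatrix (Q x) a b| ≤ 1 := by
  refine (abs_entry_le _ _ _).trans ?_
  rw [hE.eq_self]
  exact Submodule.starProjection_norm_le _

/-- The orthogonal correction makes the field vanish at the base point. This cancellation is what
turns errors relative to the kernel, of slope `1 / ε`, into errors of the same order as the data. -/
theorem perpField_self (hE : IsTangentExtension d M x Q K B C r₀) (i j k : Fin n) :
    perpField (entryMatrix (Q x)) i j k (Q x) = 0 := by
  rw [hE.eq_self]
  exact perpField_eq_zero (fun _ _ => rfl) i j k

theorem norm_perpField_sub_le (hE : IsTangentExtension d M x Q K B C r₀) (i j k : Fin n)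
    (u v : Eucl n) : ‖perpField (entryMatrix (Q x)) i j k (Q u) -
      perpField (entryMatrix (Q x)) i j k (Q v)‖ ≤ 2 * B * (1 + n) * K * ‖u - v‖ := by
  have hB := hE.one_le
  refine (_root_.norm_perpField_sub_le (δ := 0) hE.one_le (hE.norm_le u) (hE.norm_le v)
    hE.abs_entryMatrix_le hE.abs_entryMatrix_le (by simp) i j k).trans ?_
  rw [add_zero, mul_assoc _ (K : ℝ)]
  gcongr
  simpa [dist_eq_norm] using hE.lipschitz.dist_le_mul u v

theorem continuous_perpField (hE : IsTangentExtension d M x Q K B C r₀) (i j k : Fin n) :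
    Continuous fun w => perpField (entryMatrix (Q x)) i j k (Q w) :=
  (_root_.continuous_perpField _ i j k).comp hE.contDiff.continuous

theorem isGraphAt_self (hE : IsTangentExtension d M x Q K B C r₀) {s : ℝ} (hs : 0 < s)
    (hsr : s ≤ r₀) : IsGraphAt d M C x s :=
  hE.isGraphAt x ⟨hE.mem, Metric.mem_ball_self hE.radius_pos⟩ s hs hsr

variable {V : Varifold d Ω} {ν : ProbabilityTheory.Kernel (Eucl n) (Gr d n)}
variable {g ξ : ℝ → ℝ} {L : NNReal} {ε : ℝ}

theorem meanPlane_eq (hE : IsTangentExtension d M x Q K B C r₀)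
    (hνM : ∀ y ∈ M, ∃ S : Gr d n, S.1 = tangentProj M y ∧ ν y = Measure.dirac S) :
    meanPlane (ν x) = entryMatrix (Q x) := by
  obtain ⟨S, hS, hνS⟩ := hνM x hE.mem
  ext a b
  rw [hνS, meanPlane_dirac, hS, ← hE.eq_self]
  rfl

theorem perpIntegral_eq (hE : IsTangentExtension d M x Q K B C r₀) (hΩ : IsOpen Ω)
    (hν : V.IsDisintegration ν) (hVM : V.mass = surfaceMeasure d M)
    (hνM : ∀ y ∈ M, ∃ S : Gr d n, S.1 = tangentProj M y ∧ ν y = Measure.dirac S)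
    (hg : LipschitzOnWith L g (Set.Ici 0)) (h0 : g 0 = 0) (h1 : ∀ t, 1 ≤ t → g t = 0)
    (hε : 0 < ε) (hεr : ε ≤ r₀) (hεΩ : Metric.closedBall x ε ⊆ Ω) (i j k : Fin n) :
    perpIntegral V g (entryMatrix (Q x)) ε x i j k =
      ∫ w, inner ℝ (perpField (entryMatrix (Q x)) i j k (Q w)) (radialField g (ε⁻¹ • (w - x)))
        ∂(surfaceMeasure d M) := by
  have hval : Continuous fun p : Eucl n × Gr d n => p.2.1 :=
    continuous_subtype_val.comp continuous_snd
  have hB := hE.one_le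
  have hone : ∀ p : Eucl n × Gr d n,
      ‖perpField (entryMatrix (Q x)) i j k p.2.1‖ ≤ 2 * 1 * (1 + n) * (1 + 1) := by
    intro p
    have h := _root_.norm_perpField_sub_le (c := entryMatrix (Q x)) (c' := 0) (S := p.2.1) (S' := 0)
      (δ := 1) le_rfl (norm_le_one_of_gr p.2) (by simp) hE.abs_entryMatrix_le (by simp)
      (fun a b => by simpa using hE.abs_entryMatrix_le a b) i j k
    have e : perpField (n := n) 0 i j k 0 = 0 := by simp [perpField, entry]
    rw [e, sub_zero, sub_zero] at h
    refine h.trans ?_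
    gcongr
    exact norm_le_one_of_gr p.2
  have hi := V.integrable_inner_radialField hg h0 h1 hε hεΩ
    ((_root_.continuous_perpField (entryMatrix (Q x)) i j k).comp hval) hone
  refine (V.integral_eq_of_dirac hΩ hν hVM hE.measurableSet hνM (f := fun w S =>
    inner ℝ (perpField (entryMatrix (Q x)) i j k S) (radialField g (ε⁻¹ • (w - x)))) hi).trans ?_
  refine integral_congr_ae ?_
  filter_upwards [ae_restrict_mem hE.measurableSet] with w hw
  rcases lt_or_ge ‖w - x‖ ε with h | h
  · rw [hE.eq_tangentProj w ⟨hw, by rw [Metric.mem_ball, dist_eq_norm]; linarith⟩]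
  · rw [radialField_eq_zero h1 (one_le_norm_inv_smul hε h), inner_zero_right, inner_zero_right]

/-- The numerator of `β^{V,ε,⊥}(x)` for `V = v(M, 1)` is `O(ε^{d+1})`. -/
theorem exists_abs_integral_perpField_le (hE : IsTangentExtension d M x Q K B C r₀)
    (hg : LipschitzOnWith L g (Set.Ici 0)) (h0 : g 0 = 0) (h1 : ∀ t, 1 ≤ t → g t = 0) :
    ∃ b ≥ 0, ∀ᶠ ε in 𝓝[>] (0 : ℝ), ∀ i j k, |∫ w, inner ℝ (perpField (entryMatrix (Q x)) i j k (Q w))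
      (radialField g (ε⁻¹ • (w - x))) ∂(surfaceMeasure d M)| ≤ b * (ε * ε ^ d) := by
  have hB := hE.one_le
  have hC := hE.const_nonneg
  refine ⟨unitBallVolume d * (2 ^ (d + 7) * C ^ 2 + 16 * C + 2 ^ (d + 1)) *
    (L * (2 * B * (1 + n) * K)), by unfold unitBallVolume; positivity, ?_⟩
  filter_upwards [eventually_small_scale hE.radius_pos C] with ε ⟨e1, e2, e3, e4⟩ i j k
  have h := (hE.isGraphAt_self (by positivity) e2).abs_integral_inner_le hE.measurableSet
    hE.const_nonneg (hE.finrank_eq x hE.mem) e1 e3 e4 hg h0 h1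
    (F := fun w => perpField (entryMatrix (Q x)) i j k (Q w)) (hE.continuous_perpField i j k)
    (by rw [hE.perpField_self]; exact Submodule.zero_mem _) (ℓ := 2 * B * (1 + n) * K)
    (by positivity) fun w => hE.norm_perpField_sub_le i j k w x
  simp only [hE.perpField_self, norm_zero, zero_add] at h
  refine h.trans (le_of_eq ?_)
  ring

/-- The regularized mass of `M` at one of its points, in the limit of small scales. -/
theorem tendsto_massIntegral (hE : IsTangentExtension d M x Q K B C r₀) (hd : 1 ≤ d)
    {Lξ : NNReal} (hξ : LipschitzOnWith Lξ ξ (Set.Ici 0)) (hξ1 : ∀ t, 1 ≤ t → ξ t = 0) :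
    Tendsto (fun ε => (ε ^ d)⁻¹ * massIntegral (surfaceMeasure d M) ξ ε x) (𝓝[>] 0)
      (𝓝 (kernelConst d ξ)) := by
  have hlip := lipschitzWith_comp_norm (E := Eucl n) hξ
  have h := tendsto_integral_lipschitz (fun s hs hs' => hE.isGraphAt_self hs hs') hE.radius_pos
    hE.measurableSet hE.const_nonneg (hE.finrank_eq x hE.mem) (H := fun u => ξ ‖u‖) (ℓ := Lξ)
    hlip.continuous (fun u v => by simpa [Real.dist_eq, dist_eq_norm] using hlip.dist_le_mul u v)
    (fun u hu => hξ1 _ hu) (abs_norm_le_of_lipschitzOnWith hξ hξ1)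
  rw [← integral_norm_eq_kernelConst hd (hE.finrank_eq x hE.mem) hξ1]
  exact h

theorem eventually_le_massIntegral (hE : IsTangentExtension d M x Q K B C r₀) (hd : 1 ≤ d)
    {Lξ : NNReal} (hξ : LipschitzOnWith Lξ ξ (Set.Ici 0)) (hξ1 : ∀ t, 1 ≤ t → ξ t = 0)
    (hCξ : 0 < kernelConst d ξ) :
    ∀ᶠ ε in 𝓝[>] (0 : ℝ), kernelConst d ξ / 2 * ε ^ d ≤ massIntegral (surfaceMeasure d M) ξ ε x := by
  filter_upwards [(hE.tendsto_massIntegral hd hξ hξ1).eventually_const_le (half_lt_self hCξ),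
    self_mem_nhdsWithin] with ε h1 h2
  have hp : 0 < ε ^ d := pow_pos h2 d
  rwa [le_inv_mul_iff₀ hp, mul_comm] at h1

/-- The points of `M` belong to the support of its surface measure. -/
theorem surfaceMeasure_ball_pos (hE : IsTangentExtension d M x Q K B C r₀) (hd : 1 ≤ d)
    {Lξ : NNReal} (hξ : LipschitzOnWith Lξ ξ (Set.Ici 0)) (hξ1 : ∀ t, 1 ≤ t → ξ t = 0)
    (hCξ : 0 < kernelConst d ξ) {r : ℝ} (hr : 0 < r) :
    0 < surfaceMeasure d M (Metric.ball x r) := by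
  have h3 : Tendsto (fun ε : ℝ => ε) (𝓝[>] 0) (𝓝 0) := tendsto_nhdsWithin_of_tendsto_nhds tendsto_id
  have h7 : ∀ᶠ ε : ℝ in 𝓝[>] 0, 0 < ε := self_mem_nhdsWithin
  obtain ⟨ε, h1, h2, h4⟩ := ((hE.eventually_le_massIntegral hd hξ hξ1 hCξ).and
    (h7.and (h3.eventually_lt_const hr))).exists
  by_contra hn
  have h5 : surfaceMeasure d M (Metric.ball x r) = 0 := nonpos_iff_eq_zero.1 (not_lt.1 hn)
  have h6 : massIntegral (surfaceMeasure d M) ξ ε x = 0 := by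
    refine integral_eq_zero_of_ae ?_
    have : (Metric.ball x r)ᶜ ∈ ae (surfaceMeasure d M) := by
      rw [mem_ae_iff, compl_compl]; exact h5
    filter_upwards [this] with w hw
    rw [Set.mem_compl_iff, Metric.mem_ball, not_lt, dist_eq_norm] at hw
    exact hξ1 _ (one_le_norm_inv_smul h2 (h4.le.trans hw))
  rw [h6] at h1
  have : 0 < kernelConst d ξ / 2 * ε ^ d := by positivity
  linarith

end IsTangentExtension

end TangentExtension

section Stability

variable {d n : ℕ} {Ω M : Set (Eucl n)} {x z : Eucl n}
variable {Q : Eucl n → (Eucl n →L[ℝ] Eucl n)} {K : NNReal} {B C r₀ : ℝ}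
variable {V W : Varifold d Ω} {ν ν' : ProbabilityTheory.Kernel (Eucl n) (Gr d n)}
variable {g ξ : ℝ → ℝ} {L Lξ : NNReal} {ε a m D : ℝ}

/-- Stability of a quotient `N / T` with `N₀ = O(ε p)` and `T₀` of order `p`. The error `e'` of the
denominator has to be small compared with `ε`, the error `e` of the numerator does not. -/
theorem abs_inv_mul_div_sub_le {N N₀ T T₀ A b c e e' p : ℝ} (hε : 0 < ε) (hp : 0 < p) (hc : 0 < c)
    (hA : 0 ≤ A) (hb : 0 ≤ b) (hee : e' ≤ e) (hN : |N - N₀| ≤ A * e * p)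
    (hN₀ : |N₀| ≤ b * (ε * p)) (hT : |T - T₀| ≤ A * e' * (p * ε⁻¹)) (hT₀ : c * p ≤ T₀)
    (hsmall : A * e' * ε⁻¹ ≤ c / 2) :
    |ε⁻¹ * (N / T) - ε⁻¹ * (N₀ / T₀)| ≤ (2 * A / c + 2 * b * A / c ^ 2) * (e / ε) := by
  have hT' : c / 2 * p ≤ T := by
    have h1 := (abs_le.1 hT).1
    have h2 : A * e' * (p * ε⁻¹) ≤ c / 2 * p := by
      calc A * e' * (p * ε⁻¹) = (A * e' * ε⁻¹) * p := by ring
        _ ≤ _ := by gcongr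
    linarith
  have hTp : 0 < T := lt_of_lt_of_le (by positivity) hT'
  have hT₀p : 0 < T₀ := lt_of_lt_of_le (by positivity) hT₀
  have hAe : 0 ≤ A * e * p := (abs_nonneg _).trans hN
  have hTe : |T₀ - T| ≤ A * e * (p * ε⁻¹) := by
    rw [abs_sub_comm]
    exact hT.trans (by gcongr)
  have e1 : ε⁻¹ * (N / T) - ε⁻¹ * (N₀ / T₀) =
      ε⁻¹ * ((N - N₀) / T + N₀ * (T₀ - T) / (T * T₀)) := by
    field_simp; ring
  have q1 : |(N - N₀) / T| ≤ A * e * p / (c / 2 * p) := by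
    rw [abs_div, abs_of_pos hTp]
    gcongr
  have q2 : |N₀ * (T₀ - T) / (T * T₀)| ≤
      (b * (ε * p)) * (A * e * (p * ε⁻¹)) / ((c / 2 * p) * (c * p)) := by
    rw [abs_div, abs_mul, abs_of_pos (mul_pos hTp hT₀p)]
    gcongr
    exact mul_nonneg (by positivity) ((abs_nonneg _).trans hTe)
  rw [e1, abs_mul, abs_of_pos (inv_pos.2 hε)]
  calc _ ≤ ε⁻¹ * (A * e * p / (c / 2 * p) +
        (b * (ε * p)) * (A * e * (p * ε⁻¹)) / ((c / 2 * p) * (c * p))) := by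
        gcongr
        exact (abs_add_le _ _).trans (add_le_add q1 q2)
    _ = _ := by field_simp

/-- The numerators of the approximate orthogonal forms at a fixed scale: first `S` is replaced by
`Q(w)` and `c^W(z)` by `c^V(x)`, then the centre and the measure are changed. -/
theorem IsTangentExtension.abs_perpIntegral_sub_le (hE : IsTangentExtension d M x Q K B C r₀)
    (hΩ : IsOpen Ω) (hν : V.IsDisintegration ν) (hVM : V.mass = surfaceMeasure d M)
    (hνM : ∀ y ∈ M, ∃ S : Gr d n, S.1 = tangentProj M y ∧ ν y = Measure.dirac S)
    (hν' : W.IsDisintegration ν')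
    (hg : LipschitzOnWith L g (Set.Ici 0)) (h0 : g 0 = 0) (h1 : ∀ t, 1 ≤ t → g t = 0)
    (hε : 0 < ε) (hε1 : ε ≤ 1) (hεr : ε ≤ r₀) (hεΩ : Metric.closedBall x (4 * ε) ⊆ Ω)
    (hzx : ‖x - z‖ ≤ ε) (ha : 0 ≤ a) (hm : 0 ≤ m)
    (hμ : W.mass (Metric.ball x (2 * ε)) ≤ ENNReal.ofReal (m * ε ^ d))
    (hΔ : bLipDist Ω (Metric.ball x (4 * ε)) V.mass W.mass ≤ ENNReal.ofReal (a * ε ^ d))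
    (hD0 : 0 ≤ D) (hD : ∀ w ∈ Metric.ball z ε ∩ W.mass.support, ∫ S, ‖Q w - S.1‖ ∂(ν' w) ≤ D)
    (hc : ∀ a b, |meanPlane (ν' z) a b - meanPlane (ν x) a b| ≤ D + K * ‖x - z‖) (i j k : Fin n) :
    |perpIntegral W g (meanPlane (ν' z)) ε z i j k - perpIntegral V g (meanPlane (ν x)) ε x i j k| ≤
      2 * B * (1 + n) * L * ((2 + K) * m + K * (4 + 6 * m)) * (a + D + ‖x - z‖) * ε ^ d := by
  have hB := hE.one_le
  have hL0 : (0 : ℝ) ≤ L := L.2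
  have hK0 : (0 : ℝ) ≤ K := K.2
  have := hν'.1 z
  have hzsub : Metric.closedBall z ε ⊆ Metric.closedBall x (4 * ε) := fun w hw => by
    rw [Metric.mem_closedBall, dist_eq_norm] at hw ⊢
    have := norm_sub_le_norm_sub_add_norm_sub w z x
    rw [norm_sub_rev z x] at this
    linarith
  have hzball : Metric.ball z ε ⊆ Metric.ball x (2 * ε) := fun w hw => by
    rw [Metric.mem_ball, dist_eq_norm] at hw ⊢
    have := norm_sub_le_norm_sub_add_norm_sub w z x
    rw [norm_sub_rev z x] at this
    linarith
  rw [hE.meanPlane_eq hνM] at hc ⊢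
  rw [hE.perpIntegral_eq hΩ hν hVM hνM hg h0 h1 hε hεr
    ((Metric.closedBall_subset_closedBall (by linarith)).trans hεΩ)]
  have q1 := W.abs_perpIntegral_sub_le hΩ hν' hg h0 h1 hε (hzsub.trans hεΩ) (m := m * ε ^ d)
    (by positivity) ((measure_mono hzball).trans hμ) hE.contDiff.continuous hE.one_le hE.norm_le hD
    hD0 (abs_meanPlane_le (ν' z)) hE.abs_entryMatrix_le hc i j k
  rw [hVM] at hΔ
  have q2 := abs_integral_inner_radialField_sub_le hg h0 h1 hε hε1 hzx ha hm hμ hΔ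
    (ℓ := 2 * B * (1 + n) * K) (by positivity) (hE.norm_perpField_sub_le i j k)
    (hE.perpField_self i j k) (hE.continuous_perpField i j k)
  have hx0 := norm_nonneg (x - z)
  refine (abs_sub_le _ _ _).trans ((add_le_add q1 q2).trans ?_)
  have e : 2 * B * (1 + n) * (D + (D + K * ‖x - z‖)) * L * (m * ε ^ d) +
      2 * B * (1 + n) * K * L * (4 * a + 6 * m * ‖x - z‖) * ε ^ d =
      2 * B * (1 + n) * L * ((2 * D + K * ‖x - z‖) * m + K * (4 * a + 6 * m * ‖x - z‖)) * ε ^ d := by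
    ring
  rw [e, mul_assoc (2 * B * (1 + n) * L) _ (a + D + ‖x - z‖)]
  gcongr
  have p1 : 0 ≤ K * ‖x - z‖ := by positivity
  have p2 : (2 * D + K * ‖x - z‖) * m ≤ ((2 + K) * (a + D + ‖x - z‖)) * m := by
    gcongr
    nlinarith [mul_nonneg hK0 ha, mul_nonneg hK0 hD0]
  have p3 : K * (4 * a + 6 * m * ‖x - z‖) ≤ K * ((4 + 6 * m) * (a + D + ‖x - z‖)) := by
    gcongr
    nlinarith [mul_nonneg hm ha, mul_nonneg hm hD0]
  linarith

theorem IsTangentExtension.abs_meanPlane_sub_le (hE : IsTangentExtension d M x Q K B C r₀)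
    (hνM : ∀ y ∈ M, ∃ S : Gr d n, S.1 = tangentProj M y ∧ ν y = Measure.dirac S)
    (hν' : W.IsDisintegration ν') (hD : ∫ S, ‖Q z - S.1‖ ∂(ν' z) ≤ D) (a b : Fin n) :
    |meanPlane (ν' z) a b - meanPlane (ν x) a b| ≤ D + K * ‖x - z‖ := by
  have := hν'.1 z
  rw [hE.meanPlane_eq hνM]
  refine (abs_sub_le _ (entry (Q z) a b) _).trans (add_le_add
    ((abs_meanPlane_sub_entry_le _ _ _ _).trans hD) ?_)
  change |entry (Q z) a b - entry (Q x) a b| ≤ _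
  rw [← entry_sub, norm_sub_rev x]
  refine (abs_entry_le _ _ _).trans ?_
  simpa [dist_eq_norm] using hE.lipschitz.dist_le_mul z x

end Stability

section StabilitySequence

variable {d n : ℕ} {Ω M : Set (Eucl n)} {x : Eucl n}
variable {Q : Eucl n → (Eucl n →L[ℝ] Eucl n)} {K : NNReal} {B C r₀ : ℝ}
variable {V : Varifold d Ω} {ν : ProbabilityTheory.Kernel (Eucl n) (Gr d n)}

theorem unitBallVolume_nonneg (d : ℕ) : 0 ≤ unitBallVolume d := by
  unfold unitBallVolume; positivity

/-- Upper density bound at the scale `s ε`, for fixed `s` and all small `ε`. -/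
theorem IsTangentExtension.surfaceMeasure_ball_le (hE : IsTangentExtension d M x Q K B C r₀)
    {s : ℝ} (hs : 0 < s) : ∀ᶠ ε in 𝓝[>] (0 : ℝ), surfaceMeasure d M (Metric.ball x (s * ε)) ≤
      ENNReal.ofReal (2 * s ^ d * unitBallVolume d * ε ^ d) := by
  have h1 : Tendsto (fun ε : ℝ => s / 2 * ε) (𝓝[>] 0) (𝓝[>] 0) := by
    refine tendsto_nhdsWithin_iff.2 ⟨?_, ?_⟩
    · have : Continuous fun ε : ℝ => s / 2 * ε := by fun_prop
      simpa using tendsto_nhdsWithin_of_tendsto_nhds (this.tendsto 0)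
    · filter_upwards [self_mem_nhdsWithin] with ε hε
      exact mul_pos (half_pos hs) hε
  filter_upwards [h1.eventually (eventually_small_scale hE.radius_pos C)] with ε ⟨e1, e2, e3, e4⟩
  have h := (hE.isGraphAt_self (by positivity) e2).surfaceMeasure_ball_le hE.const_nonneg
    (hE.finrank_eq x hE.mem) e1 e3 e4
  have e5 : 2 * (s / 2 * ε) = s * ε := by ring
  rw [e5, mul_pow] at h
  refine h.trans (le_of_eq ?_)
  congr 1; ring

set_option maxHeartbeats 400000 in
/-- The estimate for the approximate orthogonal forms of a sequence of varifolds. -/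
theorem IsTangentExtension.exists_perp_sub_le (hE : IsTangentExtension d M x Q K B C r₀)
    (hd : 1 ≤ d) {ρ ξ : ℝ → ℝ} (hker : IsKernelPair n ρ ξ) (hΩ : IsOpen Ω) (hxΩ : x ∈ Ω)
    (hν : V.IsDisintegration ν) (hVM : V.mass = surfaceMeasure d M)
    (hνM : ∀ y ∈ M, ∃ S : Gr d n, S.1 = tangentProj M y ∧ ν y = Measure.dirac S)
    {P : Eucl n → (Eucl n →L[ℝ] Eucl n)} (hQP : ∀ w ∈ Metric.ball x r₀, Q w = P w)
    {W : ℕ → Varifold d Ω} {νW : ℕ → ProbabilityTheory.Kernel (Eucl n) (Gr d n)}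
    (hνW : ∀ h, (W h).IsDisintegration (νW h)) {z : ℕ → Eucl n}
    (hzW : ∀ h, z h ∈ (W h).mass.support) {η d₁ d₂ ε : ℕ → ℝ} (hη : ∀ h, 0 < η h)
    (hd₁ : ∀ h, 0 < d₁ h) (hd₂ : ∀ h, 0 < d₂ h) (hε : ∀ h, 0 < ε h) (hε0 : Tendsto ε atTop (𝓝 0))
    (hmass : ∃ U ∈ 𝓝 x, ∀ h, ∀ y ∈ V.mass.support, ∀ r : ℝ, 0 < r →
      Metric.ball y r ⊆ Ω → Metric.ball y r ⊆ U →
      bLipDist Ω (Metric.ball y r) V.mass (W h).mass ≤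
        ENNReal.ofReal (d₁ h) *
          min (V.mass (Metric.thickening (η h) (Metric.ball y r)))
            ((W h).mass (Metric.thickening (η h) (Metric.ball y r))))
    (hplane : ∀ᶠ h in atTop, ∀ y ∈ Metric.ball x (ε h + dist x (z h)) ∩ (W h).mass.support,
      ∫ S, ‖P y - S.1‖ ∂(νW h y) ≤ d₂ h)
    (hηε : η =O[atTop] ε) (ho : (fun h => d₁ h + dist x (z h)) =o[atTop] ε) :
    ∃ C : ℝ, 0 < C ∧ ∀ᶠ h in atTop, ∀ i j k : Fin n,
        max
          |(W h).betaPerp (νW h) ρ ξ (ε h) (z h) i j k - V.betaPerp ν ρ ξ (ε h) x i j k|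
          |(W h).formPerp (νW h) ρ ξ (ε h) (z h) i j k - V.formPerp ν ρ ξ (ε h) x i j k|
        ≤ C * ((d₁ h + d₂ h + dist x (z h)) / ε h) := by
  obtain ⟨L, hg⟩ := hker.deriv_rho_lipschitz
  obtain ⟨Lξ, hξ⟩ := hker.contDiff_xi.exists_lipschitzOnWith_of_eq_zero hker.xi_eq_zero
  have h0 := hker.deriv_rho_zero
  have h1 := hker.profileDeriv_eq_zero
  have hCξ := hker.kernelConst_xi_pos hd
  have hB := hE.one_le
  have hL0 : (0 : ℝ) ≤ L := L.2
  have hK0 : (0 : ℝ) ≤ K := K.2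
  have hLξ0 : (0 : ℝ) ≤ Lξ := Lξ.2
  obtain ⟨κ, hκ, hηκ⟩ := hηε.exists_pos
  obtain ⟨U, hU, hmass⟩ := hmass
  obtain ⟨r, hr, hrU⟩ := Metric.mem_nhds_iff.1 (Filter.inter_mem (hΩ.mem_nhds hxΩ) hU)
  obtain ⟨b, hb, hN₀⟩ := hE.exists_abs_integral_perpField_le hg h0 h1
  obtain ⟨m, hm⟩ : ∃ m : ℝ, m = 2 * (4 + κ) ^ d * unitBallVolume d := ⟨_, rfl⟩
  have hm0 : 0 ≤ m := by have := unitBallVolume_nonneg d; rw [hm]; positivity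
  obtain ⟨c, hc⟩ : ∃ c : ℝ, c = kernelConst d ξ / 2 := ⟨_, rfl⟩
  have hc0 : 0 < c := by rw [hc]; positivity
  obtain ⟨A₀, hA₀⟩ : ∃ A₀ : ℝ, A₀ = 2 * B * (1 + n) * L * ((2 + K) * (m + 1) + K * (4 + 6 * (m + 1))) := ⟨_, rfl⟩
  have hA₀0 : 0 ≤ A₀ := by rw [hA₀]; positivity
  obtain ⟨A, hA⟩ : ∃ A : ℝ, A = Lξ * (m + 1) + A₀ * (m + 1) := ⟨_, rfl⟩
  have hA0 : 0 ≤ A := by rw [hA]; positivity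
  obtain ⟨q, hq⟩ : ∃ q : ℝ, q = |kernelConst d ξ / kernelConst d ρ| := ⟨_, rfl⟩
  obtain ⟨C₁, hC₁⟩ : ∃ C₁ : ℝ, C₁ = q * (2 * A / c + 2 * b * A / c ^ 2) := ⟨_, rfl⟩
  have hq0 : 0 ≤ q := by rw [hq]; positivity
  have hC₁0 : 0 ≤ C₁ := by rw [hC₁]; positivity
  obtain ⟨C₂, hC₂⟩ : ∃ C₂ : ℝ, C₂ = (1 + n ^ 2) * C₁ + (n ^ 4 + n ^ 2) * (q * (b / c) * (1 + K)) := ⟨_, rfl⟩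
  have hC₂0 : 0 ≤ C₂ := by rw [hC₂]; positivity
  refine ⟨C₁ + C₂ + 1, by positivity, ?_⟩
  have hε' : Tendsto ε atTop (𝓝[>] 0) :=
    tendsto_nhdsWithin_iff.2 ⟨hε0, Eventually.of_forall hε⟩
  have h4ε : Tendsto (fun h => 4 * ε h) atTop (𝓝 0) := by simpa using hε0.const_mul 4
  have h2ε : Tendsto (fun h => 2 * ε h) atTop (𝓝 0) := by simpa using hε0.const_mul 2
  -- the error `d₁ + |x - z|` has to be small enough for the total mass bound and for the denominator
  have hsmall : 0 < min (1 / (m + 1)) (c / (2 * (A + 1))) := by positivity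
  filter_upwards [hε'.eventually (eventually_small_scale hE.radius_pos C),
    hε'.eventually (hE.surfaceMeasure_ball_le (s := 4 + κ) (by positivity)),
    h4ε.eventually_lt_const hr, h2ε.eventually_lt_const hE.radius_pos, ho.def hsmall, hηκ.bound,
    hε'.eventually hN₀, hε'.eventually (hE.eventually_le_massIntegral hd hξ hker.xi_eq_zero hCξ),
    hplane] with h ⟨e1, e2, e3, e4⟩ hμ hrε hr₀ε hoh hηh hN₀h hT₀ hpl i j k
  have hp : 0 < ε h ^ d := by positivity
  rw [← hm] at hμ
  have ht : 0 ≤ ‖x - z h‖ := norm_nonneg _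
  have hd₁h := hd₁ h
  have hd₂h := hd₂ h
  simp only [dist_eq_norm] at hoh hpl ⊢
  rw [Real.norm_of_nonneg (by positivity), Real.norm_of_nonneg (hε h).le] at hoh
  rw [Real.norm_of_nonneg (hη h).le, Real.norm_of_nonneg (hε h).le] at hηh
  have ho1 : (m + 1) * (d₁ h + ‖x - z h‖) ≤ ε h := by
    have : d₁ h + ‖x - z h‖ ≤ 1 / (m + 1) * ε h :=
      hoh.trans (mul_le_mul_of_nonneg_right (min_le_left _ _) e1.le)
    rwa [div_mul_eq_mul_div, one_mul, le_div_iff₀' (by positivity)] at this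
  have ho2 : A * (d₁ h + ‖x - z h‖) * (ε h)⁻¹ ≤ c / 2 := by
    have : d₁ h + ‖x - z h‖ ≤ c / (2 * (A + 1)) * ε h :=
      hoh.trans (mul_le_mul_of_nonneg_right (min_le_right _ _) e1.le)
    rw [← div_eq_mul_inv, div_le_iff₀ e1]
    calc A * (d₁ h + ‖x - z h‖) ≤ (A + 1) * (c / (2 * (A + 1)) * ε h) := by
          gcongr; linarith
      _ = _ := by field_simp
  have hmd : 0 ≤ m * d₁ h := by positivity
  have hmt : 0 ≤ m * ‖x - z h‖ := by positivity
  have hzx : ‖x - z h‖ ≤ ε h := by linarith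
  have hmε : m * d₁ h ≤ ε h := by linarith
  have hε1 : ε h ≤ 1 := by linarith
  have hxs : x ∈ V.mass.support := by
    rw [hVM, Measure.mem_support_iff_forall]
    intro O hO
    obtain ⟨s, hs, hsO⟩ := Metric.mem_nhds_iff.1 hO
    exact (hE.surfaceMeasure_ball_pos hd hξ hker.xi_eq_zero hCξ hs).trans_le (measure_mono hsO)
  have hcl : Metric.closedBall x (4 * ε h) ⊆ Metric.ball x r :=
    Metric.closedBall_subset_ball hrε
  have hbl : Metric.ball x (4 * ε h) ⊆ Metric.ball x r := Metric.ball_subset_ball hrε.le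
  have hclΩ : Metric.closedBall x (4 * ε h) ⊆ Ω := fun w hw => (hrU (hcl hw)).1
  have hthick : Metric.thickening (η h) (Metric.ball x (4 * ε h)) ⊆
      Metric.ball x ((4 + κ) * ε h) := by
    refine (Metric.thickening_ball _ _ _).trans (Metric.ball_subset_ball ?_)
    linarith
  -- closeness of the masses on `B(x, 4ε)`, with the mass of the `η`-neighbourhood bounded by density
  have hΔ : bLipDist Ω (Metric.ball x (4 * ε h)) V.mass (W h).mass ≤
      ENNReal.ofReal (m * d₁ h * ε h ^ d) := by
    refine (hmass h x hxs (4 * ε h) (by positivity) (fun w hw => (hrU (hbl hw)).1)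
      fun w hw => (hrU (hbl hw)).2).trans ?_
    calc ENNReal.ofReal (d₁ h) * _ ≤ ENNReal.ofReal (d₁ h) * ENNReal.ofReal (m * ε h ^ d) := by
          gcongr
          refine (min_le_left _ _).trans ?_
          rw [hVM]
          exact (measure_mono hthick).trans hμ
      _ = _ := by
          rw [← ENNReal.ofReal_mul hd₁h.le]
          congr 1; ring
  have hμV : V.mass (Metric.ball x (4 * ε h)) ≤ ENNReal.ofReal (m * ε h ^ d) := by
    rw [hVM]
    refine (measure_mono (Metric.ball_subset_ball ?_)).trans hμ
    linarith [mul_pos hκ e1]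
  have hμW : (W h).mass (Metric.ball x (2 * ε h)) ≤ ENNReal.ofReal ((m + 1) * ε h ^ d) :=
    measure_ball_le_of_bLipDist_le e1 hε1 hmd hmε hm0 hμV
      ((W h).mass_lt_top hclΩ (isCompact_closedBall _ _)) hΔ
  have hball : ∀ w, ‖w - z h‖ < ε h → ‖w - x‖ < ε h + ‖x - z h‖ ∧ Q w = P w := by
    intro w hw
    have h2 := norm_sub_le_norm_sub_add_norm_sub w (z h) x
    rw [norm_sub_rev (z h) x] at h2
    refine ⟨by linarith, hQP w ?_⟩
    rw [Metric.mem_ball, dist_eq_norm]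
    linarith
  have hD : ∀ w ∈ Metric.ball (z h) (ε h) ∩ (W h).mass.support,
      ∫ S, ‖Q w - S.1‖ ∂(νW h w) ≤ d₂ h := by
    rintro w ⟨hw, hws⟩
    rw [Metric.mem_ball, dist_eq_norm] at hw
    obtain ⟨h2, h3⟩ := hball w hw
    rw [h3]
    exact hpl w ⟨by rw [Metric.mem_ball, dist_eq_norm]; exact h2, hws⟩
  have hcc : ∀ a b, |meanPlane (νW h (z h)) a b - meanPlane (ν x) a b| ≤ d₂ h + K * ‖x - z h‖ :=
    hE.abs_meanPlane_sub_le hνM (hνW h) (hD (z h) ⟨Metric.mem_ball_self e1, hzW h⟩)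
  have hNN := hE.abs_perpIntegral_sub_le hΩ hν hVM hνM (hνW h) hg h0 h1 e1 hε1 (by linarith) hclΩ
    hzx hmd (by positivity) hμW hΔ hd₂h.le hD hcc
  have hTT := abs_massIntegral_sub_le hξ hker.xi_eq_zero e1 hε1 hzx hmd (by positivity) hμW hΔ
  have hclx : Metric.closedBall x (ε h) ⊆ Ω :=
    (Metric.closedBall_subset_closedBall (by linarith)).trans hclΩ
  have hclz : Metric.closedBall (z h) (ε h) ⊆ Ω := fun w hw => by
    rw [Metric.mem_closedBall, dist_eq_norm] at hw
    refine hclΩ ?_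
    rw [Metric.mem_closedBall, dist_eq_norm]
    have h2 := norm_sub_le_norm_sub_add_norm_sub w (z h) x
    rw [norm_sub_rev (z h) x] at h2
    linarith
  obtain ⟨e, he⟩ : ∃ e : ℝ, e = d₁ h + d₂ h + ‖x - z h‖ := ⟨_, rfl⟩
  have he0 : 0 ≤ e := by rw [he]; positivity
  rw [← he]
  have hN₀' : ∀ i j k, |perpIntegral V (profileDeriv ρ) (meanPlane (ν x)) (ε h) x i j k| ≤
      b * (ε h * ε h ^ d) := fun i j k => by
    rw [hE.meanPlane_eq hνM, hE.perpIntegral_eq hΩ hν hVM hνM hg h0 h1 e1 (by linarith) hclx]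
    exact hN₀h i j k
  rw [← hVM, ← hc] at hT₀
  -- the estimate for `β`
  have hβ : ∀ i j k, |(W h).betaPerp (νW h) ρ ξ (ε h) (z h) i j k -
      V.betaPerp ν ρ ξ (ε h) x i j k| ≤ C₁ * (e / ε h) := by
    intro i j k
    rw [(W h).betaPerp_eq (νW h) hker e1 hclz, V.betaPerp_eq ν hker e1 hclx, ← mul_sub, abs_mul,
      abs_neg, hC₁, hq, mul_assoc]
    refine mul_le_mul_of_nonneg_left ?_ (abs_nonneg _)
    refine abs_inv_mul_div_sub_le (e' := d₁ h + ‖x - z h‖) e1 hp hc0 hA0 hb (by rw [he]; linarith) ?_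
      (hN₀' i j k) ?_ hT₀ ho2
    · refine (hNN i j k).trans (mul_le_mul_of_nonneg_right ?_ hp.le)
      have h3 : m * d₁ h + d₂ h + ‖x - z h‖ ≤ (m + 1) * e := by
        rw [he]; linarith [mul_nonneg hm0 hd₂h.le]
      rw [← hA₀]
      calc _ ≤ A₀ * ((m + 1) * e) := by gcongr
        _ = (A₀ * (m + 1)) * e := by ring
        _ ≤ A * e := by
          gcongr
          rw [hA]
          exact le_add_of_nonneg_left (by positivity)
    · refine hTT.trans (mul_le_mul_of_nonneg_right ?_ (by positivity))
      have h3 : m * d₁ h + (m + 1) * ‖x - z h‖ ≤ (m + 1) * (d₁ h + ‖x - z h‖) := by linarith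
      calc _ ≤ Lξ * ((m + 1) * (d₁ h + ‖x - z h‖)) := by gcongr
        _ = (Lξ * (m + 1)) * (d₁ h + ‖x - z h‖) := by ring
        _ ≤ A * (d₁ h + ‖x - z h‖) := by
          gcongr
          rw [hA]
          exact le_add_of_nonneg_right (by positivity)
  -- `β` of the limit varifold is bounded, so that the solutions of the linear systems are close
  have hβV : ∀ i j k, |V.betaPerp ν ρ ξ (ε h) x i j k| ≤ q * (b / c) := by
    intro i j k
    rw [V.betaPerp_eq ν hker e1 hclx, abs_mul, abs_neg, ← hq]
    refine mul_le_mul_of_nonneg_left ?_ hq0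
    have hTp : 0 < massIntegral V.mass ξ (ε h) x := lt_of_lt_of_le (by positivity) hT₀
    rw [abs_mul, abs_div, abs_of_pos hTp, abs_of_pos (inv_pos.2 e1)]
    calc _ ≤ (ε h)⁻¹ * (b * (ε h * ε h ^ d) / (c * ε h ^ d)) := by
          gcongr
          exact hN₀' i j k
      _ = b / c := by field_simp
  have heε : 0 ≤ e / ε h := by positivity
  refine max_le ((hβ i j k).trans ?_) ?_
  · gcongr
    linarith
  · have hP1 := (hνW h).1 (z h)
    have hP2 := hν.1 x
    have h3 := abs_systemSolution_sub_le (posSemidef_meanPlane (νW h (z h)))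
      (posSemidef_meanPlane (ν x)) (abs_meanPlane_le _) hβ hβV hcc i j k
    refine (h3 : |(W h).formPerp (νW h) ρ ξ (ε h) (z h) i j k -
      V.formPerp ν ρ ξ (ε h) x i j k| ≤ _).trans ?_
    have h4 : d₂ h + K * ‖x - z h‖ ≤ (1 + K) * (e / ε h) := by
      have h5 : e ≤ e / ε h := le_div_self he0 e1 hε1
      calc d₂ h + K * ‖x - z h‖ ≤ (1 + K) * e := by
            rw [he]; linarith [mul_nonneg hK0 hd₁h.le, mul_nonneg hK0 hd₂h.le]
        _ ≤ _ := by gcongr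
    calc _ ≤ (1 + n ^ 2) * (C₁ * (e / ε h)) +
          (n ^ 4 + n ^ 2) * (q * (b / c) * ((1 + K) * (e / ε h))) := by gcongr
      _ = C₂ * (e / ε h) := by rw [hC₂]; ring
      _ ≤ _ := by gcongr; linarith

end StabilitySequence

/-! ### Uniqueness of the continuous representative of the density -/

section Uniqueness

variable {d n : ℕ} {Ω M : Set (Eucl n)} {x : Eucl n}

/-- A measure which is dominated by a measure singular to it vanishes. -/
theorem measure_eq_zero_of_forall_integral_le {μ σ : Measure (Eucl n)} {O : Set (Eucl n)}
    (hO : IsOpen O) (hOb : Bornology.IsBounded O) (hμ : μ O < ⊤) (hσ : σ O < ⊤)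
    (hms : σ.MutuallySingular (μ.restrict O)) {δ : ℝ} (hδ : 0 < δ)
    (h : ∀ φ : Eucl n → ℝ, ContDiff ℝ 1 φ → HasCompactSupport φ → tsupport φ ⊆ O →
      (∀ y, φ y ∈ Set.Icc (0 : ℝ) 1) → δ * ∫ y, φ y ∂μ ≤ ∫ y, φ y ∂σ) : μ O = 0 := by
  by_contra hne
  have hμ' : IsFiniteMeasure (μ.restrict O) := ⟨by rwa [Measure.restrict_apply_univ]⟩
  have hσ' : IsFiniteMeasure (σ.restrict O) := ⟨by rwa [Measure.restrict_apply_univ]⟩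
  have hN : MeasurableSet (hms.nullSet ∩ O) := hms.measurableSet_nullSet.inter hO.measurableSet
  have hpos : 0 < μ.restrict O (hms.nullSet ∩ O) := by
    have h1 : μ.restrict O (hms.nullSet ∩ O) = μ O := by
      rw [← Measure.restrict_apply_univ O]
      refine measure_congr (eventuallyEq_set.2 ?_)
      have h2 : hms.nullSet ∈ ae (μ.restrict O) := mem_ae_iff.2 hms.measure_compl_nullSet
      filter_upwards [h2, ae_restrict_mem hO.measurableSet] with w hw hwO
      simp [hw, hwO]
    rw [h1]
    exact pos_iff_ne_zero.2 hne
  -- a compact null set for `σ` of positive `μ`-measure, and a cut-off function concentrated near it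
  obtain ⟨F, hFN, hF, hFpos⟩ := hN.exists_lt_isCompact hpos
  have hσF : σ.restrict O F = 0 :=
    measure_mono_null (hFN.trans Set.inter_subset_left)
      (nonpos_iff_eq_zero.1 ((Measure.restrict_apply_le _ _).trans hms.measure_nullSet.le))
  have hFr : 0 < (μ.restrict O).real F := ENNReal.toReal_pos hFpos.ne' (measure_ne_top _ _)
  obtain ⟨G, hFG, hG, hσG⟩ := F.exists_isOpen_lt_of_lt (μ := σ.restrict O)
    (ENNReal.ofReal (δ * (μ.restrict O).real F)) (by
      rw [hσF]; exact ENNReal.ofReal_pos.2 (mul_pos hδ hFr))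
  obtain ⟨f, hf0, hf1, hf⟩ := exists_contMDiffMap_zero_one_nhds_of_isClosed (n := 1)
    (modelWithCornersSelf ℝ (Eucl n)) (hG.inter hO).isClosed_compl hF.isClosed
    (Set.disjoint_compl_left_iff_subset.2
      (Set.subset_inter hFG (hFN.trans Set.inter_subset_right)))
  have hfs : tsupport f ⊆ G ∩ O := fun w hw => by
    by_contra hwn
    exact notMem_tsupport_iff_eventuallyEq.2 (eventually_nhdsSet_iff_forall.1 hf0 w hwn) hw
  have hfc : HasCompactSupport f :=
    Metric.isCompact_of_isClosed_isBounded (isClosed_tsupport _)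
      (hOb.subset (hfs.trans Set.inter_subset_right))
  have hf2 : ContDiff ℝ 1 f := f.contMDiff.contDiff
  have hfz : ∀ w, w ∉ G ∩ O → f w = 0 := fun w hw =>
    image_eq_zero_of_notMem_tsupport fun hw' => hw (hfs hw')
  have h1 := h f hf2 hfc (hfs.trans Set.inter_subset_right) hf
  have hint : Integrable f (μ.restrict O) := hf2.continuous.integrable_of_hasCompactSupport hfc
  have e1 : ∫ y, f y ∂μ = ∫ y, f y ∂(μ.restrict O) :=
    (setIntegral_eq_integral_of_forall_compl_eq_zero fun w hw => hfz w fun hw' => hw hw'.2).symm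
  have e2 : ∫ y, f y ∂σ = ∫ y in G, f y ∂(σ.restrict O) := by
    rw [setIntegral_eq_integral_of_forall_compl_eq_zero fun w hw => hfz w fun hw' => hw hw'.1]
    exact (setIntegral_eq_integral_of_forall_compl_eq_zero fun w hw => hfz w fun hw' => hw hw'.2).symm
  have q1 : (μ.restrict O).real F ≤ ∫ y, f y ∂(μ.restrict O) := by
    refine le_trans (le_of_eq ?_) (setIntegral_le_integral hint
      (Eventually.of_forall fun w => (hf w).1) (s := F))
    rw [setIntegral_congr_fun hF.measurableSet (g := fun _ => (1 : ℝ)) fun w hw =>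
      (eventually_nhdsSet_iff_forall.1 hf1 w hw).self_of_nhds]
    simp
  have q2 : ∫ y in G, f y ∂(σ.restrict O) ≤ (σ.restrict O).real G := by
    have h2 := norm_setIntegral_le_of_norm_le_const (μ := σ.restrict O) (s := G) (f := f) (C := 1)
      (measure_lt_top _ _) fun w _ => by rw [Real.norm_of_nonneg (hf w).1]; exact (hf w).2
    rw [one_mul] at h2
    exact (le_abs_self _).trans h2
  have q3 : (σ.restrict O).real G < δ * (μ.restrict O).real F :=
    (ENNReal.lt_ofReal_iff_toReal_lt (measure_ne_top _ _)).1 hσG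
  rw [e1, e2] at h1
  have : δ * (μ.restrict O).real F ≤ δ * ∫ y, f y ∂(μ.restrict O) := by gcongr
  linarith

/-- Two densities of the variation which are continuous along `M` at a point of the support agree
there. If they did not, their difference times the mass, bounded below by a multiple of the mass
near `x`, would be dominated by a singular measure. -/
theorem Varifold.IsVariationDensity.apply_eq {V : Varifold d Ω} {U U' : Set (Eucl n)}
    {β β' : Fin n → Fin n → Fin n → Eucl n → ℝ} (hβ : V.IsVariationDensity U β)
    (hβ' : V.IsVariationDensity U' β') (hU : IsOpen U) (hU' : IsOpen U') (hUΩ : U ⊆ Ω)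
    (hxU : x ∈ U) (hxU' : x ∈ U') (hM : ∀ᵐ w ∂V.mass, w ∈ M)
    (hpos : ∀ r, 0 < r → 0 < V.mass (Metric.ball x r)) (i j k : Fin n)
    (hc : ContinuousWithinAt (β i j k) M x) (hc' : ContinuousWithinAt (β' i j k) M x) :
    β i j k x = β' i j k x := by
  -- by symmetry it suffices to prove one inequality
  have key : ∀ {U U' : Set (Eucl n)} {β β' : Fin n → Fin n → Fin n → Eucl n → ℝ},
      V.IsVariationDensity U β → V.IsVariationDensity U' β' → IsOpen U → IsOpen U' → U ∩ U' ⊆ Ω →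
      x ∈ U → x ∈ U' → ContinuousWithinAt (β i j k) M x → ContinuousWithinAt (β' i j k) M x →
      β i j k x ≤ β' i j k x := by
    intro U U' β β' hβ hβ' hU hU' hUΩ hxU hxU' hc hc'
    by_contra hlt
    rw [not_le] at hlt
    obtain ⟨δ, hδ, hδlt⟩ : ∃ δ > 0, δ < β i j k x - β' i j k x :=
      exists_between (sub_pos.2 hlt)
    have hev : ∀ᶠ w in 𝓝[M] x, δ < β i j k w - β' i j k w :=
      (hc.sub hc').eventually_const_lt hδlt
    rw [eventually_nhdsWithin_iff] at hev
    obtain ⟨r, hr, hrs⟩ := Metric.mem_nhds_iff.1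
      (Filter.inter_mem hev (Filter.inter_mem (hU.mem_nhds hxU) (hU'.mem_nhds hxU')))
    obtain ⟨h1, σ₁, σ₂, hσ, hs1, hs2, hφ⟩ := hβ i j k
    obtain ⟨h1', σ₁', σ₂', hσ', hs1', hs2', hφ'⟩ := hβ' i j k
    set T := Metric.closedBall x (r / 2) with hT
    set O := Metric.ball x (r / 2) with hO
    have hOT : O ⊆ T := Metric.ball_subset_closedBall
    have hTr : T ⊆ Metric.ball x r := Metric.closedBall_subset_ball (by linarith)
    have hTU : T ⊆ U := fun w hw => (hrs (hTr hw)).2.1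
    have hTU' : T ⊆ U' := fun w hw => (hrs (hTr hw)).2.2
    have hTc : IsCompact T := isCompact_closedBall _ _
    have hrest : ∀ {A : Set (Eucl n)}, T ⊆ A → V.mass.restrict O ≤ V.mass.restrict A := fun hA =>
      Measure.restrict_mono (hOT.trans hA) le_rfl
    refine (hpos (r / 2) (by positivity)).ne' (measure_eq_zero_of_forall_integral_le (σ := σ₁ + σ₂')
      Metric.isOpen_ball Metric.isBounded_ball ?_ ?_ ?_ hδ fun φ hφ1 hφ2 hφ3 hφ4 => ?_)
    · exact (measure_mono hOT).trans_lt
        (V.mass_lt_top (fun w hw => hUΩ ⟨hTU hw, hTU' hw⟩) hTc)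
    · rw [Measure.add_apply]
      exact ENNReal.add_lt_top.2 ⟨(measure_mono hOT).trans_lt (hσ T hTU hTc).1,
        (measure_mono hOT).trans_lt (hσ' T hTU' hTc).2⟩
    · exact (hs1.mono le_rfl (hrest hTU)).add_left (hs2'.mono le_rfl (hrest hTU'))
    · have hzero : ∀ w, w ∉ T → φ w = 0 := fun w hw =>
        image_eq_zero_of_notMem_tsupport fun hw' => hw (hOT (hφ3 hw'))
      have hφint : ∀ {τ : Measure (Eucl n)}, τ T < ⊤ → Integrable φ τ := by
        intro τ hτ
        rw [← integrableOn_iff_integrable_of_support_subset (s := T)]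
        · exact Measure.integrableOn_of_bounded (M := 1) hτ.ne hφ1.continuous.aestronglyMeasurable
            (Eventually.of_forall fun w => by rw [Real.norm_of_nonneg (hφ4 w).1]; exact (hφ4 w).2)
        · intro w hw
          by_contra hn
          exact hw (hzero w hn)
      have hmul : ∀ {f : Eucl n → ℝ}, IntegrableOn f T V.mass →
          Integrable (fun w => f w * φ w) V.mass := by
        intro f hf
        rw [← integrableOn_iff_integrable_of_support_subset (s := T)]
        · exact hf.mul_bdd (c := 1) hφ1.continuous.aestronglyMeasurable
            (Eventually.of_forall fun w => by rw [Real.norm_of_nonneg (hφ4 w).1]; exact (hφ4 w).2)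
        · intro w hw
          by_contra hn
          exact hw (by simp [hzero w hn])
      have i1 := hmul (h1.integrableOn_compact_subset hTU hTc)
      have i2 := hmul (h1'.integrableOn_compact_subset hTU' hTc)
      have e1 := (hφ φ hφ1 hφ2 ((hφ3.trans hOT).trans hTU)).symm.trans
        (hφ' φ hφ1 hφ2 ((hφ3.trans hOT).trans hTU'))
      have e2 : ∫ w, φ w ∂(σ₁ + σ₂') = ∫ w, φ w ∂σ₁ + ∫ w, φ w ∂σ₂' :=
        integral_add_measure (hφint (hσ T hTU hTc).1) (hφint (hσ' T hTU' hTc).2)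
      have e3 : δ * ∫ w, φ w ∂V.mass ≤ ∫ w, β i j k w * φ w ∂V.mass -
          ∫ w, β' i j k w * φ w ∂V.mass := by
        rw [← integral_sub i1 i2, ← integral_const_mul]
        refine integral_mono_ae ((hφint
          (V.mass_lt_top (fun w hw => hUΩ ⟨hTU hw, hTU' hw⟩) hTc)).const_mul δ) (i1.sub i2) ?_
        filter_upwards [hM] with w hw
        rw [← sub_mul]
        by_cases hwT : w ∈ T
        · exact mul_le_mul_of_nonneg_right ((hrs (hTr hwT)).1 hw).le (hφ4 w).1
        · simp [hzero w hwT]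
      have p1 : 0 ≤ ∫ w, φ w ∂σ₂ := integral_nonneg fun w => (hφ4 w).1
      have p2 : 0 ≤ ∫ w, φ w ∂σ₁' := integral_nonneg fun w => (hφ4 w).1
      rw [e2]
      linarith
  have hΩ' : U ∩ U' ⊆ Ω := Set.inter_subset_left.trans hUΩ
  exact le_antisymm (key hβ hβ' hU hU' hΩ' hxU hxU' hc hc')
    (key hβ' hβ hU' hU (by rwa [Set.inter_comm]) hxU' hxU hc' hc)

end Uniqueness

/-! ### The density of the variation of a submanifold -/

section Density

variable {d n : ℕ} {Ω M : Set (Eucl n)} {x : Eucl n}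
variable {Q : Eucl n → (Eucl n →L[ℝ] Eucl n)} {K : NNReal} {B C r₀ : ℝ}
variable {V : Varifold d Ω} {ν : ProbabilityTheory.Kernel (Eucl n) (Gr d n)}

theorem contDiff_perpField (c : Matrix (Fin n) (Fin n) ℝ) (i j k : Fin n)
    (hQ : ContDiff ℝ 1 Q) : ContDiff ℝ 1 fun w => perpField c i j k (Q w) := by
  have h1 : ContDiff ℝ 1 fun w => entry (Q w) j k :=
    (EuclideanSpace.proj (𝕜 := ℝ) j).contDiff.comp (hQ.clm_apply contDiff_const)
  exact (h1.smul (hQ.clm_apply contDiff_const)).sub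
    ((hQ.clm_apply contDiff_const).const_smul (c j k))

theorem continuous_planeDiv {F : Eucl n → Eucl n} (hF : ContDiff ℝ 1 F) (hQ : Continuous Q) :
    Continuous fun y => planeDiv F y (Q y) := by
  have h1 : Continuous fun y => (fderiv ℝ F y).comp (Q y) :=
    (hF.continuous_fderiv one_ne_zero).clm_comp hQ
  have h2 : Continuous fun A : Eucl n →L[ℝ] Eucl n =>
      LinearMap.trace ℝ (Eucl n) (A : Eucl n →ₗ[ℝ] Eucl n) :=
    ((LinearMap.trace ℝ (Eucl n)).comp
      (ContinuousLinearMap.coeLM ℝ : (Eucl n →L[ℝ] Eucl n) →ₗ[ℝ] _)).continuous_of_finiteDimensional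
  exact h2.comp h1

/-- The tangential divergence of the field `P_{jk} P e_i`, where `P` is the tangent map of `M` and `Q`
an extension of it. It is a continuous representative of `β_{ijk}` for `v(M, 1)`. -/
def planeDensity (Q : Eucl n → (Eucl n →L[ℝ] Eucl n)) (i j k : Fin n) (y : Eucl n) : ℝ :=
  planeDiv (fun w => perpField 0 i j k (Q w)) y (Q y)

theorem continuous_planeDensity (hQ : ContDiff ℝ 1 Q) (i j k : Fin n) :
    Continuous (planeDensity Q i j k) :=
  continuous_planeDiv (contDiff_perpField 0 i j k hQ) hQ.continuous

namespace IsTangentExtension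

theorem variation_eq (hE : IsTangentExtension d M x Q K B C r₀) (hΩ : IsOpen Ω)
    (hν : V.IsDisintegration ν) (hVM : V.mass = surfaceMeasure d M)
    (hνM : ∀ y ∈ M, ∃ S : Gr d n, S.1 = tangentProj M y ∧ ν y = Measure.dirac S)
    {φ : Eucl n → ℝ} (hφ : ContDiff ℝ 1 φ) (hφc : HasCompactSupport φ) (hφΩ : tsupport φ ⊆ Ω)
    (hφr : tsupport φ ⊆ Metric.ball x r₀) (i j k : Fin n) :
    V.variation i j k φ = ∫ w, fderiv ℝ φ w (perpField 0 i j k (Q w)) ∂(surfaceMeasure d M) := by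
  have hgrad : Continuous (gradient φ) :=
    (InnerProductSpace.toDual ℝ (Eucl n)).symm.continuous.comp (hφ.continuous_fderiv one_ne_zero)
  have hval : Continuous fun p : Eucl n × Gr d n => p.2.1 :=
    continuous_subtype_val.comp continuous_snd
  have hoff : ∀ w, w ∉ tsupport φ → gradient φ w = 0 := fun w hw => by
    have h1 : fderiv ℝ φ w = 0 :=
      image_eq_zero_of_notMem_tsupport fun h => hw (tsupport_fderiv_subset ℝ h)
    rw [gradient, h1, map_zero]
  obtain ⟨b, hb⟩ := IsCompact.exists_bound_of_continuousOn (s := tsupport φ) hφc hgrad.continuousOn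
  have hb' : ∀ w, ‖gradient φ w‖ ≤ max b 0 := fun w => by
    by_cases hw : w ∈ tsupport φ
    · exact (hb w hw).trans (le_max_left _ _)
    · rw [hoff w hw, norm_zero]; exact le_max_right _ _
  have hi : Integrable (fun p : Eucl n × Gr d n => entry p.2.1 j k * (p.2.1 (gradient φ p.1)) i)
      V.toMeasure := by
    refine V.integrable_of_continuous hφΩ hφc (B := 1 * (1 * max b 0)) ?_ (fun p => ?_) fun p hp => ?_
    · have h2 : Continuous fun p : Eucl n × Gr d n => p.2.1 (gradient φ p.1) :=
        hval.clm_apply (hgrad.comp continuous_fst)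
      exact ((continuous_entry j k).comp hval).mul ((EuclideanSpace.proj i).continuous.comp h2)
    · rw [abs_mul]
      gcongr
      · exact (abs_entry_le _ _ _).trans (norm_le_one_of_gr p.2)
      · refine (PiLp.norm_apply_le (p.2.1 (gradient φ p.1)) i).trans ((p.2.1.le_opNorm _).trans ?_)
        gcongr
        · exact norm_le_one_of_gr p.2
        · exact hb' _
    · rw [hoff _ hp]; simp
  refine (V.integral_eq_of_dirac hΩ hν hVM hE.measurableSet hνM (f := fun w S =>
    entry S j k * (S (gradient φ w)) i) hi).trans (integral_congr_ae ?_)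
  filter_upwards [ae_restrict_mem hE.measurableSet] with w hw
  by_cases hwφ : w ∈ tsupport φ
  · rw [hE.eq_tangentProj w ⟨hw, hφr hwφ⟩, ← inner_gradient_left, real_inner_comm]
    have := inner_perpField (tangentSpaceOf M w) 0 i j k (gradient φ w)
    simp only [Matrix.zero_apply, zero_mul, sub_zero] at this
    exact this.symm
  · have h1 : fderiv ℝ φ w = 0 :=
      image_eq_zero_of_notMem_tsupport fun h => hwφ (tsupport_fderiv_subset ℝ h)
    rw [hoff w hwφ, h1]
    simp

theorem perpField_mem (hE : IsTangentExtension d M x Q K B C r₀) (c : Matrix (Fin n) (Fin n) ℝ)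
    (i j k : Fin n) {y : Eucl n} (hy : y ∈ M ∩ Metric.ball x r₀) :
    perpField c i j k (Q y) ∈ tangentSpaceOf M y := by
  rw [hE.eq_tangentProj y hy]
  exact Submodule.sub_mem _
    (Submodule.smul_mem _ _ (Submodule.starProjection_apply_mem _ _))
    (Submodule.smul_mem _ _ (Submodule.starProjection_apply_mem _ _))

/-- Near `x`, the variation of `v(M, 1)` has the density `planeDensity Q` and no singular part. -/
theorem exists_isVariationDensity (hE : IsTangentExtension d M x Q K B C r₀) (hd : 1 ≤ d)
    {ρ ξ : ℝ → ℝ} (hker : IsKernelPair n ρ ξ) (hΩ : IsOpen Ω) (hxΩ : x ∈ Ω)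
    (hν : V.IsDisintegration ν) (hVM : V.mass = surfaceMeasure d M)
    (hνM : ∀ y ∈ M, ∃ S : Gr d n, S.1 = tangentProj M y ∧ ν y = Measure.dirac S) :
    ∃ R > 0, Metric.ball x R ⊆ Ω ∧ V.IsVariationDensity (Metric.ball x R) (planeDensity Q) := by
  obtain ⟨L, hg⟩ := hker.deriv_rho_lipschitz
  have hB := hE.one_le
  obtain ⟨r, hr, hrΩ⟩ := Metric.isOpen_iff.1 hΩ x hxΩ
  have h3 : Tendsto (fun ε : ℝ => ε) (𝓝[>] 0) (𝓝 0) := tendsto_nhdsWithin_of_tendsto_nhds tendsto_id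
  obtain ⟨R, ⟨e1, e2, e3, e4⟩, hRr⟩ := ((eventually_small_scale hE.radius_pos C).and
    (h3.eventually_lt_const hr)).exists
  have hclΩ : Metric.closedBall x R ⊆ Ω := (Metric.closedBall_subset_ball hRr).trans hrΩ
  have hbΩ : Metric.ball x R ⊆ Ω := Metric.ball_subset_closedBall.trans hclΩ
  have hbr : Metric.ball x R ⊆ Metric.ball x r₀ := Metric.ball_subset_ball (by linarith)
  refine ⟨R, e1, hbΩ, fun i j k => ⟨?_, 0, 0, fun T _ _ => by simp,
    Measure.MutuallySingular.zero_left, Measure.MutuallySingular.zero_left,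
    fun φ hφ hφc hφR => ?_⟩⟩
  · have hc := continuous_planeDensity hE.contDiff i j k
    obtain ⟨b, hb⟩ := (isCompact_closedBall x R).exists_bound_of_continuousOn hc.continuousOn
    refine IntegrableOn.locallyIntegrableOn ?_
    refine IntegrableOn.mono_set ?_ Metric.ball_subset_closedBall
    refine Measure.integrableOn_of_bounded (M := b)
      (V.mass_lt_top hclΩ (isCompact_closedBall _ _)).ne hc.aestronglyMeasurable ?_
    filter_upwards [ae_restrict_mem Metric.isClosed_closedBall.measurableSet] with w hw using hb w hw
  · have hF := contDiff_perpField 0 i j k hE.contDiff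
    have hlip : ∀ u v, ‖perpField 0 i j k (Q u) - perpField 0 i j k (Q v)‖ ≤
        2 * B * (1 + n) * K * ‖u - v‖ := fun u v => by
      refine (_root_.norm_perpField_sub_le (δ := 0) hB (hE.norm_le u) (hE.norm_le v) (by simp)
        (by simp) (by simp) i j k).trans ?_
      rw [add_zero, mul_assoc _ (K : ℝ)]
      gcongr
      simpa [dist_eq_norm] using hE.lipschitz.dist_le_mul u v
    have hbd : ∀ w, ‖perpField 0 i j k (Q w)‖ ≤ 2 * B * (1 + n) * B := fun w => by
      have h := _root_.norm_perpField_sub_le (c := 0) (c' := 0) (S := Q w) (S' := 0) (δ := 0) hB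
        (hE.norm_le w) (by simp; linarith) (by simp) (by simp) (by simp) i j k
      have e : perpField (n := n) 0 i j k 0 = 0 := by simp [perpField, entry]
      rw [e, sub_zero, sub_zero, add_zero] at h
      exact h.trans (by gcongr; exact hE.norm_le w)
    have h := integral_fderiv_eq_neg_integral_planeDiv hd hE.measurableSet hE.const_nonneg
      hE.finrank_eq hker.hasDerivWithinAt hg hker.deriv_rho_zero hker.profileDeriv_eq_zero
      hker.rho_eq_zero (hker.kernelConst_rho_pos hd) hE.mem hE.isGraphAt e1 e2 e3 e4 hF
      (K := ⟨2 * B * (1 + n) * K, by positivity⟩)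
      (LipschitzWith.of_dist_le_mul fun u v => by
        rw [dist_eq_norm, dist_eq_norm]; exact hlip u v) hbd
      (fun y hy => hE.perpField_mem 0 i j k hy) hφ hφc hφR
    rw [hE.variation_eq hΩ hν hVM hνM hφ hφc (hφR.trans hbΩ) (hφR.trans hbr), h, hVM]
    simp only [integral_zero_measure, sub_zero, add_zero]
    congr 1
    refine integral_congr_ae ?_
    filter_upwards [ae_restrict_mem hE.measurableSet] with w hw
    by_cases hwφ : w ∈ tsupport φ
    · rw [planeDensity, hE.eq_tangentProj w ⟨hw, hbr (hφR hwφ)⟩, mul_comm]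
    · simp [image_eq_zero_of_notMem_tsupport hwφ]

/-- Differentiating `P² = P` in a direction `v` tangent to `M` gives `P (D_v P) P = 0`. -/
theorem tangentProj_fderiv_apply (hE : IsTangentExtension d M x Q K B C r₀) {v a : Eucl n}
    (hv : v ∈ tangentSpaceOf M x) (ha : a ∈ tangentSpaceOf M x) :
    tangentProj M x (fderiv ℝ Q x v a) = 0 := by
  have hQa : Q x a = a := by
    rw [hE.eq_self]; exact Submodule.starProjection_eq_self_iff.2 ha
  rw [← hE.eq_self]
  refine Submodule.span_induction (p := fun v _ => Q x (fderiv ℝ Q x v a) = 0) ?_ (by simp)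
    (fun u w _ _ hu hw => by rw [map_add, add_apply, map_add, hu, hw, add_zero])
    (fun t u _ hu => by rw [map_smul, smul_apply, map_smul, hu, smul_zero]) hv
  rintro v ⟨γ, hγ0, hγM, hγ⟩
  have hQ' : HasDerivAt (fun t => Q (γ t)) (fderiv ℝ Q x v) 0 := by
    have h1 := (hE.contDiff.differentiable one_ne_zero (γ 0)).hasFDerivAt.comp_hasDerivAt 0 hγ
    rw [hγ0] at h1
    exact h1
  have hsq : (fun t => (Q (γ t)).comp (Q (γ t))) =ᶠ[𝓝 0] fun t => Q (γ t) := by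
    have hb : ∀ᶠ t in 𝓝 0, γ t ∈ Metric.ball x r₀ := by
      refine hγ.continuousAt.eventually (Metric.isOpen_ball.mem_nhds ?_)
      rw [hγ0]; exact Metric.mem_ball_self hE.radius_pos
    filter_upwards [hγM, hb] with t h1 h2
    rw [hE.eq_tangentProj _ ⟨h1, h2⟩]
    ext1 w
    exact Submodule.starProjection_eq_self_iff.2 (Submodule.starProjection_apply_mem _ _)
  have h2 := (hQ'.clm_comp hQ').unique (hQ'.congr_of_eventuallyEq hsq)
  have h3 := congrArg (fun A : Eucl n →L[ℝ] Eucl n => A a) h2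
  simp only [add_apply, ContinuousLinearMap.comp_apply, hγ0, hQa] at h3
  simpa using h3

/-- At `x` the correction term of `perpField` does not contribute to the tangential divergence. -/
theorem planeDiv_perpField (hE : IsTangentExtension d M x Q K B C r₀) (i j k : Fin n) :
    planeDiv (fun w => perpField (entryMatrix (Q x)) i j k (Q w)) x (tangentProj M x) =
      planeDensity Q i j k x := by
  set c := entryMatrix (Q x) with hc
  set a : Eucl n := WithLp.toLp 2 (c i) with ha
  have haT : a ∈ tangentSpaceOf M x := by
    have h1 : a = tangentProj M x (EuclideanSpace.single i 1) := by
      ext l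
      rw [ha, PiLp.toLp_apply, hc, entryMatrix, Matrix.of_apply, hE.eq_self, tangentProj,
        entry_starProjection_symm]
      rfl
    rw [h1]
    exact Submodule.starProjection_apply_mem _ _
  have hQd : HasFDerivAt Q (fderiv ℝ Q x) x :=
    (hE.contDiff.differentiable one_ne_zero x).hasFDerivAt
  set A : Eucl n →L[ℝ] Eucl n := (fderiv ℝ Q x).flip a with hA
  have hQa : HasFDerivAt (fun w => Q w a) A x := by
    have h1 := hQd.clm_apply (hasFDerivAt_const a x)
    refine h1.congr_fderiv ?_
    ext1 v
    simp [hA]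
  have h0d : HasFDerivAt (fun w => perpField 0 i j k (Q w))
      (fderiv ℝ (fun w => perpField 0 i j k (Q w)) x) x :=
    ((contDiff_perpField 0 i j k hE.contDiff).differentiable one_ne_zero x).hasFDerivAt
  have hFd : HasFDerivAt (fun w => perpField c i j k (Q w))
      (fderiv ℝ (fun w => perpField 0 i j k (Q w)) x - c j k • A) x := by
    refine (h0d.sub (hQa.const_smul (c j k))).congr_of_eventuallyEq (Eventually.of_forall fun w => ?_)
    simp [perpField, ha]
  have htr : LinearMap.trace ℝ (Eucl n) (A.comp (tangentProj M x) : Eucl n →ₗ[ℝ] Eucl n) = 0 := by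
    have h1 : ((A.comp (tangentProj M x) : Eucl n →L[ℝ] Eucl n) : Eucl n →ₗ[ℝ] Eucl n) =
        (A.comp (tangentProj M x) : Eucl n →ₗ[ℝ] Eucl n) ∘ₗ
          (tangentProj M x : Eucl n →ₗ[ℝ] Eucl n) := by
      ext1 v
      change A (tangentProj M x v) = A (tangentProj M x (tangentProj M x v))
      congr 1
      exact (Submodule.starProjection_eq_self_iff.2 (Submodule.starProjection_apply_mem _ _)).symm
    rw [h1, LinearMap.trace_comp_comm']
    have h2 : (tangentProj M x : Eucl n →ₗ[ℝ] Eucl n) ∘ₗ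
        (A.comp (tangentProj M x) : Eucl n →ₗ[ℝ] Eucl n) = 0 := by
      ext1 v
      exact hE.tangentProj_fderiv_apply (Submodule.starProjection_apply_mem _ v) haT
    rw [h2, map_zero]
  rw [planeDensity, planeDiv, planeDiv, hFd.fderiv, hE.eq_self, ContinuousLinearMap.sub_comp,
    ContinuousLinearMap.smul_comp]
  change LinearMap.trace ℝ (Eucl n) (_ - c j k • _) = _
  rw [map_sub, map_smul, htr, smul_zero, sub_zero]

/-- For the submanifold itself, the approximate orthogonal forms converge to the density of the
variation as the scale tends to zero. -/
theorem tendsto_betaPerp (hE : IsTangentExtension d M x Q K B C r₀) (hd : 1 ≤ d)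
    {ρ ξ : ℝ → ℝ} (hker : IsKernelPair n ρ ξ) (hΩ : IsOpen Ω) (hxΩ : x ∈ Ω)
    (hν : V.IsDisintegration ν) (hVM : V.mass = surfaceMeasure d M)
    (hνM : ∀ y ∈ M, ∃ S : Gr d n, S.1 = tangentProj M y ∧ ν y = Measure.dirac S) (i j k : Fin n) :
    Tendsto (fun ε => V.betaPerp ν ρ ξ ε x i j k) (𝓝[>] 0) (𝓝 (planeDensity Q i j k x)) := by
  obtain ⟨L, hg⟩ := hker.deriv_rho_lipschitz
  obtain ⟨Lξ, hξ⟩ := hker.contDiff_xi.exists_lipschitzOnWith_of_eq_zero hker.xi_eq_zero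
  have h0 := hker.deriv_rho_zero
  have h1 := hker.profileDeriv_eq_zero
  have hCξ := hker.kernelConst_xi_pos hd
  have hCρ := hker.kernelConst_rho_pos hd
  obtain ⟨r, hr, hrΩ⟩ := Metric.isOpen_iff.1 hΩ x hxΩ
  have h3 : Tendsto (fun ε : ℝ => ε) (𝓝[>] 0) (𝓝 0) := tendsto_nhdsWithin_of_tendsto_nhds tendsto_id
  have hF := contDiff_perpField (entryMatrix (Q x)) i j k hE.contDiff
  have hN := tendsto_integral_inner_radialField hd (fun s hs hs' => hE.isGraphAt_self hs hs')
    hE.radius_pos hE.measurableSet hE.const_nonneg (hE.finrank_eq x hE.mem) hker.hasDerivWithinAt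
    hg h0 h1 hker.rho_eq_zero (F := fun w => perpField (entryMatrix (Q x)) i j k (Q w))
    hF.continuous (hF.differentiable one_ne_zero x).hasFDerivAt
    (hE.perpField_mem _ i j k ⟨hE.mem, Metric.mem_ball_self hE.radius_pos⟩)
  have hdiv := hE.planeDiv_perpField i j k
  rw [planeDiv] at hdiv
  rw [hdiv] at hN
  have hT := hE.tendsto_massIntegral hd hξ hker.xi_eq_zero
  have hlim := (hN.div hT hCξ.ne').const_mul (-(kernelConst d ξ / kernelConst d ρ))
  have e : -(kernelConst d ξ / kernelConst d ρ) *
      (-(kernelConst d ρ * planeDensity Q i j k x) / kernelConst d ξ) = planeDensity Q i j k x := by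
    field_simp
  rw [e] at hlim
  refine hlim.congr' ?_
  filter_upwards [eventually_small_scale hE.radius_pos C, h3.eventually_lt_const hr]
    with ε ⟨e1, e2, _⟩ e5
  have hcl : Metric.closedBall x ε ⊆ Ω := (Metric.closedBall_subset_ball e5).trans hrΩ
  rw [V.betaPerp_eq ν hker e1 hcl, hE.meanPlane_eq hνM,
    hE.perpIntegral_eq hΩ hν hVM hνM hg h0 h1 e1 (by linarith) hcl, hVM]
  congr 1
  simp only [Pi.div_apply]
  have hp : ε ^ d ≠ 0 := by positivity
  rw [pow_succ, mul_inv, mul_assoc, mul_div_mul_left _ _ (inv_ne_zero hp), mul_div_assoc]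

end IsTangentExtension

end Density

end

theorem mainTheorem2 {d n : ℕ} (hd : 1 ≤ d) (hdn : d ≤ n)
    (ρ ξ : ℝ → ℝ) (hker : IsKernelPair n ρ ξ)
    (Ω : Set (Eucl n)) (hΩ : IsOpen Ω)
    (M : Set (Eucl n)) (hMΩ : M ⊆ Ω) (hM : IsC2Submanifold d M)
    -- the varifold `V = v(M, 1)`, with `V = ‖V‖ ⊗ ν` and `ν_y = δ_{T_y M}` for `y ∈ M`
    (V : Varifold d Ω) (hV : V.IsUnitOn M)
    (ν : ProbabilityTheory.Kernel (Eucl n) (Gr d n)) (hν : V.IsDisintegration ν)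
    (hνM : ∀ y ∈ M, ∃ S : Gr d n, S.1 = tangentProj M y ∧ ν y = Measure.dirac S)
    -- a `C¹` extension `P` of the tangent map to a neighbourhood `N` of `M`
    (N : Set (Eucl n)) (hN : IsOpen N) (hMN : M ⊆ N)
    (P : Eucl n → (Eucl n →L[ℝ] Eucl n)) (hP : ContDiffOn ℝ 1 P N)
    (hPM : ∀ y ∈ M, P y = tangentProj M y)
    -- the approximating varifolds `V_h = ‖V_h‖ ⊗ ν^h`
    (W : ℕ → Varifold d Ω)
    (νW : ℕ → ProbabilityTheory.Kernel (Eucl n) (Gr d n))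
    (hνW : ∀ h, (W h).IsDisintegration (νW h))
    (x : Eucl n) (hx : x ∈ M)
    (z : ℕ → Eucl n) (hzΩ : ∀ h, z h ∈ Ω) (hz : Tendsto z atTop (𝓝 x))
    (hzW : ∀ h, z h ∈ (W h).mass.support)
    (η d₁ d₂ ε : ℕ → ℝ)
    (hη : (∀ h, 0 < η h) ∧ Antitone η ∧ Tendsto η atTop (𝓝 0))
    (hd₁ : (∀ h, 0 < d₁ h) ∧ Antitone d₁ ∧ Tendsto d₁ atTop (𝓝 0))
    (hd₂ : (∀ h, 0 < d₂ h) ∧ Antitone d₂ ∧ Tendsto d₂ atTop (𝓝 0))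
    (hε : (∀ h, 0 < ε h) ∧ Antitone ε ∧ Tendsto ε atTop (𝓝 0))
    -- closeness of the masses on all balls in a neighbourhood of `x`
    (hmass : ∃ U ∈ 𝓝 x, ∀ h, ∀ y ∈ V.mass.support, ∀ r : ℝ, 0 < r →
      Metric.ball y r ⊆ Ω → Metric.ball y r ⊆ U →
      bLipDist Ω (Metric.ball y r) V.mass (W h).mass ≤
        ENNReal.ofReal (d₁ h) *
          min (V.mass (Metric.thickening (η h) (Metric.ball y r)))
            ((W h).mass (Metric.thickening (η h) (Metric.ball y r))))
    -- closeness of the tangent planes near `x`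
    (hplane : ∀ᶠ h in atTop, ∀ y ∈ Metric.ball x (ε h + dist x (z h)) ∩ (W h).mass.support,
      ∫ S, ‖P y - S.1‖ ∂(νW h y) ≤ d₂ h) :
    -- the estimate for the approximate orthogonal forms
    ((η =O[atTop] ε ∧ (fun h => d₁ h + dist x (z h)) =o[atTop] ε) →
      ∃ C : ℝ, 0 < C ∧ ∀ᶠ h in atTop, ∀ i j k : Fin n,
        max
          |(W h).betaPerp (νW h) ρ ξ (ε h) (z h) i j k - V.betaPerp ν ρ ξ (ε h) x i j k|
          |(W h).formPerp (νW h) ρ ξ (ε h) (z h) i j k - V.formPerp ν ρ ξ (ε h) x i j k|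
        ≤ C * ((d₁ h + d₂ h + dist x (z h)) / ε h)) ∧
    -- near `x` the density `β^V` exists and has a representative which is continuous on `M`
    (∃ U : Set (Eucl n), IsOpen U ∧ x ∈ U ∧ U ⊆ Ω ∧
      ∃ β : Fin n → Fin n → Fin n → Eucl n → ℝ, V.IsVariationDensity U β ∧
        ∀ i j k, ContinuousOn (β i j k) (M ∩ U)) ∧
    -- convergence to the value at `x` of that representative
    ((fun h => d₁ h + d₂ h + η h + dist x (z h)) =o[atTop] ε →
      ∀ (U : Set (Eucl n)) (β : Fin n → Fin n → Fin n → Eucl n → ℝ),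
        IsOpen U → x ∈ U → U ⊆ Ω → V.IsVariationDensity U β →
        (∀ i j k, ContinuousWithinAt (β i j k) M x) →
        ∀ i j k, Tendsto (fun h => (W h).betaPerp (νW h) ρ ξ (ε h) (z h) i j k)
          atTop (𝓝 (β i j k x))) := by
  have hxΩ : x ∈ Ω := hMΩ hx
  have hT : ∀ y ∈ M, ∃ S : Gr d n, S.1 = tangentProj M y := fun y hy =>
    (hνM y hy).imp fun S hS => hS.1
  have hVM := hV.mass_eq hT
  obtain ⟨Q, K, B, C, r₀, hE, hQP⟩ := exists_isTangentExtension hdn hM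
    (fun y hy => finrank_tangentSpaceOf (hT y hy)) hx hN (hMN hx) hP hPM
  have hest := fun hηε ho => hE.exists_perp_sub_le hd hker hΩ hxΩ hν hVM hνM hQP hνW hzW hη.1 hd₁.1
    hd₂.1 hε.1 hε.2.2 hmass hplane hηε ho
  obtain ⟨R, hR, hRΩ, hden⟩ := hE.exists_isVariationDensity hd hker hΩ hxΩ hν hVM hνM
  refine ⟨fun h => hest h.1 h.2, ⟨Metric.ball x R, Metric.isOpen_ball, Metric.mem_ball_self hR, hRΩ,
    planeDensity Q, hden, fun i j k => (continuous_planeDensity hE.contDiff i j k).continuousOn⟩,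
    fun ho U β hU hxU hUΩ hβ hβc i j k => ?_⟩
  -- the value of `β` at `x` is that of the explicit density
  obtain ⟨Lξ, hξ⟩ := hker.contDiff_xi.exists_lipschitzOnWith_of_eq_zero hker.xi_eq_zero
  have hval : β i j k x = planeDensity Q i j k x := by
    refine hβ.apply_eq hden hU Metric.isOpen_ball hUΩ hxU (Metric.mem_ball_self hR) (M := M) ?_ ?_
      i j k (hβc i j k) (continuous_planeDensity hE.contDiff i j k).continuousWithinAt
    · rw [hVM]
      exact ae_restrict_mem hE.measurableSet
    · intro r hr
      rw [hVM]
      exact hE.surfaceMeasure_ball_pos hd hξ hker.xi_eq_zero (hker.kernelConst_xi_pos hd) hr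
  have hle : ∀ {f : ℕ → ℝ}, (∀ h, 0 ≤ f h) →
      (∀ h, f h ≤ d₁ h + d₂ h + η h + dist x (z h)) → f =o[atTop] ε := fun h0 h1 =>
    (Asymptotics.IsBigO.of_bound' (Eventually.of_forall fun h => by
      rw [Real.norm_of_nonneg (h0 h)]
      exact (h1 h).trans (le_abs_self _))).trans_isLittleO ho
  have hd₁0 := fun h => (hd₁.1 h).le
  have hd₂0 := fun h => (hd₂.1 h).le
  have hη0 := fun h => (hη.1 h).le
  have ht0 : ∀ h, 0 ≤ dist x (z h) := fun h => dist_nonneg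
  obtain ⟨C', hC', hCev⟩ := hest
    (hle hη0 fun h => by linarith [hd₁0 h, hd₂0 h, ht0 h]).isBigO
    (hle (fun h => add_nonneg (hd₁0 h) (ht0 h)) fun h => by linarith [hd₂0 h, hη0 h])
  have hsmall : Tendsto (fun h => C' * ((d₁ h + d₂ h + dist x (z h)) / ε h)) atTop (𝓝 0) := by
    have h1 : (fun h => d₁ h + d₂ h + dist x (z h)) =o[atTop] ε :=
      hle (fun h => add_nonneg (add_nonneg (hd₁0 h) (hd₂0 h)) (ht0 h)) fun h => by linarith [hη0 h]
    simpa using h1.tendsto_div_nhds_zero.const_mul C'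
  have hdiff : Tendsto (fun h => (W h).betaPerp (νW h) ρ ξ (ε h) (z h) i j k -
      V.betaPerp ν ρ ξ (ε h) x i j k) atTop (𝓝 0) := by
    rw [tendsto_zero_iff_norm_tendsto_zero]
    refine squeeze_zero' (Eventually.of_forall fun _ => norm_nonneg _) ?_ hsmall
    filter_upwards [hCev] with h hh
    exact (le_max_left _ _).trans (hh i j k)
  have hε' : Tendsto ε atTop (𝓝[>] 0) :=
    tendsto_nhdsWithin_iff.2 ⟨hε.2.2, Eventually.of_forall hε.1⟩
  have hlim := hdiff.add ((hE.tendsto_betaPerp hd hker hΩ hxΩ hν hVM hνM i j k).comp hε')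
  rw [zero_add] at hlim
  rw [hval]
  refine hlim.congr fun h => ?_
  simp
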